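/- **Setting.** Let $f:\mathbb R^n\to\mathbb R$ be $C^2$, with $M$-Lipschitz gradient and $L$-Lipschitz Hessian ($M,L>0$; operator norm for the Hessian). Let $m>0$ be such that every eigenvalue $\lambda$ of $\nabla^2 f$ at every critical point of $f$ satisfies $|\lambda|>2m$. A *saddle* is a critical point at which the Hessian has a negative eigenvalue. Let $\alpha\in(0,\tfrac12)$, $\beta,\gamma,\zeta\in(0,1)$, $0<\delta\le\min\{\tfrac{3m^2}{L}(1-2\alpha),\tfrac{m^2}{5L}\}$ and $$0<\varepsilon<\min\Big\{\frac{\zeta\delta m}{2M\sqrt n+m},\ \frac{2m^4\gamma}{5L(2M\sqrt n+m)^2}\Big\}.$$ For a saddle $c$ let $\mathcal N_c$ be the open ball of radius $m/L$ around $c$, let $\nabla f_-(x)$ be the orthogonal projection of $\nabla f(x)$ on the span of the eigenvectors of $\nabla^2f(c)$ with negative eigenvalue, and let the *good region* be $$\mathcal G_c=\Big\{x\in\mathcal N_c:\ \|\nabla f_-(x)\|>\gamma\varepsilon,\ \|\nabla f(x)\|<\zeta\delta,\ \|\nabla f_-(x)\|\ge\frac{5L}{2m^2}\|\nabla f(x)\|^2\Big\}.$$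 An *NCN step* maps $x$ to $x-\eta H_m(x)^{-1}\nabla f(x)$. Here $H_m(x)^{-1}$ has the orthonormal eigenvectors of $\nabla^2f(x)$, with each eigenvalue $\lambda$ replaced by $1/\max\{|\lambda|,m\}$, and $\eta=\beta^j$ for the least $j\ge0$ with $f(x-\eta H_m(x)^{-1}\nabla f(x))\le f(x)-\alpha\eta\nabla f(x)^\top H_m(x)^{-1}\nabla f(x)$. The *algorithm* starts at $x_0$. When a test is due (first at $k=0$) and $\|\nabla f(x_k)\|<\varepsilon$: if $\nabla^2f(x_k)$ has a negative eigenvalue, a fresh perturbation $X_k$ is drawn, with independent $N(0,\sigma^2)$ coordinates of standard deviation $\sigma=2\varepsilon/m$; otherwise the algorithm has stopped. If $\|\nabla f(x_k+X_k)\|\le(2\sqrt n\tfrac Mm+1)\varepsilon$, the perturbation is accepted, $x_{k+1}=x_k+X_k$, and the next $K=\lceil 1+\log(1/\gamma)/\log(2-\zeta)\rceil$ iterations are NCN steps, made without a test; otherwise it is rejected, $x_{k+1}=x_k$, and a new one is drawn in the next iteration. If a test is due and $\|\nabla f(x_k)\|\ge\varepsilon$, an NCN step is made and a test is due again. A perturbation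 is *drawn at* the saddle $c$ if it is drawn while $x_k\in\mathcal N_c$. All draws, including rejected ones, are counted. **Proposition.** 1. For every saddle $c$ and every $x\in\mathcal N_c$ with $\|\nabla f(x)\|<\varepsilon$, a perturbation drawn at $x$ is accepted and satisfies $x+X\in\mathcal G_c$ with probability greater than $$2\,(1-\Phi(1))\,\frac{\gamma(n/2,n/2)}{\Gamma(n/2)},$$ where $\Phi$ is the standard normal distribution function and $\gamma(\cdot,\cdot)$ in this display is the lower incomplete gamma function. 2. Escape from $\mathcal G_c$ is exponential with base $2-\zeta$: if $c$ is a saddle, $y_0\in\mathcal G_c$, the points $y_1,y_2,\dots$ are obtained by NCN steps, and $\|\nabla f(y_j)\|<\zeta\delta$ for all $j\le k$, then $\|\nabla f_-(y_{k+1})\|>(2-\zeta)^k\gamma\varepsilon$. 3. For every noise sequence: if a perturbation is drawn at the saddle $c$ in iteration $k$ and $x_{k+1}\in\mathcal N_c$, then there is $k'$ with $k<k'\le k+K+2$ such that $x_{k'}\in\mathcal G_c$ or a new perturbation is drawn at $c$ in iteration $k'$. 4. Let $q\in(0,1)$ be a lower bound for the probability in 1, over all saddles $c$ and all $x\in\mathcal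 N_c$ with $\|\nabla f(x)\|<\varepsilon$. Let $p\in(0,1)$, let $S\ge1$ be an integer, and let $$N=\Big\lceil\frac{\log(S/p)}{\log(1/(1-q))}\Big\rceil.$$ If the noise vectors are independent, then with probability at least $1-p$ the following holds for each of the first $S$ saddles at which a perturbation is drawn (hence for all of them, if there are at most $S$): the iterate enters the good region $\mathcal G_c$ of that saddle $c$ after at least one and at most $N$ perturbations drawn at $c$, unless fewer than $N$ perturbations are ever drawn at $c$ and the last of them carries the iterate out of $\mathcal N_c$. -/

import Mathlib

open MeasureTheory ProbabilityTheory

namespace NonconvexNewton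

noncomputable section

/-- The numerical data: `m` is the truncation level of the PT-inverse, `M` and `L` are Lipschitz
constants of the gradient and of the Hessian, `α` and `β` are the line-search parameters, `γ`, `ζ`,
`δ` are the constants of the good region, and `ε` is the gradient tolerance. -/
structure Params where
  (m M L α β γ ζ δ ε : ℝ)

variable {n : ℕ}

/-- The Hessian of `f` at `x`, as an operator. -/
def hessian (f : EuclideanSpace ℝ (Fin n) → ℝ) (x : EuclideanSpace ℝ (Fin n)) :
    EuclideanSpace ℝ (Fin n) →L[ℝ] EuclideanSpace ℝ (Fin n) :=
  fderiv ℝ (gradient f) x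

/-- `μ` is an eigenvalue of the Hessian of `f` at `x`. -/
def IsHessianEigenvalue (f : EuclideanSpace ℝ (Fin n) → ℝ) (x : EuclideanSpace ℝ (Fin n))
    (μ : ℝ) : Prop :=
  Module.End.HasEigenvalue (hessian f x).toLinearMap μ

/-- The Hessian of `f` at `x` has a negative eigenvalue. -/
def HasNegativeCurvature (f : EuclideanSpace ℝ (Fin n) → ℝ) (x : EuclideanSpace ℝ (Fin n)) :
    Prop :=
  ∃ μ < 0, IsHessianEigenvalue f x μ

/-- A saddle: a critical point at which the Hessian has a negative eigenvalue. -/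
def IsSaddle (f : EuclideanSpace ℝ (Fin n) → ℝ) (c : EuclideanSpace ℝ (Fin n)) : Prop :=
  gradient f c = 0 ∧ HasNegativeCurvature f c

/-- The span of the eigenvectors with negative eigenvalue of the Hessian at `c`. -/
def negSpace (f : EuclideanSpace ℝ (Fin n) → ℝ) (c : EuclideanSpace ℝ (Fin n)) :
    Submodule ℝ (EuclideanSpace ℝ (Fin n)) :=
  ⨆ μ : {μ : ℝ // μ < 0}, Module.End.eigenspace (hessian f c).toLinearMap μ

/-- The component `∇f₋(x)` of the gradient at `x` in the negative eigenspace of the Hessian at the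
critical point `c`. -/
def gradNeg (f : EuclideanSpace ℝ (Fin n) → ℝ) (c x : EuclideanSpace ℝ (Fin n)) :
    EuclideanSpace ℝ (Fin n) :=
  (negSpace f c).starProjection (gradient f x)

open Classical in
/-- The PT-inverse `|T|ₘ⁻¹` of a symmetric operator `T`, applied to a vector: same orthonormal
eigenbasis as `T`, and each eigenvalue `μ` is replaced by `1 / |μ|` if `|μ| ≥ m` and by `1 / m`
otherwise. -/
def ptInverse (m : ℝ) (T : EuclideanSpace ℝ (Fin n) →L[ℝ] EuclideanSpace ℝ (Fin n))
    (v : EuclideanSpace ℝ (Fin n)) : EuclideanSpace ℝ (Fin n) :=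
  if hT : T.toLinearMap.IsSymmetric then
    ∑ i : Fin n, ((max |hT.eigenvalues finrank_euclideanSpace_fin i| m)⁻¹ *
      inner ℝ (hT.eigenvectorBasis finrank_euclideanSpace_fin i) v) •
        hT.eigenvectorBasis finrank_euclideanSpace_fin i
  else 0

/-- The descent direction of the nonconvex Newton method. -/
def newtonDir (f : EuclideanSpace ℝ (Fin n) → ℝ) (θ : Params) (x : EuclideanSpace ℝ (Fin n)) :
    EuclideanSpace ℝ (Fin n) :=
  -ptInverse θ.m (hessian f x) (gradient f x)

/-- The number of times the backtracking line search shrinks the step size by the factor `β`. -/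
def backtracks (f : EuclideanSpace ℝ (Fin n) → ℝ) (θ : Params) (x : EuclideanSpace ℝ (Fin n)) :
    ℕ :=
  sInf {j : ℕ | f (x + θ.β ^ j • newtonDir f θ x) ≤
    f x + θ.α * θ.β ^ j * inner ℝ (gradient f x) (newtonDir f θ x)}

/-- One step of the nonconvex Newton (NCN) method, with backtracking line search. -/
def ncnStep (f : EuclideanSpace ℝ (Fin n) → ℝ) (θ : Params) (x : EuclideanSpace ℝ (Fin n)) :
    EuclideanSpace ℝ (Fin n) :=
  x + θ.β ^ backtracks f θ x • newtonDir f θ x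

/-- The neighbourhood of a critical point `c`. -/
def nbhd (θ : Params) (c : EuclideanSpace ℝ (Fin n)) : Set (EuclideanSpace ℝ (Fin n)) :=
  Metric.ball c (θ.m / θ.L)

/-- The good region `𝒢` of the saddle `c`. -/
def goodRegion (f : EuclideanSpace ℝ (Fin n) → ℝ) (θ : Params) (c : EuclideanSpace ℝ (Fin n)) :
    Set (EuclideanSpace ℝ (Fin n)) :=
  {x | x ∈ nbhd θ c ∧ θ.γ * θ.ε < ‖gradNeg f c x‖ ∧ ‖gradient f x‖ < θ.ζ * θ.δ ∧
    5 * θ.L / (2 * θ.m ^ 2) * ‖gradient f x‖ ^ 2 ≤ ‖gradNeg f c x‖}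

/-- The law of the noise: independent centred Gaussian coordinates of standard deviation
`2 ε / m`. -/
def noiseLaw (n : ℕ) (θ : Params) : Measure (EuclideanSpace ℝ (Fin n)) :=
  (Measure.pi fun _ : Fin n => gaussianReal 0 (Real.toNNReal ((2 * θ.ε / θ.m) ^ 2))).map
    (WithLp.toLp 2)

/-- A perturbed point `y` is kept only if its gradient is not too large. -/
def Accepted (f : EuclideanSpace ℝ (Fin n) → ℝ) (θ : Params) (y : EuclideanSpace ℝ (Fin n)) :
    Prop :=
  ‖gradient f y‖ ≤ (2 * √n * (θ.M / θ.m) + 1) * θ.ε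

/-- The number of NCN steps performed after an accepted perturbation before the perturbation test is
made again. -/
def waitSteps (θ : Params) : ℕ :=
  ⌈1 + Real.log (1 / θ.γ) / Real.log (2 - θ.ζ)⌉₊

/-- In the state `(x, w)`, where `x` is the iterate and `w` the number of NCN steps still to be
performed before the next test, the iterate is perturbed. -/
def Perturbs (f : EuclideanSpace ℝ (Fin n) → ℝ) (θ : Params)
    (s : EuclideanSpace ℝ (Fin n) × ℕ) : Prop :=
  s.2 = 0 ∧ ‖gradient f s.1‖ < θ.ε ∧ HasNegativeCurvature f s.1

open Classical in
/-- One iteration of the NCN method with noise `v`. If the iterate is to be perturbed, `v` is added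
to it; a rejected perturbation is undone, so that a new one is drawn in the next iteration. If the
gradient is small and there is no negative curvature, the method has stopped. Otherwise an NCN step
is made. -/
def iteration (f : EuclideanSpace ℝ (Fin n) → ℝ) (θ : Params)
    (s : EuclideanSpace ℝ (Fin n) × ℕ) (v : EuclideanSpace ℝ (Fin n)) :
    EuclideanSpace ℝ (Fin n) × ℕ :=
  if Perturbs f θ s then
    if Accepted f θ (s.1 + v) then (s.1 + v, waitSteps θ) else s
  else if s.2 = 0 ∧ ‖gradient f s.1‖ < θ.ε then s
  else (ncnStep f θ s.1, s.2 - 1)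

/-- The state after `k` iterations, started at `x₀`, with the noise sequence `v`. -/
def state (f : EuclideanSpace ℝ (Fin n) → ℝ) (θ : Params) (x₀ : EuclideanSpace ℝ (Fin n))
    (v : ℕ → EuclideanSpace ℝ (Fin n)) : ℕ → EuclideanSpace ℝ (Fin n) × ℕ
  | 0 => (x₀, 0)
  | k + 1 => iteration f θ (state f θ x₀ v k) (v k)

/-- The iterate `x_k`. -/
def iterate (f : EuclideanSpace ℝ (Fin n) → ℝ) (θ : Params) (x₀ : EuclideanSpace ℝ (Fin n))
    (v : ℕ → EuclideanSpace ℝ (Fin n)) (k : ℕ) : EuclideanSpace ℝ (Fin n) :=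
  (state f θ x₀ v k).1

/-- A perturbation is drawn at `c` in iteration `k`: the iterate `x_k` lies in the neighbourhood of
`c` and is perturbed. -/
def DrawsAt (f : EuclideanSpace ℝ (Fin n) → ℝ) (θ : Params) (x₀ : EuclideanSpace ℝ (Fin n))
    (v : ℕ → EuclideanSpace ℝ (Fin n)) (c : EuclideanSpace ℝ (Fin n)) (k : ℕ) : Prop :=
  Perturbs f θ (state f θ x₀ v k) ∧ iterate f θ x₀ v k ∈ nbhd θ c

open Classical in
/-- The number of perturbations drawn at `c` before iteration `k`. -/
def numDraws (f : EuclideanSpace ℝ (Fin n) → ℝ) (θ : Params) (x₀ : EuclideanSpace ℝ (Fin n))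
    (v : ℕ → EuclideanSpace ℝ (Fin n)) (c : EuclideanSpace ℝ (Fin n)) (k : ℕ) : ℕ :=
  Nat.count (DrawsAt f θ x₀ v c) k

/-- The set of saddles at which a perturbation has been drawn in one of the iterations `0, …, k`. -/
def visited (f : EuclideanSpace ℝ (Fin n) → ℝ) (θ : Params) (x₀ : EuclideanSpace ℝ (Fin n))
    (v : ℕ → EuclideanSpace ℝ (Fin n)) (k : ℕ) : Set (EuclideanSpace ℝ (Fin n)) :=
  {c | IsSaddle f c ∧ ∃ j ≤ k, DrawsAt f θ x₀ v c j}

/-- The iterate enters the good region of `c` after at least one and at most `N` perturbations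
drawn at `c`. -/
def EntersGoodRegion (f : EuclideanSpace ℝ (Fin n) → ℝ) (θ : Params)
    (x₀ : EuclideanSpace ℝ (Fin n)) (v : ℕ → EuclideanSpace ℝ (Fin n))
    (c : EuclideanSpace ℝ (Fin n)) (N : ℕ) : Prop :=
  ∃ k, iterate f θ x₀ v k ∈ goodRegion f θ c ∧
    1 ≤ numDraws f θ x₀ v c k ∧ numDraws f θ x₀ v c k ≤ N

/-- Fewer than `N` perturbations are ever drawn at `c`, and the last one carries the iterate out of
the neighbourhood of `c`. -/
def ThrownOut (f : EuclideanSpace ℝ (Fin n) → ℝ) (θ : Params)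
    (x₀ : EuclideanSpace ℝ (Fin n)) (v : ℕ → EuclideanSpace ℝ (Fin n))
    (c : EuclideanSpace ℝ (Fin n)) (N : ℕ) : Prop :=
  ∃ k, DrawsAt f θ x₀ v c k ∧ iterate f θ x₀ v (k + 1) ∉ nbhd θ c ∧
    (∀ j > k, ¬ DrawsAt f θ x₀ v c j) ∧ numDraws f θ x₀ v c (k + 1) < N

/-- The number `2 (1 - Φ(1)) γ(n/2, n/2) / Γ(n/2)`, where `Φ` is the standard normal distribution
function and `γ(s, x)` is the lower incomplete gamma function. -/
def probBound (n : ℕ) : ℝ :=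
  2 * (1 - cdf (gaussianReal 0 1) 1) *
    ((∫ t in (0 : ℝ)..(n / 2 : ℝ), t ^ ((n / 2 : ℝ) - 1) * Real.exp (-t)) /
      Real.Gamma (n / 2 : ℝ))

/-- `q` is a lower bound for the probability that a single perturbation, drawn at any point with
gradient smaller than `ε` in the neighbourhood of any saddle, is accepted and puts the iterate into
the good region of that saddle. -/
def IsSuccessBound (f : EuclideanSpace ℝ (Fin n) → ℝ) (θ : Params) (q : ℝ) : Prop :=
  ∀ c, IsSaddle f c → ∀ x ∈ nbhd θ c, ‖gradient f x‖ < θ.ε →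
    q ≤ (noiseLaw n θ).real {v | Accepted f θ (x + v) ∧ x + v ∈ goodRegion f θ c}

/-- The number of perturbations `⌈log (S / p) / log (1 / (1 - q))⌉`. -/
def drawBound (S : ℕ) (p q : ℝ) : ℕ :=
  ⌈Real.log (S / p) / Real.log (1 / (1 - q))⌉₊

end

end NonconvexNewton

/-!
The argument has a deterministic part and a probabilistic one.

*One Newton step.* Near a saddle `c` the spectrum of the Hessian avoids `[-m, m]`, so truncation is
inactive there and the full step `y ↦ y - |∇²f(y)|⁻¹ ∇f(y)` is accepted by the line search. To first
order it replaces the gradient by `∇f(y) - sgn(∇²f(y)) ∇f(y)`, which is twice the projection of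
`∇f(y)` on the negative spectral subspace at `y`, up to `L/(2m²) ‖∇f(y)‖²`. That subspace is then
compared with the one at `c`: by `norm_starProjection_le_of_separated`, a bound of Davis–Kahan type,
the two projections differ by a quantity of the order `L ‖y - c‖ / m`, and `‖y - c‖` is of the order
`‖∇f(y)‖ / m`. All errors are therefore quadratic in `‖∇f(y)‖`, and on the good region the quadratic
term is dominated by `‖∇f₋(y)‖`. The first step from there does not decrease `‖∇f₋‖` and makes the
gradient almost parallel to the negative eigenspace; from then on, as long as `‖∇f‖ < ζδ`, each step
multiplies `‖∇f₋‖` by at least `2 - ζ` (`Standing.lt_norm_gradNeg_iterate`). The same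
estimates show that a perturbed point which stays near `c` without being in the good region is
brought back to a small gradient within the `K` untested steps and two more
(`Standing.exists_goodRegion_or_drawsAt`).

*One perturbation.* In units of `σ = 2ε/m` the noise is a standard Gaussian vector. On the event
`‖v‖ ≤ √n σ` the perturbation is accepted, and one negative eigenvector of `∇²f(c)` already gives a
large `‖∇f₋‖` once the corresponding coordinate of the noise avoids a slab of length at most `1` in
these units. `probBound n` thus becomes a lower bound for the Gaussian measure of a ball minus a
slab: on each line the centred interval of length `1` is the worst slab
(`gaussianReal_le_of_volume_le_one`), and the incomplete gamma integral is estimated from the chi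
square law of the norm (`Standing.probBound_lt`).

*Counting.* For a saddle `c` let `failedBefore f θ x₀ S c i k` be the event that the draw in
iteration `k` is made at `c`, is preceded by exactly `i` draws at `c`, all of them unsuccessful, and
that `c` is among the first `S` saddles. It depends only on the noise before iteration `k`, hence is
independent of the draw made in it, and each further draw fails with probability at most `1 - q`.
Summing over iterations, over the countably many saddles (critical points are nondegenerate, hence
isolated) and over the at most `S` of them that matter, the probability that some saddle has its
first `N` draws all fail is at most `S (1 - q) ^ N ≤ p` (`Standing.le_measureReal_enters`).
-/

namespace NonconvexNewton

/-! ### Spectral subspaces of symmetric operators -/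

section Operators

variable {n : ℕ}

local notation "𝔼" k:max => EuclideanSpace ℝ (Fin k)

/-- The span of the eigenvectors of `T` with negative eigenvalue; `negSpace f c` is the case of the
Hessian of `f` at `c`. -/
noncomputable def negEigenspace (T : EuclideanSpace ℝ (Fin n) →L[ℝ] EuclideanSpace ℝ (Fin n)) :
    Submodule ℝ (EuclideanSpace ℝ (Fin n)) :=
  ⨆ μ : {μ : ℝ // μ < 0}, Module.End.eigenspace T.toLinearMap μ

/-- All eigenvalues of `T` are at least `a` in absolute value. -/
def SpectralGap (a : ℝ) (T : EuclideanSpace ℝ (Fin n) →L[ℝ] EuclideanSpace ℝ (Fin n)) : Prop :=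
  ∀ μ, Module.End.HasEigenvalue T.toLinearMap μ → a ≤ |μ|

theorem apply_mem_negEigenspace {T : 𝔼 n →L[ℝ] 𝔼 n} {u : 𝔼 n} (hu : u ∈ negEigenspace T) :
    T u ∈ negEigenspace T := by
  refine Submodule.iSup_induction (fun μ : {μ : ℝ // μ < 0} =>
    Module.End.eigenspace T.toLinearMap μ) (motive := fun u => T u ∈ negEigenspace T) hu ?_ ?_ ?_
  · intro μ x hx
    have h : T x = (μ : ℝ) • x := Module.End.mem_eigenspace_iff.1 hx
    rw [h]
    exact Submodule.smul_mem _ _ (Submodule.mem_iSup_of_mem μ hx)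
  · simp
  · intro x y hx hy
    rw [map_add]
    exact Submodule.add_mem _ hx hy

/-- An orthonormal eigenbasis of `T` in which the PT-inverse is diagonal. -/
theorem exists_orthonormalBasis_eigenvectors {T : 𝔼 n →L[ℝ] 𝔼 n} (hT : T.toLinearMap.IsSymmetric) :
    ∃ (b : OrthonormalBasis (Fin n) ℝ (𝔼 n)) (l : Fin n → ℝ), (∀ i, T (b i) = l i • b i) ∧
      (∀ i, Module.End.HasEigenvalue T.toLinearMap (l i)) ∧
      ∀ m v, ptInverse m T v = ∑ i, ((max |l i| m)⁻¹ * inner ℝ (b i) v) • b i := by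
  refine ⟨hT.eigenvectorBasis finrank_euclideanSpace_fin,
    hT.eigenvalues finrank_euclideanSpace_fin, fun i => ?_, fun i => ?_, fun m v => ?_⟩
  · exact hT.apply_eigenvectorBasis finrank_euclideanSpace_fin i
  · exact hT.hasEigenvalue_eigenvalues finrank_euclideanSpace_fin i
  · rw [ptInverse, dif_pos hT]

section Eigenbasis

variable {T : 𝔼 n →L[ℝ] 𝔼 n} (hT : T.toLinearMap.IsSymmetric) {b : OrthonormalBasis (Fin n) ℝ (𝔼 n)}
  {l : Fin n → ℝ} (hb : ∀ i, T (b i) = l i • b i)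

include hT hb

theorem inner_eigenbasis_apply (i : Fin n) (v : 𝔼 n) :
    inner ℝ (b i) (T v) = l i * inner ℝ (b i) v := by
  have h := hT (b i) v
  simp only [ContinuousLinearMap.coe_coe] at h
  rw [← h, hb, real_inner_smul_left]

theorem inner_apply_self_eq_sum (v : 𝔼 n) :
    inner ℝ (T v) v = ∑ i, l i * inner ℝ (b i) v ^ 2 := by
  rw [← b.sum_inner_mul_inner]
  refine Finset.sum_congr rfl fun i _ => ?_
  rw [real_inner_comm, inner_eigenbasis_apply hT hb]
  ring

theorem inner_eigenbasis_eq_zero_of_mem {i : Fin n} (hi : 0 ≤ l i) {u : 𝔼 n}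
    (hu : u ∈ negEigenspace T) : inner ℝ (b i) u = 0 := by
  refine Submodule.iSup_induction (fun μ : {μ : ℝ // μ < 0} =>
    Module.End.eigenspace T.toLinearMap μ) (motive := fun u => inner ℝ (b i) u = 0) hu ?_ ?_ ?_
  · intro μ x hx
    have h : T x = (μ : ℝ) • x := Module.End.mem_eigenspace_iff.1 hx
    have h2 := inner_eigenbasis_apply hT hb i x
    rw [h, real_inner_smul_right] at h2
    have h3 : ((μ : ℝ) - l i) * inner ℝ (b i) x = 0 := by linarith
    rcases mul_eq_zero.1 h3 with h4 | h4
    · have := μ.2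
      linarith
    · exact h4
  · simp
  · intro x y hx hy
    rw [inner_add_right, hx, hy, add_zero]

omit hT in
theorem eigenbasis_mem {i : Fin n} (hi : l i < 0) : b i ∈ negEigenspace T :=
  Submodule.mem_iSup_of_mem (⟨l i, hi⟩ : {μ : ℝ // μ < 0}) (Module.End.mem_eigenspace_iff.2 (hb i))

theorem inner_eigenbasis_starProjection (i : Fin n) (v : 𝔼 n) :
    inner ℝ (b i) ((negEigenspace T).starProjection v) =
      if l i < 0 then inner ℝ (b i) v else 0 := by
  split_ifs with hi
  · have h := Submodule.starProjection_inner_eq_zero (K := negEigenspace T) v (b i)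
      (eigenbasis_mem hb hi)
    rw [inner_sub_left, real_inner_comm, real_inner_comm (b i)] at h
    linarith
  · exact inner_eigenbasis_eq_zero_of_mem hT hb (not_lt.1 hi)
      (Submodule.starProjection_apply_mem _ _)

end Eigenbasis

theorem starProjection_negEigenspace_apply {T : 𝔼 n →L[ℝ] 𝔼 n} (hT : T.toLinearMap.IsSymmetric)
    (v : 𝔼 n) :
    (negEigenspace T).starProjection (T v) = T ((negEigenspace T).starProjection v) := by
  obtain ⟨b, l, hb, -, -⟩ := exists_orthonormalBasis_eigenvectors hT
  refine b.repr.injective (PiLp.ext fun i => ?_)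
  rw [b.repr_apply_apply, b.repr_apply_apply]
  rw [inner_eigenbasis_starProjection hT hb, inner_eigenbasis_apply hT hb,
    inner_eigenbasis_apply hT hb, inner_eigenbasis_starProjection hT hb]
  split_ifs <;> simp

theorem inner_apply_le_of_mem_negEigenspace {T : 𝔼 n →L[ℝ] 𝔼 n} (hT : T.toLinearMap.IsSymmetric)
    {a : ℝ} (ha : SpectralGap a T) {u : 𝔼 n} (hu : u ∈ negEigenspace T) :
    inner ℝ (T u) u ≤ -(a * ‖u‖ ^ 2) := by
  obtain ⟨b, l, hb, hl, -⟩ := exists_orthonormalBasis_eigenvectors hT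
  rw [inner_apply_self_eq_sum hT hb, ← b.sum_sq_inner_right, Finset.mul_sum,
    ← Finset.sum_neg_distrib]
  refine Finset.sum_le_sum fun i _ => ?_
  rcases le_or_gt 0 (l i) with h | h
  · simp [inner_eigenbasis_eq_zero_of_mem hT hb h hu]
  · have h1 := ha _ (hl i)
    rw [abs_of_neg h] at h1
    nlinarith [sq_nonneg (inner ℝ (b i) u)]

theorem le_inner_apply_of_mem_orthogonal {T : 𝔼 n →L[ℝ] 𝔼 n} (hT : T.toLinearMap.IsSymmetric)
    {a : ℝ} (ha : SpectralGap a T) {u : 𝔼 n} (hu : u ∈ (negEigenspace T)ᗮ) :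
    a * ‖u‖ ^ 2 ≤ inner ℝ (T u) u := by
  obtain ⟨b, l, hb, hl, -⟩ := exists_orthonormalBasis_eigenvectors hT
  rw [inner_apply_self_eq_sum hT hb, ← b.sum_sq_inner_right, Finset.mul_sum]
  refine Finset.sum_le_sum fun i _ => ?_
  rcases lt_or_ge (l i) 0 with h | h
  · simp [(Submodule.mem_orthogonal _ _).1 hu _ (eigenbasis_mem hb h)]
  · have h1 := ha _ (hl i)
    rw [abs_of_nonneg h] at h1
    nlinarith [sq_nonneg (inner ℝ (b i) u)]

theorem norm_apply_ge_of_spectralGap {T : 𝔼 n →L[ℝ] 𝔼 n} (hT : T.toLinearMap.IsSymmetric)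
    {a : ℝ} (ha0 : 0 ≤ a) (ha : SpectralGap a T) (v : 𝔼 n) : a * ‖v‖ ≤ ‖T v‖ := by
  obtain ⟨b, l, hb, hl, -⟩ := exists_orthonormalBasis_eigenvectors hT
  refine abs_le_of_sq_le_sq' ?_ (norm_nonneg _) |>.2
  rw [mul_pow, ← b.sum_sq_inner_right, ← b.sum_sq_inner_right, Finset.mul_sum]
  refine Finset.sum_le_sum fun i _ => ?_
  rw [inner_eigenbasis_apply hT hb, mul_pow, ← sq_abs (l i)]
  have := ha _ (hl i)
  gcongr

theorem SpectralGap.of_norm_sub_le {A B : 𝔼 n →L[ℝ] 𝔼 n} (hA : A.toLinearMap.IsSymmetric)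
    {a d : ℝ} (ha0 : 0 ≤ a) (ha : SpectralGap a A) (hd : ‖B - A‖ ≤ d) :
    SpectralGap (a - d) B := by
  intro μ hμ
  obtain ⟨v, hv⟩ := hμ.exists_hasEigenvector
  have h1 : B v = μ • v := hv.apply_eq_smul
  have h2 := norm_apply_ge_of_spectralGap hA ha0 ha v
  have h3 : ‖(B - A) v‖ ≤ d * ‖v‖ := (B - A).le_of_opNorm_le hd v
  have h4 : ‖A v‖ ≤ ‖B v‖ + ‖(B - A) v‖ := by
    have : A v = B v - (B - A) v := by simp
    rw [this]
    exact norm_sub_le _ _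
  rw [h1, norm_smul, Real.norm_eq_abs] at h4
  have hv0 : 0 < ‖v‖ := norm_pos_iff.2 hv.2
  refine le_of_mul_le_mul_right ?_ hv0
  linarith

theorem exists_neg_eigenvalue_of_inner_neg {T : 𝔼 n →L[ℝ] 𝔼 n} (hT : T.toLinearMap.IsSymmetric)
    {v : 𝔼 n} (hv : inner ℝ (T v) v < 0) :
    ∃ μ < 0, Module.End.HasEigenvalue T.toLinearMap μ := by
  obtain ⟨b, l, hb, hl, -⟩ := exists_orthonormalBasis_eigenvectors hT
  by_contra! h
  rw [inner_apply_self_eq_sum hT hb] at hv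
  refine absurd (Finset.sum_nonneg fun i _ => ?_) (not_le.2 hv)
  have : 0 ≤ l i := by
    by_contra! h0
    exact h _ h0 (hl i)
  positivity

section PTInverse

variable {T : 𝔼 n →L[ℝ] 𝔼 n} (hT : T.toLinearMap.IsSymmetric) {m : ℝ} (hm : 0 < m)
  (hgap : SpectralGap m T)

include hT hm hgap

/-- Under a spectral gap, the PT-inverse is `|T|⁻¹`, and `T |T|⁻¹ = 1 - 2 Q`, where `Q` is the
projection on the negative eigenspace. -/
theorem apply_ptInverse (g : 𝔼 n) :
    T (ptInverse m T g) = g - (2 : ℝ) • (negEigenspace T).starProjection g := by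
  obtain ⟨b, l, hb, hl, hpt⟩ := exists_orthonormalBasis_eigenvectors hT
  refine b.repr.injective (PiLp.ext fun i => ?_)
  rw [b.repr_apply_apply, b.repr_apply_apply]
  rw [inner_eigenbasis_apply hT hb, inner_sub_right, real_inner_smul_right,
    inner_eigenbasis_starProjection hT hb, hpt, b.orthonormal.inner_right_fintype]
  have h1 := hgap _ (hl i)
  rw [max_eq_left h1]
  have h0 : l i ≠ 0 := fun h => by rw [h, abs_zero] at h1; linarith
  split_ifs with hi
  · rw [abs_of_neg hi]
    field_simp
    ring
  · rw [abs_of_nonneg (not_lt.1 hi)]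
    field_simp
    ring

theorem norm_ptInverse_le (g : 𝔼 n) : m * ‖ptInverse m T g‖ ≤ ‖g‖ := by
  obtain ⟨b, l, hb, hl, hpt⟩ := exists_orthonormalBasis_eigenvectors hT
  refine abs_le_of_sq_le_sq' ?_ (norm_nonneg _) |>.2
  rw [mul_pow, ← b.sum_sq_inner_right, ← b.sum_sq_inner_right, Finset.mul_sum]
  refine Finset.sum_le_sum fun i _ => ?_
  rw [hpt, b.orthonormal.inner_right_fintype, max_eq_left (hgap _ (hl i)), mul_pow, ← mul_assoc,
    ← mul_pow]
  refine mul_le_of_le_one_left (sq_nonneg _) (pow_le_one₀ (by positivity) ?_)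
  rw [← div_eq_mul_inv]
  exact div_le_one_of_le₀ (hgap _ (hl i)) (abs_nonneg _)

theorem le_inner_ptInverse (g : 𝔼 n) :
    m * ‖ptInverse m T g‖ ^ 2 ≤ inner ℝ g (ptInverse m T g) := by
  obtain ⟨b, l, hb, hl, hpt⟩ := exists_orthonormalBasis_eigenvectors hT
  rw [← b.sum_inner_mul_inner, ← b.sum_sq_inner_right, Finset.mul_sum]
  refine Finset.sum_le_sum fun i _ => ?_
  have h1 := hgap _ (hl i)
  have h2 : 0 < |l i| := hm.trans_le h1
  rw [hpt, b.orthonormal.inner_right_fintype, max_eq_left h1, real_inner_comm (b i) g]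
  calc m * (|l i|⁻¹ * inner ℝ (b i) g) ^ 2
      ≤ |l i| * (|l i|⁻¹ * inner ℝ (b i) g) ^ 2 := by gcongr
    _ = _ := by field_simp

theorem inner_apply_ptInverse_le (g : 𝔼 n) :
    inner ℝ (T (ptInverse m T g)) (ptInverse m T g) ≤ inner ℝ g (ptInverse m T g) := by
  obtain ⟨b, l, hb, hl, hpt⟩ := exists_orthonormalBasis_eigenvectors hT
  rw [inner_apply_self_eq_sum hT hb, ← b.sum_inner_mul_inner]
  refine Finset.sum_le_sum fun i _ => ?_
  have h1 := hgap _ (hl i)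
  have h2 : 0 < |l i| := hm.trans_le h1
  rw [hpt, b.orthonormal.inner_right_fintype, max_eq_left h1, real_inner_comm (b i) g]
  calc l i * (|l i|⁻¹ * inner ℝ (b i) g) ^ 2
      ≤ |l i| * (|l i|⁻¹ * inner ℝ (b i) g) ^ 2 := by
        gcongr
        exact le_abs_self _
    _ = _ := by field_simp

end PTInverse

/-- One half of the `sin Θ` theorem for spectra separated by a half-line, up to the constant: if `A`
is at most `-a` on `U` and `B` is at least `b` on `V`, then vectors of `V` are almost orthogonal to
`U`. For large `ρ`, `X = P_U P_V` satisfies `X (B + ρ) = P_U (B - A) P_V + (A + ρ) X`, where `B + ρ`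
is at least `b + ρ` on `V` and `A + ρ` is at most `ρ - a / 2` on `U`. -/
theorem norm_starProjection_le_of_separated {A B : 𝔼 n →L[ℝ] 𝔼 n} {U V : Submodule ℝ (𝔼 n)}
    {a b : ℝ} (ha : 0 < a) (hb : 0 < b)
    (hPA : ∀ v, U.starProjection (A v) = A (U.starProjection v))
    (hBV : ∀ v ∈ V, B v ∈ V)
    (hA : ∀ u ∈ U, inner ℝ (A u) u ≤ -(a * ‖u‖ ^ 2))
    (hB : ∀ v ∈ V, b * ‖v‖ ^ 2 ≤ inner ℝ (B v) v) {v : 𝔼 n} (hv : v ∈ V) :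
    (b + a / 2) * ‖U.starProjection v‖ ≤ ‖B - A‖ * ‖v‖ := by
  set ρ : ℝ := ‖A‖ ^ 2 / a + a with hρ
  have hρa : ρ * a = ‖A‖ ^ 2 + a ^ 2 := by rw [hρ]; field_simp
  have hρ0 : a ≤ ρ := by
    have : 0 ≤ ‖A‖ ^ 2 / a := by positivity
    linarith
  set s : ℝ := ‖U.starProjection ∘L V.starProjection‖ with hs
  have hs0 : 0 ≤ s := norm_nonneg _
  have hsv : ∀ w ∈ V, ‖U.starProjection w‖ ≤ s * ‖w‖ := fun w hw => by
    have := (U.starProjection ∘L V.starProjection).le_opNorm w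
    rwa [ContinuousLinearMap.comp_apply, Submodule.starProjection_eq_self_iff.2 hw] at this
  have hAU : ∀ u ∈ U, ‖A u + ρ • u‖ ≤ (ρ - a / 2) * ‖u‖ := fun u hu => by
    refine abs_le_of_sq_le_sq' ?_ (mul_nonneg (by linarith) (norm_nonneg _)) |>.2
    rw [norm_add_sq_real, real_inner_smul_right, norm_smul, Real.norm_eq_abs, mul_pow, sq_abs]
    have h1 := hA u hu
    have h2 : ‖A u‖ ^ 2 ≤ ‖A‖ ^ 2 * ‖u‖ ^ 2 := by
      rw [← mul_pow]
      gcongr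
      exact A.le_opNorm u
    have h3 : ρ * inner ℝ (A u) u ≤ ρ * -(a * ‖u‖ ^ 2) := by gcongr
    have h4 : (ρ - a / 2) ^ 2 = ρ ^ 2 - ‖A‖ ^ 2 - 3 / 4 * a ^ 2 := by linear_combination -hρa
    have h5 : ρ * -(a * ‖u‖ ^ 2) = -(‖A‖ ^ 2 + a ^ 2) * ‖u‖ ^ 2 := by
      rw [← hρa]; ring
    rw [mul_pow, h4]
    nlinarith [sq_nonneg ‖u‖, mul_nonneg (sq_nonneg a) (sq_nonneg ‖u‖)]
  have hBV' : ∀ w ∈ V, (ρ + b) * ‖w‖ ≤ ‖B w + ρ • w‖ := fun w hw => by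
    rcases eq_or_ne w 0 with rfl | hw0
    · simp
    have h0 : 0 < ‖w‖ := norm_pos_iff.2 hw0
    refine le_of_mul_le_mul_right ?_ h0
    calc (ρ + b) * ‖w‖ * ‖w‖ ≤ inner ℝ (B w + ρ • w) w := by
          rw [inner_add_left, real_inner_smul_left, real_inner_self_eq_norm_sq]
          have := hB w hw
          nlinarith
      _ ≤ _ := real_inner_le_norm _ _
  have hsurj : ∀ w ∈ V, ∃ w' ∈ V, B w' + ρ • w' = w := by
    have hmaps : ∀ w ∈ V, (B.toLinearMap + ρ • (LinearMap.id : 𝔼 n →ₗ[ℝ] 𝔼 n)) w ∈ V := fun w hw =>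
      V.add_mem (hBV w hw) (V.smul_mem _ hw)
    have hinj : Function.Injective
        ((B.toLinearMap + ρ • (LinearMap.id : 𝔼 n →ₗ[ℝ] 𝔼 n)).restrict hmaps) := by
      rw [← LinearMap.ker_eq_bot, LinearMap.ker_eq_bot']
      intro w hw
      have h1 : B (w : 𝔼 n) + ρ • (w : 𝔼 n) = 0 := congrArg Subtype.val hw
      have h2 := hBV' w w.2
      rw [h1, norm_zero] at h2
      have h3 : ‖(w : 𝔼 n)‖ = 0 := by
        refine le_antisymm ?_ (norm_nonneg _)
        by_contra! h4
        have : 0 < (ρ + b) * ‖(w : 𝔼 n)‖ := mul_pos (by linarith) h4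
        linarith
      exact Subtype.ext (norm_eq_zero.1 h3)
    intro w hw
    obtain ⟨w', hw'⟩ := LinearMap.surjective_of_injective hinj ⟨w, hw⟩
    exact ⟨w', w'.2, congrArg Subtype.val hw'⟩
  have key : ∀ w ∈ V, (ρ + b) * ‖U.starProjection w‖ ≤ (‖B - A‖ + (ρ - a / 2) * s) * ‖w‖ := by
    intro w hw
    obtain ⟨w', hw', rfl⟩ := hsurj w hw
    have h1 : U.starProjection (B w' + ρ • w') = U.starProjection ((B - A) w') +
        (A (U.starProjection w') + ρ • U.starProjection w') := by
      rw [sub_apply, map_sub, map_add, map_smul, hPA]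
      abel
    have h2 : ‖U.starProjection ((B - A) w')‖ ≤ ‖B - A‖ * ‖w'‖ :=
      (Submodule.norm_starProjection_apply_le _ _).trans ((B - A).le_opNorm w')
    have h3 := hAU _ (Submodule.starProjection_apply_mem U w')
    have h4 : (ρ - a / 2) * ‖U.starProjection w'‖ ≤ (ρ - a / 2) * (s * ‖w'‖) :=
      mul_le_mul_of_nonneg_left (hsv w' hw') (by linarith)
    have h5 : ‖U.starProjection (B w' + ρ • w')‖ ≤ (‖B - A‖ + (ρ - a / 2) * s) * ‖w'‖ := by
      rw [h1]
      refine (norm_add_le _ _).trans ?_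
      linarith
    have h6 : 0 ≤ ‖B - A‖ + (ρ - a / 2) * s :=
      add_nonneg (norm_nonneg _) (mul_nonneg (by linarith) hs0)
    calc (ρ + b) * ‖U.starProjection (B w' + ρ • w')‖
        ≤ (ρ + b) * ((‖B - A‖ + (ρ - a / 2) * s) * ‖w'‖) := by
          gcongr
      _ = (‖B - A‖ + (ρ - a / 2) * s) * ((ρ + b) * ‖w'‖) := by ring
      _ ≤ _ := by gcongr; exact hBV' w' hw'
  have hρb : 0 < ρ + b := by linarith
  have hsle : s ≤ (‖B - A‖ + (ρ - a / 2) * s) / (ρ + b) := by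
    have h6 : 0 ≤ ‖B - A‖ + (ρ - a / 2) * s :=
      add_nonneg (norm_nonneg _) (mul_nonneg (by linarith) hs0)
    refine ContinuousLinearMap.opNorm_le_bound _ (by positivity) fun z => ?_
    have h1 := key _ (Submodule.starProjection_apply_mem V z)
    rw [ContinuousLinearMap.comp_apply, div_mul_eq_mul_div, le_div_iff₀ hρb, mul_comm]
    refine h1.trans ?_
    gcongr
    exact Submodule.norm_starProjection_apply_le _ _
  rw [le_div_iff₀ hρb] at hsle
  have hfin : (b + a / 2) * s ≤ ‖B - A‖ := by linarith
  calc (b + a / 2) * ‖U.starProjection v‖ ≤ (b + a / 2) * (s * ‖v‖) := by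
        gcongr
        exact hsv v hv
    _ = (b + a / 2) * s * ‖v‖ := by ring
    _ ≤ _ := by gcongr

end Operators

/-! ### Second-order calculus -/

section Calculus

variable {n : ℕ} {f : EuclideanSpace ℝ (Fin n) → ℝ}

local notation "𝔼" k:max => EuclideanSpace ℝ (Fin k)

theorem contDiff_gradient (hf : ContDiff ℝ 2 f) : ContDiff ℝ 1 (gradient f) := by
  have h : ContDiff ℝ 1 (fderiv ℝ f) := hf.fderiv_right (by norm_num)
  exact (InnerProductSpace.toDual ℝ (𝔼 n)).symm.contDiff.comp h

theorem hasFDerivAt_gradient (hf : ContDiff ℝ 2 f) (x : 𝔼 n) :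
    HasFDerivAt (gradient f) (hessian f x) x :=
  ((contDiff_gradient hf).differentiable (by norm_num) x).hasFDerivAt

theorem continuous_hessian (hf : ContDiff ℝ 2 f) : Continuous (hessian f) :=
  (contDiff_gradient hf).continuous_fderiv (by norm_num)

theorem hasFDerivAt_of_contDiff (hf : ContDiff ℝ 2 f) (x : 𝔼 n) :
    HasFDerivAt f (innerSL ℝ (gradient f x)) x :=
  (hf.differentiable (by norm_num) x).hasGradientAt.hasFDerivAt

theorem hessian_isSymmetric (hf : ContDiff ℝ 2 f) (x : 𝔼 n) :
    (hessian f x).toLinearMap.IsSymmetric := by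
  intro v w
  have h1 : ∀ v w : 𝔼 n, inner ℝ (hessian f x v) w = fderiv ℝ (fderiv ℝ f) x v w := by
    intro v w
    have h2 : fderiv ℝ f = fun y => innerSL ℝ (gradient f y) :=
      funext fun y => (hasFDerivAt_of_contDiff hf y).fderiv
    have h3 : HasFDerivAt (fun y => innerSL ℝ (gradient f y)) (innerSL ℝ ∘L hessian f x) x :=
      (innerSL ℝ (E := 𝔼 n)).hasFDerivAt.comp x (hasFDerivAt_gradient hf x)
    rw [h2, h3.fderiv]
    rfl
  have h3 : IsSymmSndFDerivAt ℝ f x :=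
    hf.contDiffAt.isSymmSndFDerivAt (by simp)
  simp only [ContinuousLinearMap.coe_coe]
  rw [real_inner_comm _ v, h1, h1, h3.eq]

theorem norm_gradient_sub_sub_le (hf : ContDiff ℝ 2 f) {L : ℝ}
    (hLip : ∀ x y, ‖hessian f x - hessian f y‖ ≤ L * ‖x - y‖) (x d : 𝔼 n) {t : ℝ}
    (ht : t ∈ Set.Icc (0 : ℝ) 1) :
    ‖gradient f (x + t • d) - gradient f x - t • hessian f x d‖ ≤ L / 2 * ‖d‖ ^ 2 * t ^ 2 := by
  have hderiv : ∀ s : ℝ, HasDerivAt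
      (fun s : ℝ => gradient f (x + s • d) - gradient f x - s • hessian f x d)
      (hessian f (x + s • d) d - hessian f x d) s := by
    intro s
    have h1 : HasDerivAt (fun s : ℝ => x + s • d) d s := by
      simpa using ((hasDerivAt_id s).smul_const d).const_add x
    have h2 := (hasFDerivAt_gradient hf (x + s • d)).comp_hasDerivAt s h1
    have h3 : HasDerivAt (fun s : ℝ => s • hessian f x d) (hessian f x d) s := by
      simpa using (hasDerivAt_id s).smul_const (hessian f x d)
    exact (h2.sub_const _).sub h3
  refine image_norm_le_of_norm_deriv_right_le_deriv_boundary (a := 0) (b := 1)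
    (B := fun s => L / 2 * ‖d‖ ^ 2 * s ^ 2) (B' := fun s => L * ‖d‖ ^ 2 * s)
    (fun s _ => (hderiv s).continuousAt.continuousWithinAt)
    (fun s _ => (hderiv s).hasDerivWithinAt) (by simp) (fun s => ?_) (fun s hs => ?_) ht
  · have := (hasDerivAt_pow 2 s).const_mul (L / 2 * ‖d‖ ^ 2)
    refine this.congr_deriv ?_
    simp
    ring
  · rw [← sub_apply]
    refine (ContinuousLinearMap.le_of_opNorm_le _ (hLip _ _) _).trans ?_
    rw [add_sub_cancel_left, norm_smul, Real.norm_eq_abs, abs_of_nonneg hs.1]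
    exact le_of_eq (by ring)

theorem norm_gradient_add_sub_le (hf : ContDiff ℝ 2 f) {L : ℝ}
    (hLip : ∀ x y, ‖hessian f x - hessian f y‖ ≤ L * ‖x - y‖) (x d : 𝔼 n) :
    ‖gradient f (x + d) - gradient f x - hessian f x d‖ ≤ L / 2 * ‖d‖ ^ 2 := by
  simpa using norm_gradient_sub_sub_le hf hLip x d (t := 1) (by simp)

theorem apply_add_le (hf : ContDiff ℝ 2 f) {L : ℝ}
    (hLip : ∀ x y, ‖hessian f x - hessian f y‖ ≤ L * ‖x - y‖) (x d : 𝔼 n) :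
    f (x + d) ≤ f x + inner ℝ (gradient f x) d + 1 / 2 * inner ℝ (hessian f x d) d +
      L / 6 * ‖d‖ ^ 3 := by
  have hderiv : ∀ s : ℝ, HasDerivAt
      (fun s : ℝ => f (x + s • d) - f x - s * inner ℝ (gradient f x) d -
        s ^ 2 / 2 * inner ℝ (hessian f x d) d)
      (inner ℝ (gradient f (x + s • d) - gradient f x - s • hessian f x d) d) s := by
    intro s
    have h1 : HasDerivAt (fun s : ℝ => x + s • d) d s := by
      simpa using ((hasDerivAt_id s).smul_const d).const_add x
    have h2 := (hasFDerivAt_of_contDiff hf (x + s • d)).comp_hasDerivAt s h1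
    have h3 := (hasDerivAt_id s).mul_const (inner ℝ (gradient f x) d)
    have h4 := ((hasDerivAt_pow 2 s).div_const 2).mul_const (inner ℝ (hessian f x d) d)
    refine (((h2.sub_const _).sub h3).sub h4).congr_deriv ?_
    simp [inner_sub_left, real_inner_smul_left]
  have h := image_norm_le_of_norm_deriv_right_le_deriv_boundary (a := 0) (b := 1)
    (B := fun s => L / 6 * ‖d‖ ^ 3 * s ^ 3) (B' := fun s => L / 2 * ‖d‖ ^ 3 * s ^ 2)
    (fun s _ => (hderiv s).continuousAt.continuousWithinAt)
    (fun s _ => (hderiv s).hasDerivWithinAt) (by simp) (fun s => ?_) (fun s hs => ?_)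
    (Set.right_mem_Icc.2 zero_le_one)
  · simp only [Real.norm_eq_abs, one_smul, one_pow, mul_one, one_mul] at h
    have := (abs_le.1 h).2
    linarith
  · have := (hasDerivAt_pow 3 s).const_mul (L / 6 * ‖d‖ ^ 3)
    refine this.congr_deriv ?_
    simp
    ring
  · refine (norm_inner_le_norm _ _).trans ?_
    have := norm_gradient_sub_sub_le hf hLip x d ⟨hs.1, hs.2.le⟩
    calc _ ≤ L / 2 * ‖d‖ ^ 2 * s ^ 2 * ‖d‖ := by gcongr
      _ = _ := by ring

end Calculus

/-! ### A Newton step near a critical point -/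

section Step

variable {n : ℕ} {f : EuclideanSpace ℝ (Fin n) → ℝ} {θ : Params}

local notation "𝔼" k:max => EuclideanSpace ℝ (Fin k)

/-- The standing hypotheses on the objective `f` and on the numerical data `θ`. -/
structure Standing (f : EuclideanSpace ℝ (Fin n) → ℝ) (θ : Params) : Prop where
  contDiff : ContDiff ℝ 2 f
  m_pos : 0 < θ.m
  M_pos : 0 < θ.M
  L_pos : 0 < θ.L
  lip_gradient : ∀ x y, ‖gradient f x - gradient f y‖ ≤ θ.M * ‖x - y‖
  lip_hessian : ∀ x y, ‖hessian f x - hessian f y‖ ≤ θ.L * ‖x - y‖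
  nondegenerate : ∀ c, gradient f c = 0 → ∀ μ, IsHessianEigenvalue f c μ → 2 * θ.m < |μ|
  α_mem : 0 < θ.α ∧ θ.α < 1 / 2
  γ_mem : 0 < θ.γ ∧ θ.γ < 1
  ζ_mem : 0 < θ.ζ ∧ θ.ζ < 1
  δ_mem : 0 < θ.δ ∧ θ.δ ≤ 3 * θ.m ^ 2 / θ.L * (1 - 2 * θ.α) ∧ θ.δ ≤ θ.m ^ 2 / (5 * θ.L)
  ε_pos : 0 < θ.ε
  ε_lt : θ.ε < θ.ζ * θ.δ * θ.m / (2 * θ.M * √n + θ.m)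
  ε_lt' : θ.ε < 2 * θ.m ^ 4 * θ.γ / (5 * θ.L * (2 * θ.M * √n + θ.m) ^ 2)

namespace Standing

variable (H : Standing f θ) {c y : EuclideanSpace ℝ (Fin n)}

include H

theorem spectralGap_hessian_critical (hc : gradient f c = 0) :
    SpectralGap (2 * θ.m) (hessian f c) :=
  fun μ hμ => (H.nondegenerate c hc μ hμ).le

theorem mul_norm_sub_lt (hy : y ∈ nbhd θ c) : θ.L * ‖y - c‖ < θ.m := by
  have := H.L_pos
  rw [nbhd, Metric.mem_ball, dist_eq_norm, lt_div_iff₀ this] at hy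
  linarith

theorem norm_hessian_sub_le (hy : y ∈ nbhd θ c) : ‖hessian f y - hessian f c‖ ≤ θ.m :=
  (H.lip_hessian y c).trans (H.mul_norm_sub_lt hy).le

theorem spectralGap_hessian (hc : gradient f c = 0) (hy : y ∈ nbhd θ c) :
    SpectralGap θ.m (hessian f y) := by
  have h := (H.spectralGap_hessian_critical hc).of_norm_sub_le
    (hessian_isSymmetric H.contDiff c) (by linarith [H.m_pos]) (H.norm_hessian_sub_le hy)
  rwa [two_mul, add_sub_cancel_right] at h

/-- The gradient is bounded below by a multiple of the distance to a critical point. -/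
theorem mul_norm_sub_le_norm_gradient (hc : gradient f c = 0) (hy : y ∈ nbhd θ c) :
    3 * θ.m / 2 * ‖y - c‖ ≤ ‖gradient f y‖ := by
  have h1 := norm_gradient_add_sub_le H.contDiff H.lip_hessian c (y - c)
  rw [add_sub_cancel, hc, sub_zero] at h1
  have h2 := norm_apply_ge_of_spectralGap (hessian_isSymmetric H.contDiff c)
    (by linarith [H.m_pos]) (H.spectralGap_hessian_critical hc) (y - c)
  have h3 : ‖hessian f c (y - c)‖ ≤ ‖gradient f y‖ +
      ‖gradient f y - hessian f c (y - c)‖ := by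
    have := norm_sub_le (gradient f y) (gradient f y - hessian f c (y - c))
    rwa [sub_sub_cancel] at this
  have h4 := H.mul_norm_sub_lt hy
  nlinarith [norm_nonneg (y - c)]

theorem delta_mul_L_le : θ.δ * (5 * θ.L) ≤ θ.m ^ 2 := by
  have := H.L_pos
  have h := H.δ_mem.2.2
  rwa [le_div_iff₀ (by positivity)] at h

/-- Close to a critical point the full Newton step passes the line search. -/
theorem backtracks_eq_zero (hgap : SpectralGap θ.m (hessian f y))
    (hg : ‖gradient f y‖ ≤ θ.δ) : backtracks f θ y = 0 := by
  have hm := H.m_pos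
  have hL := H.L_pos
  set d := newtonDir f θ y with hd
  have hdef : d = -ptInverse θ.m (hessian f y) (gradient f y) := rfl
  have hT := hessian_isSymmetric H.contDiff y
  have h1 := norm_ptInverse_le hT hm hgap (gradient f y)
  have h2 := le_inner_ptInverse hT hm hgap (gradient f y)
  have h3 := inner_apply_ptInverse_le hT hm hgap (gradient f y)
  have e1 : ptInverse θ.m (hessian f y) (gradient f y) = -d := by rw [hdef, neg_neg]
  rw [e1] at h1 h2 h3
  rw [norm_neg, inner_neg_right] at h2
  rw [map_neg, inner_neg_neg, inner_neg_right] at h3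
  rw [norm_neg] at h1
  have h4 := apply_add_le H.contDiff H.lip_hessian y d
  have h5 : θ.L * ‖d‖ ≤ 3 * θ.m * (1 - 2 * θ.α) := by
    have h6 := H.δ_mem.2.1
    rw [div_mul_eq_mul_div, le_div_iff₀ hL] at h6
    have h7 : θ.m * (θ.L * ‖d‖) ≤ θ.m * (3 * θ.m * (1 - 2 * θ.α)) := by
      nlinarith
    exact le_of_mul_le_mul_left h7 hm
  have h8 : θ.L / 6 * ‖d‖ ^ 3 ≤ (1 / 2 - θ.α) * (θ.m * ‖d‖ ^ 2) := by
    nlinarith [sq_nonneg ‖d‖, mul_le_mul_of_nonneg_right h5 (sq_nonneg ‖d‖)]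
  have h9 : (1 / 2 - θ.α) * (θ.m * ‖d‖ ^ 2) ≤
      (1 / 2 - θ.α) * -inner ℝ (gradient f y) d :=
    mul_le_mul_of_nonneg_left h2 (by linarith [H.α_mem.2])
  rw [backtracks, Nat.sInf_eq_zero]
  left
  simp only [Set.mem_ofPred_eq, pow_zero, one_smul, mul_one]
  rw [← hd]
  linarith

theorem ncnStep_eq (hgap : SpectralGap θ.m (hessian f y)) (hg : ‖gradient f y‖ ≤ θ.δ) :
    ncnStep f θ y = y + newtonDir f θ y := by
  rw [ncnStep, H.backtracks_eq_zero hgap hg, pow_zero, one_smul]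

theorem norm_newtonDir_le (hgap : SpectralGap θ.m (hessian f y)) :
    θ.m * ‖newtonDir f θ y‖ ≤ ‖gradient f y‖ := by
  rw [newtonDir, norm_neg]
  exact norm_ptInverse_le (hessian_isSymmetric H.contDiff y) H.m_pos hgap _

theorem ncnStep_mem_nbhd (hc : gradient f c = 0) (hy : y ∈ nbhd θ c)
    (hg : ‖gradient f y‖ < θ.δ) : ncnStep f θ y ∈ nbhd θ c := by
  have hm := H.m_pos
  have hL := H.L_pos
  have hgap := H.spectralGap_hessian hc hy
  rw [H.ncnStep_eq hgap hg.le, nbhd, Metric.mem_ball, dist_eq_norm, lt_div_iff₀ hL]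
  have h1 := H.norm_newtonDir_le hgap
  have h2 := H.mul_norm_sub_le_norm_gradient hc hy
  have h3 := H.delta_mul_L_le
  have h4 : ‖y + newtonDir f θ y - c‖ ≤ ‖y - c‖ + ‖newtonDir f θ y‖ := by
    rw [add_sub_right_comm]
    exact norm_add_le _ _
  refine lt_of_mul_lt_mul_left (a := θ.m) ?_ hm.le
  have h5 : θ.m * ‖y + newtonDir f θ y - c‖ ≤ 5 / 3 * ‖gradient f y‖ := by nlinarith
  nlinarith

/-- The gradient after a full Newton step is `2 Q ∇f(y)` up to a quadratic error, `Q` being the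
projection on the negative eigenspace of the Hessian at `y`. -/
theorem norm_gradient_ncnStep_sub_le (hgap : SpectralGap θ.m (hessian f y))
    (hg : ‖gradient f y‖ ≤ θ.δ) :
    ‖gradient f (ncnStep f θ y) -
      (2 : ℝ) • (negEigenspace (hessian f y)).starProjection (gradient f y)‖ ≤
      1 / 2 * (θ.L / θ.m ^ 2 * ‖gradient f y‖ ^ 2) := by
  have hm := H.m_pos
  have hL := H.L_pos
  rw [H.ncnStep_eq hgap hg]
  have h1 := norm_gradient_add_sub_le H.contDiff H.lip_hessian y (newtonDir f θ y)
  have h2 : hessian f y (newtonDir f θ y) = -(gradient f y -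
      (2 : ℝ) • (negEigenspace (hessian f y)).starProjection (gradient f y)) := by
    rw [newtonDir, map_neg, apply_ptInverse (hessian_isSymmetric H.contDiff y) hm hgap]
  rw [h2] at h1
  have h3 : gradient f (y + newtonDir f θ y) - gradient f y - -(gradient f y -
      (2 : ℝ) • (negEigenspace (hessian f y)).starProjection (gradient f y)) =
      gradient f (y + newtonDir f θ y) -
      (2 : ℝ) • (negEigenspace (hessian f y)).starProjection (gradient f y) := by abel
  rw [h3] at h1
  refine h1.trans ?_
  have h4 := H.norm_newtonDir_le hgap
  have h5 : ‖newtonDir f θ y‖ ≤ ‖gradient f y‖ / θ.m := by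
    rw [le_div_iff₀ hm]
    linarith
  calc θ.L / 2 * ‖newtonDir f θ y‖ ^ 2 ≤ θ.L / 2 * (‖gradient f y‖ / θ.m) ^ 2 := by gcongr
    _ = _ := by field_simp

theorem norm_hessian_sub_mul_le (hc : gradient f c = 0) (hy : y ∈ nbhd θ c) {w : 𝔼 n}
    (hw : ‖w‖ ≤ ‖gradient f y‖) :
    ‖hessian f y - hessian f c‖ * ‖w‖ ≤ 2 / 3 * θ.m * (θ.L / θ.m ^ 2 * ‖gradient f y‖ ^ 2) := by
  have hm := H.m_pos
  have hL := H.L_pos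
  have h1 := H.mul_norm_sub_le_norm_gradient hc hy
  have h2 : ‖y - c‖ ≤ 2 / (3 * θ.m) * ‖gradient f y‖ := by
    rw [div_mul_eq_mul_div, le_div_iff₀ (by positivity)]
    linarith
  calc ‖hessian f y - hessian f c‖ * ‖w‖
      ≤ (θ.L * (2 / (3 * θ.m) * ‖gradient f y‖)) * ‖gradient f y‖ := by
        gcongr
        exact (H.lip_hessian y c).trans (by gcongr)
    _ = _ := by field_simp

/-- In the negative eigenspace of the Hessian at `c` the gradient doubles, up to a quadratic
error. -/
theorem norm_gradNeg_ncnStep_sub_le (hc : gradient f c = 0) (hy : y ∈ nbhd θ c)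
    (hg : ‖gradient f y‖ < θ.δ) :
    ‖gradNeg f c (ncnStep f θ y) - (2 : ℝ) • gradNeg f c y‖ ≤
      3 / 2 * (θ.L / θ.m ^ 2 * ‖gradient f y‖ ^ 2) := by
  have hm := H.m_pos
  have hL := H.L_pos
  have hgap := H.spectralGap_hessian hc hy
  have hgapc := H.spectralGap_hessian_critical hc
  have hsc := hessian_isSymmetric H.contDiff c
  have hsy := hessian_isSymmetric H.contDiff y
  have h1 := H.norm_gradient_ncnStep_sub_le hgap hg.le
  set g := gradient f y
  set g' := gradient f (ncnStep f θ y) with hg'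
  set Q := (negEigenspace (hessian f y)).starProjection
  set P := (negEigenspace (hessian f c)).starProjection
  have hw : g - Q g ∈ (negEigenspace (hessian f y))ᗮ :=
    Submodule.sub_starProjection_mem_orthogonal g
  have h2 := norm_starProjection_le_of_separated (a := 2 * θ.m) (b := θ.m) (by positivity) hm
    (starProjection_negEigenspace_apply hsc)
    (V := (negEigenspace (hessian f y))ᗮ) (B := hessian f y) (fun v hv => by
      rw [Submodule.mem_orthogonal] at hv ⊢
      intro u hu
      exact (hsy u v).symm.trans (hv _ (apply_mem_negEigenspace hu)))
    (fun u hu => inner_apply_le_of_mem_negEigenspace hsc hgapc hu)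
    (fun v hv => le_inner_apply_of_mem_orthogonal hsy hgap hv) hw
  have hwn : ‖g - Q g‖ ≤ ‖g‖ := by
    have : g - Q g = (negEigenspace (hessian f y))ᗮ.starProjection g :=
      (Submodule.starProjection_orthogonal_val g).symm
    rw [this]
    exact Submodule.norm_starProjection_apply_le _ _
  have h3 := h2.trans (H.norm_hessian_sub_mul_le hc hy hwn)
  have h4 : ‖P (g - Q g)‖ ≤ 1 / 3 * (θ.L / θ.m ^ 2 * ‖g‖ ^ 2) := by
    refine le_of_mul_le_mul_left (a := 2 * θ.m) ?_ (by positivity)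
    calc _ = (θ.m + 2 * θ.m / 2) * ‖P (g - Q g)‖ := by ring
      _ ≤ _ := h3
      _ = _ := by ring
  have h5 : gradNeg f c (ncnStep f θ y) - (2 : ℝ) • gradNeg f c y =
      P (g' - (2 : ℝ) • Q g) - (2 : ℝ) • P (g - Q g) := by
    change P g' - (2 : ℝ) • P g = _
    simp only [map_sub, map_smul, smul_sub]
    abel
  rw [h5]
  refine (norm_sub_le _ _).trans ?_
  rw [norm_smul, Real.norm_of_nonneg (by norm_num)]
  have h6 : ‖P (g' - (2 : ℝ) • Q g)‖ ≤ ‖g' - (2 : ℝ) • Q g‖ :=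
    Submodule.norm_starProjection_apply_le _ _
  have h7 : 0 ≤ θ.L / θ.m ^ 2 * ‖g‖ ^ 2 := by positivity
  linarith

/-- In the positive eigenspace of the Hessian at `c` the gradient vanishes, up to a quadratic
error. -/
theorem norm_gradient_sub_gradNeg_ncnStep_le (hc : gradient f c = 0) (hy : y ∈ nbhd θ c)
    (hg : ‖gradient f y‖ < θ.δ) :
    ‖gradient f (ncnStep f θ y) - gradNeg f c (ncnStep f θ y)‖ ≤
      3 / 2 * (θ.L / θ.m ^ 2 * ‖gradient f y‖ ^ 2) := by
  have hm := H.m_pos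
  have hL := H.L_pos
  have hgap := H.spectralGap_hessian hc hy
  have hgapc := H.spectralGap_hessian_critical hc
  have hsc := hessian_isSymmetric H.contDiff c
  have hsy := hessian_isSymmetric H.contDiff y
  have h1 := H.norm_gradient_ncnStep_sub_le hgap hg.le
  set g := gradient f y
  set g' := gradient f (ncnStep f θ y) with hg'
  set Q := (negEigenspace (hessian f y)).starProjection
  have hP : ∀ v, v - (negEigenspace (hessian f c)).starProjection v =
      (negEigenspace (hessian f c))ᗮ.starProjection v := fun v =>
    (Submodule.starProjection_orthogonal_val v).symm
  set P := (negEigenspace (hessian f c))ᗮ.starProjection with hPdef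
  have h2 := norm_starProjection_le_of_separated (a := 2 * θ.m) (b := θ.m) (A := -hessian f c)
    (B := -hessian f y) (U := (negEigenspace (hessian f c))ᗮ)
    (V := negEigenspace (hessian f y)) (by positivity) hm
    (fun v => by
      rw [← hP, ← hP, neg_apply, neg_apply, map_neg, map_sub,
        starProjection_negEigenspace_apply hsc]
      abel)
    (fun v hv => Submodule.neg_mem _ (apply_mem_negEigenspace hv))
    (fun u hu => by
      have := le_inner_apply_of_mem_orthogonal hsc hgapc hu
      rw [neg_apply, inner_neg_left]
      linarith)
    (fun v hv => by
      have := inner_apply_le_of_mem_negEigenspace hsy hgap hv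
      rw [neg_apply, inner_neg_left]
      linarith)
    (Submodule.starProjection_apply_mem (negEigenspace (hessian f y)) g)
  have e : -hessian f y - -hessian f c = -(hessian f y - hessian f c) := by abel
  rw [e, norm_neg] at h2
  have h3 := h2.trans (H.norm_hessian_sub_mul_le hc hy
    (Submodule.norm_starProjection_apply_le (negEigenspace (hessian f y)) g))
  have h4 : ‖P (Q g)‖ ≤ 1 / 3 * (θ.L / θ.m ^ 2 * ‖g‖ ^ 2) := by
    refine le_of_mul_le_mul_left (a := 2 * θ.m) ?_ (by positivity)
    calc _ = (θ.m + 2 * θ.m / 2) * ‖P (Q g)‖ := by ring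
      _ ≤ _ := h3
      _ = _ := by ring
  have h5 : g' - gradNeg f c (ncnStep f θ y) =
      P (g' - (2 : ℝ) • Q g) + (2 : ℝ) • P (Q g) := by
    change g' - (negEigenspace (hessian f c)).starProjection g' = _
    rw [hP, map_sub, map_smul]
    abel
  rw [h5]
  refine (norm_add_le _ _).trans ?_
  rw [norm_smul, Real.norm_of_nonneg (by norm_num)]
  have h6 : ‖P (g' - (2 : ℝ) • Q g)‖ ≤ ‖g' - (2 : ℝ) • Q g‖ :=
    Submodule.norm_starProjection_apply_le _ _
  have h7 : 0 ≤ θ.L / θ.m ^ 2 * ‖g‖ ^ 2 := by positivity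
  linarith

end Standing

end Step

/-! ### Escape from the good region, and the iterates after a perturbation -/

section Dynamics

variable {n : ℕ} {f : EuclideanSpace ℝ (Fin n) → ℝ} {θ : Params}

local notation "𝔼" k:max => EuclideanSpace ℝ (Fin k)

namespace Standing

variable (H : Standing f θ) {c y : EuclideanSpace ℝ (Fin n)}

include H

theorem zeta_mul_delta_lt : θ.ζ * θ.δ < θ.δ := by
  nlinarith [H.ζ_mem.2, H.δ_mem.1]

theorem two_mul_m_lt_M (hc : IsSaddle f c) : 2 * θ.m < θ.M := by
  obtain ⟨hc0, μ, -, hμ⟩ := hc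
  refine (H.nondegenerate c hc0 μ hμ).trans_le ?_
  obtain ⟨v, hv⟩ := Module.End.HasEigenvalue.exists_hasEigenvector hμ
  have h1 : hessian f c v = μ • v := hv.apply_eq_smul
  have h2 : ‖hessian f c‖ ≤ θ.M := by
    have hlip : LipschitzWith (Real.toNNReal θ.M) (gradient f) :=
      LipschitzWith.of_dist_le_mul fun x y => by
        rw [dist_eq_norm, dist_eq_norm, Real.coe_toNNReal _ H.M_pos.le]
        exact H.lip_gradient x y
    have := norm_fderiv_le_of_lipschitz ℝ hlip (x₀ := c)
    rwa [Real.coe_toNNReal _ H.M_pos.le] at this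
  have h3 := (hessian f c).le_of_opNorm_le h2 v
  rw [h1, norm_smul, Real.norm_eq_abs] at h3
  exact le_of_mul_le_mul_right h3 (norm_pos_iff.2 hv.2)

theorem one_le_sqrt (hc : IsSaddle f c) : 1 ≤ √(n : ℝ) := by
  rw [Real.one_le_sqrt, Nat.one_le_cast, Nat.one_le_iff_ne_zero]
  rintro rfl
  obtain ⟨-, μ, -, hμ⟩ := hc
  obtain ⟨v, hv⟩ := Module.End.HasEigenvalue.exists_hasEigenvector hμ
  exact hv.2 (Subsingleton.elim _ _)

theorem denom_pos : 0 < 2 * θ.M * √(n : ℝ) + θ.m := by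
  have := H.m_pos
  have := H.M_pos
  positivity

theorem five_mul_m_le (hc : IsSaddle f c) : 5 * θ.m ≤ 2 * θ.M * √(n : ℝ) + θ.m := by
  have h1 := H.two_mul_m_lt_M hc
  have h2 := H.one_le_sqrt hc
  have := H.m_pos
  nlinarith

theorem eps_mul_denom_lt : θ.ε * (2 * θ.M * √(n : ℝ) + θ.m) < θ.ζ * θ.δ * θ.m :=
  (lt_div_iff₀ H.denom_pos).1 H.ε_lt

theorem eps_mul_sq_denom_lt :
    θ.ε * (5 * θ.L * (2 * θ.M * √(n : ℝ) + θ.m) ^ 2) < 2 * θ.m ^ 4 * θ.γ := by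
  have := H.denom_pos
  have := H.L_pos
  exact (lt_div_iff₀ (by positivity)).1 H.ε_lt'

theorem five_mul_eps_lt (hc : IsSaddle f c) : 5 * θ.ε < θ.ζ * θ.δ := by
  have h1 := H.five_mul_m_le hc
  have h2 := H.eps_mul_denom_lt
  have h3 := H.m_pos
  have h4 := H.ε_pos
  refine lt_of_mul_lt_mul_right (a := θ.m) ?_ h3.le
  nlinarith

theorem L_mul_eps_lt (hc : IsSaddle f c) : θ.L / θ.m ^ 2 * θ.ε ≤ 2 / 125 * θ.γ := by
  have h1 := H.five_mul_m_le hc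
  have h2 := H.eps_mul_sq_denom_lt
  have h3 := H.m_pos
  have h4 := H.ε_pos
  have h5 := H.L_pos
  have h6 : θ.ε * (5 * θ.L * (5 * θ.m) ^ 2) ≤
      θ.ε * (5 * θ.L * (2 * θ.M * √(n : ℝ) + θ.m) ^ 2) := by gcongr
  rw [div_mul_eq_mul_div, div_le_iff₀ (by positivity)]
  refine le_of_mul_le_mul_left (a := 125 * θ.m ^ 2) ?_ (by positivity)
  nlinarith

theorem hasNegativeCurvature (hc : IsSaddle f c) (hy : y ∈ nbhd θ c) :
    HasNegativeCurvature f y := by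
  obtain ⟨hc0, μ, hμ0, hμ⟩ := hc
  have h0 := H.nondegenerate c hc0 μ hμ
  rw [abs_of_neg hμ0] at h0
  obtain ⟨v, hv⟩ := Module.End.HasEigenvalue.exists_hasEigenvector hμ
  have h1 : hessian f c v = μ • v := hv.apply_eq_smul
  have hv0 : 0 < ‖v‖ := norm_pos_iff.2 hv.2
  refine exists_neg_eigenvalue_of_inner_neg (hessian_isSymmetric H.contDiff y) (v := v) ?_
  have h2 : inner ℝ ((hessian f y - hessian f c) v) v ≤ θ.m * ‖v‖ * ‖v‖ :=
    (real_inner_le_norm _ _).trans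
      (mul_le_mul_of_nonneg_right ((hessian f y - hessian f c).le_of_opNorm_le
        (H.norm_hessian_sub_le hy) v) hv0.le)
  rw [sub_apply, inner_sub_left, h1, real_inner_smul_left, real_inner_self_eq_norm_sq] at h2
  have := H.m_pos
  nlinarith [mul_pos hv0 hv0]

/-- If the gradient is dominated by its negative component, then one NCN step expands the negative
component and makes the gradient almost parallel to the negative eigenspace. -/
theorem ncnStep_expands (hc : gradient f c = 0) (hy : y ∈ nbhd θ c)
    (hg : ‖gradient f y‖ < θ.ζ * θ.δ) {κ : ℝ} (hκ : κ ≤ 2 / 5)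
    (hu : θ.L / θ.m ^ 2 * ‖gradient f y‖ ^ 2 ≤ κ * ‖gradNeg f c y‖) :
    ncnStep f θ y ∈ nbhd θ c ∧
      ‖gradient f (ncnStep f θ y)‖ ≤ 10 / 7 * ‖gradNeg f c (ncnStep f θ y)‖ ∧
      (2 - 3 / 2 * κ) * ‖gradNeg f c y‖ ≤ ‖gradNeg f c (ncnStep f θ y)‖ := by
  have hg' := hg.trans H.zeta_mul_delta_lt
  have h1 := H.norm_gradNeg_ncnStep_sub_le hc hy hg'
  have h2 := H.norm_gradient_sub_gradNeg_ncnStep_le hc hy hg'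
  have h3 : 2 * ‖gradNeg f c y‖ ≤ ‖gradNeg f c (ncnStep f θ y)‖ +
      ‖gradNeg f c (ncnStep f θ y) - (2 : ℝ) • gradNeg f c y‖ := by
    have := norm_sub_le (gradNeg f c (ncnStep f θ y))
      (gradNeg f c (ncnStep f θ y) - (2 : ℝ) • gradNeg f c y)
    rwa [sub_sub_cancel, norm_smul, Real.norm_of_nonneg (by norm_num)] at this
  have h4 : ‖gradient f (ncnStep f θ y)‖ ≤ ‖gradNeg f c (ncnStep f θ y)‖ +
      ‖gradient f (ncnStep f θ y) - gradNeg f c (ncnStep f θ y)‖ := norm_le_insert' _ _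
  have h5 := norm_nonneg (gradNeg f c y)
  refine ⟨H.ncnStep_mem_nbhd hc hy hg', ?_, ?_⟩
  · nlinarith
  · nlinarith

/-- Exponential escape from the good region. From the first step on `‖∇f‖ ≤ 10/7 ‖∇f₋‖`, so that the
quadratic error is at most a small multiple of `ζ ‖∇f₋‖` while `‖∇f‖ < ζ δ`. -/
theorem lt_norm_gradNeg_iterate (hc : gradient f c = 0) (hy : y ∈ goodRegion f θ c) (k : ℕ)
    (hk : ∀ j ≤ k, ‖gradient f ((ncnStep f θ)^[j] y)‖ < θ.ζ * θ.δ) :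
    (ncnStep f θ)^[k + 1] y ∈ nbhd θ c ∧
      ‖gradient f ((ncnStep f θ)^[k + 1] y)‖ ≤
        10 / 7 * ‖gradNeg f c ((ncnStep f θ)^[k + 1] y)‖ ∧
      (2 - θ.ζ) ^ k * (θ.γ * θ.ε) < ‖gradNeg f c ((ncnStep f θ)^[k + 1] y)‖ := by
  have hm := H.m_pos
  have hL := H.L_pos
  induction k with
  | zero =>
    obtain ⟨h1, h2, h3, h4⟩ := hy
    have h5 : θ.L / θ.m ^ 2 * ‖gradient f y‖ ^ 2 ≤ 2 / 5 * ‖gradNeg f c y‖ := by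
      have e : 5 * θ.L / (2 * θ.m ^ 2) * ‖gradient f y‖ ^ 2 =
          5 / 2 * (θ.L / θ.m ^ 2 * ‖gradient f y‖ ^ 2) := by field_simp
      rw [e] at h4
      linarith
    obtain ⟨h6, h7, h8⟩ := H.ncnStep_expands hc h1 h3 le_rfl h5
    refine ⟨h6, h7, ?_⟩
    simp only [pow_zero, one_mul, zero_add, Function.iterate_one]
    have := norm_nonneg (gradNeg f c y)
    linarith
  | succ k ih =>
    obtain ⟨h1, h2, h3⟩ := ih fun j hj => hk j (by omega)
    have hg := hk (k + 1) le_rfl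
    rw [Function.iterate_succ_apply' _ (k + 1)]
    set z := (ncnStep f θ)^[k + 1] y
    have hP := norm_nonneg (gradNeg f c z)
    have hζ := H.ζ_mem
    have hζ0 := hζ.1
    have hδ0 := H.δ_mem.1
    have h5 : θ.L / θ.m ^ 2 * ‖gradient f z‖ ^ 2 ≤ 2 / 7 * θ.ζ * ‖gradNeg f c z‖ := by
      have h6 := H.delta_mul_L_le
      have h7 : θ.L / θ.m ^ 2 * (θ.ζ * θ.δ) ≤ θ.ζ / 5 := by
        rw [div_mul_eq_mul_div, div_le_iff₀ (by positivity)]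
        nlinarith [H.ζ_mem.1]
      calc θ.L / θ.m ^ 2 * ‖gradient f z‖ ^ 2
          = θ.L / θ.m ^ 2 * ‖gradient f z‖ * ‖gradient f z‖ := by ring
        _ ≤ θ.L / θ.m ^ 2 * (θ.ζ * θ.δ) * (10 / 7 * ‖gradNeg f c z‖) := by gcongr
        _ ≤ θ.ζ / 5 * (10 / 7 * ‖gradNeg f c z‖) := by gcongr
        _ = _ := by ring
    obtain ⟨h6, h7, h8⟩ := H.ncnStep_expands hc h1 hg (by linarith) h5
    refine ⟨h6, h7, lt_of_lt_of_le ?_ h8⟩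
    have h9 : 0 < 2 - θ.ζ := by linarith
    calc (2 - θ.ζ) ^ (k + 1) * (θ.γ * θ.ε) = (2 - θ.ζ) * ((2 - θ.ζ) ^ k * (θ.γ * θ.ε)) := by ring
      _ < (2 - θ.ζ) * ‖gradNeg f c z‖ := by gcongr
      _ ≤ _ := by
        gcongr
        linarith

theorem norm_gradNeg_le_of_notMem (hy : y ∈ nbhd θ c) (hg : ‖gradient f y‖ < θ.ζ * θ.δ)
    (hu : θ.L / θ.m ^ 2 * ‖gradient f y‖ ^ 2 ≤ 2 / 5 * (θ.γ * θ.ε))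
    (hn : y ∉ goodRegion f θ c) : ‖gradNeg f c y‖ ≤ θ.γ * θ.ε := by
  have hm := H.m_pos
  by_contra! h
  refine hn ⟨hy, h, hg, ?_⟩
  have e : 5 * θ.L / (2 * θ.m ^ 2) * ‖gradient f y‖ ^ 2 =
      5 / 2 * (θ.L / θ.m ^ 2 * ‖gradient f y‖ ^ 2) := by field_simp
  rw [e]
  linarith

/-- Outside the good region a small gradient stays small, and its quadratic error term becomes
negligible compared with `γ ε`. -/
theorem ncnStep_stays_small (hc : IsSaddle f c) (hy : y ∈ nbhd θ c)
    (hg : ‖gradient f y‖ < θ.ζ * θ.δ)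
    (hu : θ.L / θ.m ^ 2 * ‖gradient f y‖ ^ 2 ≤ 2 / 5 * (θ.γ * θ.ε))
    (hP : ‖gradNeg f c y‖ ≤ θ.γ * θ.ε) :
    ncnStep f θ y ∈ nbhd θ c ∧ ‖gradient f (ncnStep f θ y)‖ < θ.ζ * θ.δ ∧
      θ.L / θ.m ^ 2 * ‖gradient f (ncnStep f θ y)‖ ^ 2 ≤ 17 / 100 * (θ.γ * θ.ε) := by
  have hm := H.m_pos
  have hL := H.L_pos
  have hγ := H.γ_mem
  have hε := H.ε_pos
  have hγε : 0 < θ.γ * θ.ε := mul_pos hγ.1 hε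
  have hg' := hg.trans H.zeta_mul_delta_lt
  have h1 := H.norm_gradNeg_ncnStep_sub_le hc.1 hy hg'
  have h2 := H.norm_gradient_sub_gradNeg_ncnStep_le hc.1 hy hg'
  have h3 : ‖gradNeg f c (ncnStep f θ y)‖ ≤ 2 * ‖gradNeg f c y‖ +
      ‖gradNeg f c (ncnStep f θ y) - (2 : ℝ) • gradNeg f c y‖ := by
    have := norm_le_insert' (gradNeg f c (ncnStep f θ y)) ((2 : ℝ) • gradNeg f c y)
    rwa [norm_smul, Real.norm_of_nonneg (by norm_num)] at this
  have h4 : ‖gradient f (ncnStep f θ y)‖ ≤ ‖gradNeg f c (ncnStep f θ y)‖ +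
      ‖gradient f (ncnStep f θ y) - gradNeg f c (ncnStep f θ y)‖ := norm_le_insert' _ _
  have h5 : ‖gradient f (ncnStep f θ y)‖ ≤ 16 / 5 * (θ.γ * θ.ε) := by linarith
  have h6 := H.five_mul_eps_lt hc
  have h7 := H.L_mul_eps_lt hc
  refine ⟨H.ncnStep_mem_nbhd hc.1 hy hg', ?_, ?_⟩
  · nlinarith
  · have h8 : θ.γ * θ.γ * θ.γ ≤ θ.γ := by
      have : θ.γ * θ.γ ≤ 1 := by nlinarith
      nlinarith
    calc θ.L / θ.m ^ 2 * ‖gradient f (ncnStep f θ y)‖ ^ 2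
        ≤ θ.L / θ.m ^ 2 * (16 / 5 * (θ.γ * θ.ε)) ^ 2 := by gcongr
      _ = (θ.L / θ.m ^ 2 * θ.ε) * (256 / 25 * θ.γ ^ 2 * θ.ε) := by ring
      _ ≤ (2 / 125 * θ.γ) * (256 / 25 * θ.γ ^ 2 * θ.ε) := by gcongr
      _ = 512 / 3125 * (θ.γ * θ.γ * θ.γ) * θ.ε := by ring
      _ ≤ 512 / 3125 * θ.γ * θ.ε := by gcongr
      _ ≤ _ := by nlinarith

/-- An accepted point that stays in the neighbourhood of a saddle has a small gradient. -/
theorem small_of_accepted (hy : Accepted f θ y) :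
    ‖gradient f y‖ < θ.ζ * θ.δ ∧
      θ.L / θ.m ^ 2 * ‖gradient f y‖ ^ 2 ≤ 2 / 5 * (θ.γ * θ.ε) := by
  have hm := H.m_pos
  have hL := H.L_pos
  have hε := H.ε_pos
  have hs := H.denom_pos
  have h1 : ‖gradient f y‖ ≤ θ.ε * (2 * θ.M * √(n : ℝ) + θ.m) / θ.m := by
    refine hy.trans_eq ?_
    field_simp
  refine ⟨h1.trans_lt ?_, ?_⟩
  · rw [div_lt_iff₀ hm]
    exact H.eps_mul_denom_lt
  · have h2 := H.eps_mul_sq_denom_lt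
    calc θ.L / θ.m ^ 2 * ‖gradient f y‖ ^ 2
        ≤ θ.L / θ.m ^ 2 * (θ.ε * (2 * θ.M * √(n : ℝ) + θ.m) / θ.m) ^ 2 := by gcongr
      _ = θ.ε * (5 * θ.L * (2 * θ.M * √(n : ℝ) + θ.m) ^ 2) * θ.ε / (5 * θ.m ^ 4) := by
        field_simp
      _ ≤ 2 * θ.m ^ 4 * θ.γ * θ.ε / (5 * θ.m ^ 4) := by gcongr
      _ = _ := by field_simp

theorem two_le_waitSteps : 2 ≤ waitSteps θ := by
  rw [waitSteps, Nat.succ_le_iff, Nat.lt_ceil]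
  have h1 : 0 < Real.log (1 / θ.γ) := Real.log_pos (by
    rw [lt_div_iff₀ H.γ_mem.1]; linarith [H.γ_mem.2])
  have h2 : 0 < Real.log (2 - θ.ζ) := Real.log_pos (by linarith [H.ζ_mem.2])
  have := div_pos h1 h2
  push_cast
  linarith

theorem iterate_stays_small (hc : IsSaddle f c) (hy : y ∈ nbhd θ c) (hacc : Accepted f θ y) {j : ℕ}
    (havoid : ∀ i ≤ j, (ncnStep f θ)^[i] y ∉ goodRegion f θ c) :
    (ncnStep f θ)^[j + 1] y ∈ nbhd θ c ∧
      ‖gradient f ((ncnStep f θ)^[j + 1] y)‖ < θ.ζ * θ.δ ∧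
      θ.L / θ.m ^ 2 * ‖gradient f ((ncnStep f θ)^[j + 1] y)‖ ^ 2 ≤ 17 / 100 * (θ.γ * θ.ε) := by
  have hγε : 0 < θ.γ * θ.ε := mul_pos H.γ_mem.1 H.ε_pos
  induction j with
  | zero =>
    obtain ⟨h1, h2⟩ := H.small_of_accepted hacc
    exact H.ncnStep_stays_small hc hy h1 h2
      (H.norm_gradNeg_le_of_notMem hy h1 h2 (havoid 0 le_rfl))
  | succ j ih =>
    obtain ⟨h1, h2, h3⟩ := ih fun i hi => havoid i (by omega)
    have h3' := h3.trans (mul_le_mul_of_nonneg_right (by norm_num : (17 / 100 : ℝ) ≤ 2 / 5)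
      hγε.le)
    rw [Function.iterate_succ_apply' _ (j + 1)]
    exact H.ncnStep_stays_small hc h1 h2 h3'
      (H.norm_gradNeg_le_of_notMem h1 h2 h3' (havoid (j + 1) le_rfl))

/-- A sequence of NCN steps that starts with a small gradient and avoids the good region brings the
gradient below `ε`: its positive component becomes negligible after two steps, and its negative
component, which doubles in each step, is at most about `γ ε / 2` one step before the last. -/
theorem norm_gradient_lt_of_avoids (hc : IsSaddle f c) (hy : y ∈ nbhd θ c)
    (hacc : Accepted f θ y) {K : ℕ} (hK : 2 ≤ K)
    (havoid : ∀ j ≤ K + 1, (ncnStep f θ)^[j] y ∉ goodRegion f θ c) :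
    ‖gradient f ((ncnStep f θ)^[K] y)‖ < θ.ε := by
  have hγε : 0 < θ.γ * θ.ε := mul_pos H.γ_mem.1 H.ε_pos
  have hγε' : θ.γ * θ.ε < θ.ε := by nlinarith [H.γ_mem.2, H.ε_pos]
  have hstep := fun j (hj : j ≤ K) => H.iterate_stays_small hc hy hacc (j := j)
    fun i hi => havoid i (by omega)
  obtain ⟨k, rfl⟩ : ∃ k, K = k + 2 := ⟨K - 2, by omega⟩
  obtain ⟨a1, a2, a3⟩ := hstep k (by omega)
  obtain ⟨b1, b2, b3⟩ := hstep (k + 1) (by omega)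
  obtain ⟨d1, d2, d3⟩ := hstep (k + 2) (by omega)
  have d4 := H.norm_gradNeg_le_of_notMem d1 d2 (by linarith) (havoid (k + 3) (by omega))
  rw [Function.iterate_succ_apply' _ (k + 2)] at d4
  have h1 := H.norm_gradNeg_ncnStep_sub_le hc.1 b1 (b2.trans H.zeta_mul_delta_lt)
  have h2 := H.norm_gradient_sub_gradNeg_ncnStep_le hc.1 a1 (a2.trans H.zeta_mul_delta_lt)
  rw [← Function.iterate_succ_apply' (ncnStep f θ) (k + 1)] at h2
  set z := (ncnStep f θ)^[k + 1 + 1] y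
  have h3 : 2 * ‖gradNeg f c z‖ ≤ ‖gradNeg f c (ncnStep f θ z)‖ +
      ‖gradNeg f c (ncnStep f θ z) - (2 : ℝ) • gradNeg f c z‖ := by
    have := norm_sub_le (gradNeg f c (ncnStep f θ z))
      (gradNeg f c (ncnStep f θ z) - (2 : ℝ) • gradNeg f c z)
    rwa [sub_sub_cancel, norm_smul, Real.norm_of_nonneg (by norm_num)] at this
  have h4 : ‖gradient f z‖ ≤ ‖gradNeg f c z‖ + ‖gradient f z - gradNeg f c z‖ :=
    norm_le_insert' _ _
  linarith

end Standing

theorem state_add_of_wait {x₀ : 𝔼 n} {v : ℕ → 𝔼 n} {k K : ℕ} {y : 𝔼 n}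
    (h : state f θ x₀ v k = (y, K)) {j : ℕ} (hj : j ≤ K) :
    state f θ x₀ v (k + j) = ((ncnStep f θ)^[j] y, K - j) := by
  induction j with
  | zero => simpa using h
  | succ j ih =>
    have h1 := ih (by omega)
    have h2 : K - j ≠ 0 := by omega
    rw [← add_assoc, state, h1, iteration, if_neg (by simp [Perturbs, h2]),
      if_neg (by simp [h2]), Function.iterate_succ_apply']
    simp only [Prod.mk.injEq, true_and]
    omega

/-- After a perturbation that leaves the iterate in the neighbourhood of the saddle, the iterate
soon enters the good region or is perturbed again. -/
theorem Standing.exists_goodRegion_or_drawsAt (H : Standing f θ) {x₀ : 𝔼 n} {v : ℕ → 𝔼 n}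
    {c : 𝔼 n} (hc : IsSaddle f c) {k : ℕ} (hk : DrawsAt f θ x₀ v c k)
    (hk1 : iterate f θ x₀ v (k + 1) ∈ nbhd θ c) :
    ∃ k', k < k' ∧ k' ≤ k + waitSteps θ + 2 ∧
      (iterate f θ x₀ v k' ∈ goodRegion f θ c ∨ DrawsAt f θ x₀ v c k') := by
  by_cases hacc : Accepted f θ ((state f θ x₀ v k).1 + v k)
  · by_contra! hcon
    set y := (state f θ x₀ v k).1 + v k with hy
    have hs1 : state f θ x₀ v (k + 1) = (y, waitSteps θ) := by
      rw [state, iteration, if_pos hk.1, if_pos hacc]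
    have hyn : y ∈ nbhd θ c := by rwa [iterate, hs1] at hk1
    have hs := fun j (hj : j ≤ waitSteps θ) => state_add_of_wait hs1 hj
    have hsK := hs _ le_rfl
    rw [Nat.sub_self] at hsK
    set z := (ncnStep f θ)^[waitSteps θ] y with hz
    have hK := H.two_le_waitSteps
    have havoid : ∀ j ≤ waitSteps θ, (ncnStep f θ)^[j] y ∉ goodRegion f θ c := fun j hj => by
      have := (hcon (k + 1 + j) (by omega) (by omega)).1
      rwa [iterate, hs j hj] at this
    have hzn : z ∈ nbhd θ c := by
      have := (H.iterate_stays_small hc hyn hacc (j := waitSteps θ - 1)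
        fun i hi => havoid i (by omega)).1
      rwa [Nat.sub_add_cancel (by omega)] at this
    have hzε : ¬ ‖gradient f z‖ < θ.ε := fun h => by
      refine (hcon (k + 1 + waitSteps θ) (by omega) (by omega)).2 ⟨?_, ?_⟩
      · rw [hsK]
        exact ⟨rfl, h, H.hasNegativeCurvature hc hzn⟩
      · rwa [iterate, hsK]
    have hlast : ncnStep f θ z ∉ goodRegion f θ c := by
      have := (hcon (k + 1 + waitSteps θ + 1) (by omega) (by omega)).1
      rwa [iterate, state, hsK, iteration, if_neg (fun h' => hzε h'.2.1),
        if_neg (fun h' => hzε h'.2)] at this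
    refine hzε (H.norm_gradient_lt_of_avoids hc hyn hacc hK fun j hj => ?_)
    rcases Nat.lt_or_ge (waitSteps θ) j with h | h
    · obtain rfl : j = waitSteps θ + 1 := by omega
      rwa [Function.iterate_succ_apply']
    · exact havoid j h
  · have hs1 : state f θ x₀ v (k + 1) = state f θ x₀ v k := by
      rw [state, iteration, if_pos hk.1, if_neg hacc]
    refine ⟨k + 1, by omega, by omega, Or.inr ?_⟩
    rw [DrawsAt, iterate, hs1]
    exact hk

end Dynamics

/-! ### The norm of a standard Gaussian vector -/

section ChiSquare

local notation "𝔼" k:max => EuclideanSpace ℝ (Fin k)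

theorem stdGaussian_eq_withDensity (d : ℕ) :
    stdGaussian (𝔼 d) = (volume : Measure (𝔼 d)).withDensity fun x =>
      ENNReal.ofReal (((2 * Real.pi) ^ ((d : ℝ) / 2))⁻¹ * Real.exp (-(1 / 2) * ‖x‖ ^ 2)) := by
  have hpos : ∀ x : 𝔼 d,
      0 ≤ ((2 * Real.pi) ^ ((d : ℝ) / 2))⁻¹ * Real.exp (-(1 / 2) * ‖x‖ ^ 2) :=
    fun x => by positivity
  have hint : Integrable (fun x : 𝔼 d =>
      ((2 * Real.pi) ^ ((d : ℝ) / 2))⁻¹ * Real.exp (-(1 / 2) * ‖x‖ ^ 2)) := by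
    refine Integrable.const_mul ?_ _
    have h := (GaussianFourier.integrable_cexp_neg_mul_sq_norm_add (V := 𝔼 d) (b := 1 / 2)
      (by norm_num) 0 0).re
    refine h.congr (Filter.Eventually.of_forall fun x => ?_)
    have : (-(1 / 2 : ℂ) * (‖x‖ : ℂ) ^ 2 + 0 * (inner ℝ (0 : 𝔼 d) x : ℝ)) =
        ((-(1 / 2) * ‖x‖ ^ 2 : ℝ) : ℂ) := by
      push_cast
      ring
    simp only [this]
    rw [← Complex.ofReal_exp]
    exact Complex.ofReal_re _
  have := isFiniteMeasure_withDensity_ofReal hint.2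
  refine Measure.ext_of_charFun (funext fun t => ?_)
  rw [charFun_stdGaussian, charFun_apply, integral_withDensity_eq_integral_toReal_smul
    (by fun_prop) (Filter.Eventually.of_forall fun x => ENNReal.ofReal_lt_top)]
  have h := GaussianFourier.integral_cexp_neg_mul_sq_norm_add (V := 𝔼 d) (b := 1 / 2)
    (by norm_num) Complex.I t
  have e : ∀ x : 𝔼 d, (ENNReal.ofReal (((2 * Real.pi) ^ ((d : ℝ) / 2))⁻¹ *
      Real.exp (-(1 / 2) * ‖x‖ ^ 2))).toReal • Complex.exp ((inner ℝ x t : ℝ) * Complex.I) =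
      ((((2 * Real.pi) ^ ((d : ℝ) / 2))⁻¹ : ℝ) : ℂ) *
        Complex.exp (-(1 / 2) * (‖x‖ : ℂ) ^ 2 + Complex.I * (inner ℝ t x : ℝ)) := by
    intro x
    rw [ENNReal.toReal_ofReal (hpos x), Complex.real_smul, Complex.exp_add, real_inner_comm]
    push_cast
    ring_nf
  simp_rw [e]
  rw [integral_const_mul, h]
  have h2 : ((Real.pi : ℂ) / (1 / 2)) ^ ((Module.finrank ℝ (𝔼 d) : ℂ) / 2) =
      (((2 * Real.pi) ^ ((d : ℝ) / 2) : ℝ) : ℂ) := by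
    rw [Complex.ofReal_cpow (by positivity)]
    congr 1
    · push_cast; ring
    · simp
  rw [h2, ← mul_assoc, ← Complex.ofReal_mul, inv_mul_cancel₀ (by positivity), Complex.ofReal_one,
    one_mul, Complex.I_sq]
  congr 1
  ring

/-- Half the squared norm of a standard Gaussian vector in dimension `d` has the Gamma distribution
with shape `d / 2`, here up to the normalization. -/
theorem exists_integral_norm_sq_stdGaussian {d : ℕ} (hd : d ≠ 0) :
    ∃ K : ℝ, ∀ φ : ℝ → ℝ, ∫ x, φ (‖x‖ ^ 2 / 2) ∂stdGaussian (𝔼 d) =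
      K * ∫ t in Set.Ioi (0 : ℝ), t ^ ((d : ℝ) / 2 - 1) * Real.exp (-t) * φ t := by
  have : Nonempty (Fin d) := ⟨⟨0, Nat.pos_of_ne_zero hd⟩⟩
  set c : ℝ := ((2 * Real.pi) ^ ((d : ℝ) / 2))⁻¹
  have hsub : ∀ g : ℝ → ℝ, ∫ y in Set.Ioi (0 : ℝ), y * g (y ^ 2 / 2) =
      ∫ t in Set.Ioi (0 : ℝ), g t := by
    intro g
    have h1 := integral_comp_rpow_Ioi_of_pos (g := fun s => g (2⁻¹ * s)) (p := 2) two_pos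
    rw [integral_comp_mul_left_Ioi (fun s => g s) 0 (by norm_num : (0 : ℝ) < 2⁻¹)] at h1
    simp only [mul_zero, inv_inv, smul_eq_mul] at h1
    have h2 : ∫ x in Set.Ioi (0 : ℝ), 2 * x ^ ((2 : ℝ) - 1) * g (2⁻¹ * x ^ (2 : ℝ)) =
        2 * ∫ y in Set.Ioi (0 : ℝ), y * g (y ^ 2 / 2) := by
      rw [← integral_const_mul]
      refine integral_congr_ae (Filter.Eventually.of_forall fun x => ?_)
      have e1 : (2 : ℝ) - 1 = 1 := by norm_num
      simp only [e1, Real.rpow_one, Real.rpow_two]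
      rw [inv_mul_eq_div]
      ring
    rw [h2] at h1
    linarith
  refine ⟨c * (d * volume.real (Metric.ball (0 : 𝔼 d) 1) * 2 ^ ((d : ℝ) / 2 - 1)), fun φ => ?_⟩
  rw [stdGaussian_eq_withDensity, integral_withDensity_eq_integral_toReal_smul
    (by fun_prop) (Filter.Eventually.of_forall fun x => ENNReal.ofReal_lt_top)]
  have e : ∀ x : 𝔼 d, (ENNReal.ofReal (c * Real.exp (-(1 / 2) * ‖x‖ ^ 2))).toReal •
      φ (‖x‖ ^ 2 / 2) = (fun y : ℝ => c * Real.exp (-(1 / 2) * y ^ 2) * φ (y ^ 2 / 2)) ‖x‖ := by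
    intro x
    rw [ENNReal.toReal_ofReal (by positivity), smul_eq_mul]
  refine (integral_congr_ae (Filter.Eventually.of_forall e)).trans ?_
  rw [integral_fun_norm_addHaar volume
    (fun y : ℝ => c * Real.exp (-(1 / 2) * y ^ 2) * φ (y ^ 2 / 2)),
    ← hsub fun t => t ^ ((d : ℝ) / 2 - 1) * Real.exp (-t) * φ t]
  rw [finrank_euclideanSpace_fin, nsmul_eq_mul, smul_eq_mul]
  have e2 : ∫ y in Set.Ioi (0 : ℝ),
      y ^ (d - 1) • (c * Real.exp (-(1 / 2) * y ^ 2) * φ (y ^ 2 / 2)) =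
      c * 2 ^ ((d : ℝ) / 2 - 1) * ∫ y in Set.Ioi (0 : ℝ),
        y * ((y ^ 2 / 2) ^ ((d : ℝ) / 2 - 1) * Real.exp (-(y ^ 2 / 2)) * φ (y ^ 2 / 2)) := by
    rw [← integral_const_mul]
    refine setIntegral_congr_fun measurableSet_Ioi fun y hy => ?_
    have hy0 : (0 : ℝ) < y := hy
    have e3 : y ^ (d - 1) = y * (2 ^ ((d : ℝ) / 2 - 1) * (y ^ 2 / 2) ^ ((d : ℝ) / 2 - 1)) := by
      rw [← Real.mul_rpow (by norm_num) (by positivity), mul_div_cancel₀ _ (by norm_num),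
        ← Real.rpow_natCast y 2, ← Real.rpow_mul hy0.le, ← Real.rpow_natCast,
        Nat.cast_sub (Nat.one_le_iff_ne_zero.2 hd)]
      nth_rw 2 [← Real.rpow_one y]
      rw [← Real.rpow_add hy0]
      congr 1
      push_cast
      ring
    have e4 : -(1 / 2) * y ^ 2 = -(y ^ 2 / 2) := by ring
    simp only [smul_eq_mul]
    rw [e3, e4]
    ring
  rw [e2]
  ring

/-- The distribution function of half the squared norm of a standard Gaussian vector. -/
theorem stdGaussian_real_norm_sq_le {d : ℕ} (hd : d ≠ 0) {r : ℝ} (hr : 0 ≤ r) :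
    (stdGaussian (𝔼 d)).real {x | ‖x‖ ^ 2 ≤ r} =
      (∫ t in (0 : ℝ)..(r / 2), t ^ ((d : ℝ) / 2 - 1) * Real.exp (-t)) /
        Real.Gamma ((d : ℝ) / 2) := by
  obtain ⟨K, hK⟩ := exists_integral_norm_sq_stdGaussian hd
  have hd0 : (0 : ℝ) < (d : ℝ) / 2 := by
    have : (0 : ℝ) < d := Nat.cast_pos.2 (Nat.pos_of_ne_zero hd)
    positivity
  have h1 := hK fun _ => 1
  have h2 : ∫ t in Set.Ioi (0 : ℝ), t ^ ((d : ℝ) / 2 - 1) * Real.exp (-t) * 1 =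
      Real.Gamma ((d : ℝ) / 2) := by
    rw [Real.Gamma_eq_integral hd0]
    refine integral_congr_ae (Filter.Eventually.of_forall fun t => ?_)
    simp only
    ring
  rw [h2, integral_const, probReal_univ, smul_eq_mul, one_mul] at h1
  have h3 := hK ((Set.Iic (r / 2)).indicator fun _ => 1)
  have hms : MeasurableSet {x : 𝔼 d | ‖x‖ ^ 2 ≤ r} := measurableSet_le (by fun_prop) (by fun_prop)
  have h4 : ∫ x, (Set.Iic (r / 2)).indicator (fun _ => (1 : ℝ)) (‖x‖ ^ 2 / 2)
      ∂stdGaussian (𝔼 d) = (stdGaussian (𝔼 d)).real {x | ‖x‖ ^ 2 ≤ r} := by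
    rw [← integral_indicator_one hms]
    refine integral_congr_ae (Filter.Eventually.of_forall fun x => ?_)
    have : ‖x‖ ^ 2 / 2 ∈ Set.Iic (r / 2) ↔ x ∈ {x : 𝔼 d | ‖x‖ ^ 2 ≤ r} := by
      rw [Set.mem_Iic, Set.mem_ofPred_eq, div_le_div_iff_of_pos_right two_pos]
    by_cases hx : x ∈ {x : 𝔼 d | ‖x‖ ^ 2 ≤ r}
    · simp only [Set.indicator_of_mem (this.2 hx), Set.indicator_of_mem hx, Pi.one_apply]
    · simp only [Set.indicator_of_notMem (mt this.1 hx), Set.indicator_of_notMem hx]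
  have h5 : ∫ t in Set.Ioi (0 : ℝ), t ^ ((d : ℝ) / 2 - 1) * Real.exp (-t) *
      (Set.Iic (r / 2)).indicator (fun _ => (1 : ℝ)) t =
      ∫ t in (0 : ℝ)..(r / 2), t ^ ((d : ℝ) / 2 - 1) * Real.exp (-t) := by
    rw [intervalIntegral.integral_of_le (by positivity), ← Set.Ioi_inter_Iic,
      ← setIntegral_indicator measurableSet_Iic]
    refine integral_congr_ae (Filter.Eventually.of_forall fun t => ?_)
    by_cases ht : t ∈ Set.Iic (r / 2)
    · simp [Set.indicator_of_mem ht]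
    · simp [Set.indicator_of_notMem ht]
  rw [h4, h5] at h3
  have hΓ := Real.Gamma_pos_of_pos hd0
  rw [h3, eq_div_iff hΓ.ne', mul_right_comm, ← h1, one_mul]

theorem pi_gaussianReal_sum_sq_le (d : ℕ) (r : ℝ) :
    (Measure.pi fun _ : Fin d => gaussianReal 0 1).real {w | ∑ i, w i ^ 2 ≤ r} =
      (stdGaussian (𝔼 d)).real {x | ‖x‖ ^ 2 ≤ r} := by
  rw [← map_pi_eq_stdGaussian, map_measureReal_apply (by fun_prop)
    (measurableSet_le (by fun_prop) (by fun_prop))]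
  congr 1
  ext w
  simp [EuclideanSpace.norm_sq_eq]

theorem intervalIntegrable_gamma {a : ℝ} (ha : 0 < a) {x : ℝ} (hx : 0 ≤ x) :
    IntervalIntegrable (fun t : ℝ => t ^ (a - 1) * Real.exp (-t)) volume 0 x := by
  rw [intervalIntegrable_iff_integrableOn_Ioc_of_le hx]
  refine (Real.GammaIntegral_convergent ha).mono_set Set.Ioc_subset_Ioi_self |>.congr ?_
  exact Filter.Eventually.of_forall fun t => mul_comm _ _

/-- The lower incomplete gamma function satisfies `γ(a, a + 1/2) ≤ (3/2) γ(a, a)`: its integrand is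
at most `a ^ (a - 1) e⁻ᵃ` on `[a, ∞)`, and its integral up to `a` is at least that, since
`(t ^ a e⁻ᵗ)' = (a - t) t ^ (a - 1) e⁻ᵗ`. -/
theorem integral_gamma_le {a : ℝ} (ha : 0 < a) :
    ∫ t in (0 : ℝ)..(a + 1 / 2), t ^ (a - 1) * Real.exp (-t) ≤
      3 / 2 * ∫ t in (0 : ℝ)..a, t ^ (a - 1) * Real.exp (-t) := by
  have hi := intervalIntegrable_gamma ha ha.le
  have hi2 := intervalIntegrable_gamma ha (by linarith : 0 ≤ a + 1 / 2)
  have hi3 : IntervalIntegrable (fun t : ℝ => t ^ (a - 1) * Real.exp (-t)) volume a (a + 1 / 2) :=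
    hi.symm.trans hi2
  have hlow : a ^ (a - 1) * Real.exp (-a) ≤
      ∫ t in (0 : ℝ)..a, t ^ (a - 1) * Real.exp (-t) := by
    have hderiv : ∀ t ∈ Set.Ioo 0 a, HasDerivAt (fun t : ℝ => t ^ a * Real.exp (-t))
        ((a - t) * (t ^ (a - 1) * Real.exp (-t))) t := by
      intro t ht
      have h1 := (Real.hasDerivAt_rpow_const (x := t) (p := a) (Or.inl ht.1.ne')).mul
        ((Real.hasDerivAt_exp (-t)).comp t (hasDerivAt_neg t))
      refine h1.congr_deriv ?_
      have h2 : t ^ a = t * t ^ (a - 1) := by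
        nth_rw 2 [← Real.rpow_one t]
        rw [← Real.rpow_add ht.1]
        congr 1
        ring
      simp only [Function.comp_apply]
      rw [h2]
      ring
    have hint : IntervalIntegrable (fun t : ℝ => (a - t) * (t ^ (a - 1) * Real.exp (-t)))
        volume 0 a := hi.continuousOn_mul (by fun_prop)
    have h3 := intervalIntegral.integral_eq_sub_of_hasDerivAt_of_le ha.le
      (f := fun t : ℝ => t ^ a * Real.exp (-t))
      (((Real.continuous_rpow_const ha.le).mul (by fun_prop)).continuousOn) hderiv hint
    rw [Real.zero_rpow ha.ne', zero_mul, sub_zero] at h3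
    have h4 : ∫ t in (0 : ℝ)..a, (a - t) * (t ^ (a - 1) * Real.exp (-t)) ≤
        ∫ t in (0 : ℝ)..a, a * (t ^ (a - 1) * Real.exp (-t)) := by
      refine intervalIntegral.integral_mono_on ha.le hint (hi.const_mul a) fun t ht => ?_
      have : 0 ≤ t ^ (a - 1) * Real.exp (-t) :=
        mul_nonneg (Real.rpow_nonneg ht.1 _) (Real.exp_nonneg _)
      nlinarith [ht.1]
    rw [h3, intervalIntegral.integral_const_mul] at h4
    refine le_of_mul_le_mul_left (a := a) ?_ ha
    refine le_trans (le_of_eq ?_) h4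
    rw [Real.rpow_sub_one ha.ne']
    field_simp
  have hup : ∫ t in a..(a + 1 / 2), t ^ (a - 1) * Real.exp (-t) ≤
      1 / 2 * (a ^ (a - 1) * Real.exp (-a)) := by
    have h1 : ∫ t in a..(a + 1 / 2), t ^ (a - 1) * Real.exp (-t) ≤
        ∫ t in a..(a + 1 / 2), a ^ (a - 1) * Real.exp (-a) := by
      refine intervalIntegral.integral_mono_on (by linarith) hi3 (by simp) fun t ht => ?_
      have ht0 : 0 < t := ha.trans_le ht.1
      -- `t ^ a e⁻ᵗ` is largest at `t = a`
      have h2 : (t / a) ^ a ≤ Real.exp (t - a) := by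
        have h3 : t / a ≤ Real.exp ((t - a) / a) := by
          have := Real.add_one_le_exp ((t - a) / a)
          rw [sub_div, div_self ha.ne', sub_add_cancel] at this
          rwa [sub_div, div_self ha.ne']
        calc (t / a) ^ a ≤ Real.exp ((t - a) / a) ^ a :=
              Real.rpow_le_rpow (by positivity) h3 ha.le
          _ = Real.exp (t - a) := by
            rw [← Real.exp_mul, div_mul_cancel₀ _ ha.ne']
      rw [Real.div_rpow ht0.le ha.le, div_le_iff₀ (by positivity)] at h2
      have h4 : t ^ a * Real.exp (-t) ≤ a ^ a * Real.exp (-a) := by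
        calc t ^ a * Real.exp (-t) ≤ Real.exp (t - a) * a ^ a * Real.exp (-t) := by gcongr
          _ = a ^ a * (Real.exp (t - a) * Real.exp (-t)) := by ring
          _ = _ := by rw [← Real.exp_add]; ring_nf
      rw [Real.rpow_sub_one ht0.ne', Real.rpow_sub_one ha.ne', div_mul_eq_mul_div,
        div_mul_eq_mul_div]
      exact div_le_div₀ (by positivity) h4 ha ht.1
    refine h1.trans (le_of_eq ?_)
    rw [intervalIntegral.integral_const, smul_eq_mul]
    ring
  rw [← intervalIntegral.integral_add_adjacent_intervals hi hi3]
  linarith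

theorem pi_gaussianReal_sum_sq_le_add_one (k : ℕ) :
    (Measure.pi fun _ : Fin k => gaussianReal 0 1).real {w | ∑ i, w i ^ 2 ≤ (k : ℝ) + 1} ≤
      3 / 2 * (Measure.pi fun _ : Fin k => gaussianReal 0 1).real {w | ∑ i, w i ^ 2 ≤ (k : ℝ)} := by
  rcases eq_or_ne k 0 with rfl | hk
  · simp
    norm_num
  · have hk0 : (0 : ℝ) < (k : ℝ) / 2 := by
      have : (0 : ℝ) < k := Nat.cast_pos.2 (Nat.pos_of_ne_zero hk)
      positivity
    rw [pi_gaussianReal_sum_sq_le, pi_gaussianReal_sum_sq_le,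
      stdGaussian_real_norm_sq_le hk (by positivity),
      stdGaussian_real_norm_sq_le hk (by positivity),
      ← mul_div_assoc, add_div]
    have := integral_gamma_le hk0
    have hΓ := Real.Gamma_pos_of_pos hk0
    gcongr

theorem pi_gaussianReal_sum_sq_le_pos (k : ℕ) :
    0 < (Measure.pi fun _ : Fin k => gaussianReal 0 1).real {w | ∑ i, w i ^ 2 ≤ (k : ℝ)} := by
  rcases eq_or_ne k 0 with rfl | hk
  · simp
  · have hk0 : (0 : ℝ) < (k : ℝ) / 2 := by
      have : (0 : ℝ) < k := Nat.cast_pos.2 (Nat.pos_of_ne_zero hk)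
      positivity
    rw [pi_gaussianReal_sum_sq_le, stdGaussian_real_norm_sq_le hk (by positivity)]
    refine div_pos ?_ (Real.Gamma_pos_of_pos hk0)
    refine intervalIntegral.intervalIntegral_pos_of_pos_on (intervalIntegrable_gamma hk0 hk0.le)
      (fun t ht => ?_) hk0
    exact mul_pos (Real.rpow_pos_of_pos ht.1 _) (Real.exp_pos _)

end ChiSquare

/-! ### Gaussian measure of a ball with thin slices removed -/

section Slab

local notation "𝔼" k:max => EuclideanSpace ℝ (Fin k)

/-- Among the sets of length at most `1`, the centred interval has the largest Gaussian measure: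
the density is at least `φ (1 / 2)` on that interval and at most `φ (1 / 2)` outside. -/
theorem gaussianReal_le_of_volume_le_one {s : Set ℝ} (hs : MeasurableSet s)
    (hvol : volume s ≤ 1) :
    gaussianReal 0 1 s ≤ gaussianReal 0 1 (Set.Icc (-(1 / 2)) (1 / 2)) := by
  set J : Set ℝ := Set.Icc (-(1 / 2)) (1 / 2) with hJ
  have hJm : MeasurableSet J := measurableSet_Icc
  have hJv : volume J = 1 := by
    rw [hJ, Real.volume_Icc]
    norm_num
  have hpdf : ∀ x y : ℝ, |x| ≤ |y| → gaussianPDF 0 1 y ≤ gaussianPDF 0 1 x := by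
    intro x y hxy
    refine ENNReal.ofReal_le_ofReal ?_
    rw [gaussianPDFReal, gaussianPDFReal]
    gcongr ?_ * Real.exp (-?_ / _)
    simpa using sq_le_sq.2 hxy
  have habs : |(1 / 2 : ℝ)| = 1 / 2 := abs_of_pos (by norm_num)
  have h1 : gaussianReal 0 1 (s \ J) ≤ gaussianPDF 0 1 (1 / 2) * volume (s \ J) := by
    rw [gaussianReal_apply _ one_ne_zero, ← setLIntegral_const]
    refine setLIntegral_mono' (hs.diff hJm) fun x hx => hpdf _ _ ?_
    rw [habs]
    by_contra! h
    exact hx.2 (abs_le.1 h.le)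
  have h2 : gaussianPDF 0 1 (1 / 2) * volume (J \ s) ≤ gaussianReal 0 1 (J \ s) := by
    rw [gaussianReal_apply _ one_ne_zero, ← setLIntegral_const]
    refine setLIntegral_mono' (hJm.diff hs) fun x hx => hpdf _ _ ?_
    rw [habs]
    exact abs_le.2 hx.1
  have h3 : volume (s \ J) ≤ volume (J \ s) := by
    have e1 := measure_inter_add_sdiff s hJm (μ := volume)
    have e2 := measure_inter_add_sdiff J hs (μ := volume)
    refine ENNReal.le_of_add_le_add_left (a := volume (s ∩ J))
      (measure_ne_top_of_subset Set.inter_subset_right (by simp [hJv])) ?_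
    rwa [e1, Set.inter_comm, e2, hJv]
  rw [← measure_inter_add_sdiff s hJm, ← measure_inter_add_sdiff J hs, Set.inter_comm J s]
  exact add_le_add le_rfl (h1.trans ((mul_le_mul_right h3 _).trans h2))

theorem gaussianReal_le_of_subset_sq_le {s : Set ℝ} (hs : MeasurableSet s)
    (hvol : volume s ≤ 1) {r : ℝ} (hr : ∀ t ∈ s, t ^ 2 ≤ r) :
    gaussianReal 0 1 s ≤ gaussianReal 0 1 {t | |t| ≤ 1 / 2 ∧ t ^ 2 ≤ r} := by
  rcases le_or_gt ((1 / 2 : ℝ) ^ 2) r with h | h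
  · refine (gaussianReal_le_of_volume_le_one hs hvol).trans (measure_mono fun t ht => ?_)
    have ht' : |t| ≤ 1 / 2 := abs_le.2 ht
    refine ⟨ht', le_trans ?_ h⟩
    rw [← sq_abs]
    gcongr
  · refine measure_mono fun t ht => ⟨?_, hr t ht⟩
    exact abs_le_of_sq_le_sq ((hr t ht).trans h.le) (by norm_num)

theorem gaussianReal_real_Icc {a : ℝ} (ha : 0 ≤ a) :
    (gaussianReal 0 1).real (Set.Icc (-a) a) =
      (√(2 * Real.pi))⁻¹ * ∫ t in (-a)..a, Real.exp (-(t ^ 2 / 2)) := by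
  rw [measureReal_def, gaussianReal_apply_eq_integral _ one_ne_zero, ENNReal.toReal_ofReal
    (integral_nonneg fun x => gaussianPDFReal_nonneg _ _ _), integral_Icc_eq_integral_Ioc,
    ← intervalIntegral.integral_of_le (by linarith), ← intervalIntegral.integral_const_mul]
  refine intervalIntegral.integral_congr fun t _ => ?_
  simp only [gaussianPDFReal, NNReal.coe_one, mul_one, sub_zero, neg_div]

theorem abs_exp_neg_sub_le {t : ℝ} (ht : |t| ≤ 1) :
    |Real.exp (-(t ^ 2 / 2)) - (1 - t ^ 2 / 2 + t ^ 4 / 8)| ≤ t ^ 6 / 36 := by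
  have h0 : t ^ 2 ≤ 1 := by
    rw [← sq_abs]
    exact pow_le_one₀ (abs_nonneg t) ht
  have h1 := Real.exp_bound (x := -(t ^ 2 / 2)) (by
    rw [abs_neg, abs_of_nonneg (by positivity)]
    linarith) (n := 3) (by norm_num)
  rw [abs_neg, abs_of_nonneg (by positivity : 0 ≤ t ^ 2 / 2)] at h1
  simp only [Finset.sum_range_succ, Finset.range_zero, Finset.sum_empty, pow_zero,
    Nat.factorial] at h1
  norm_num at h1
  refine le_trans (le_of_eq ?_) (h1.trans (le_of_eq ?_))
  · congr 1
    ring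
  · ring

theorem integral_exp_taylor (κ a b : ℝ) :
    ∫ t in a..b, (1 - t ^ 2 / 2 + t ^ 4 / 8 + κ * t ^ 6) =
      (b - b ^ 3 / 6 + b ^ 5 / 40 + κ * b ^ 7 / 7) -
        (a - a ^ 3 / 6 + a ^ 5 / 40 + κ * a ^ 7 / 7) := by
  refine intervalIntegral.integral_eq_sub_of_hasDerivAt
    (f := fun t => t - t ^ 3 / 6 + t ^ 5 / 40 + κ * t ^ 7 / 7) (fun t _ => ?_)
    (Continuous.intervalIntegrable (by fun_prop) _ _)
  have h := (((hasDerivAt_id t).sub ((hasDerivAt_pow 3 t).div_const 6)).add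
    ((hasDerivAt_pow 5 t).div_const 40)).add (((hasDerivAt_pow 7 t).const_mul κ).div_const 7)
  refine h.congr_deriv ?_
  push_cast
  ring

/-- The true value is about `0.3829`. -/
theorem gaussianReal_real_half_le :
    (gaussianReal 0 1).real (Set.Icc (-(1 / 2)) (1 / 2)) ≤ 0.384 := by
  rw [gaussianReal_real_Icc (by norm_num)]
  have h1 : ∫ t in (-(1 / 2 : ℝ))..(1 / 2), Real.exp (-(t ^ 2 / 2)) ≤
      ∫ t in (-(1 / 2 : ℝ))..(1 / 2), (1 - t ^ 2 / 2 + t ^ 4 / 8 + 1 / 36 * t ^ 6) := by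
    refine intervalIntegral.integral_mono_on (by norm_num)
      (Continuous.intervalIntegrable (by fun_prop) _ _)
      (Continuous.intervalIntegrable (by fun_prop) _ _) fun t ht => ?_
    have := (abs_le.1 (abs_exp_neg_sub_le (t := t) (abs_le.2 ⟨by linarith [ht.1],
      by linarith [ht.2]⟩))).2
    linarith
  have h2 : ∫ t in (-(1 / 2 : ℝ))..(1 / 2), (1 - t ^ 2 / 2 + t ^ 4 / 8 + 1 / 36 * t ^ 6) ≤
      0.961 := by
    rw [integral_exp_taylor]
    norm_num
  have h3 : 2.506 ≤ √(2 * Real.pi) := by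
    refine Real.le_sqrt_of_sq_le ?_
    nlinarith [Real.pi_gt_d6]
  rw [inv_mul_eq_div, div_le_iff₀ (by linarith)]
  linarith

/-- The true value is about `0.6827`. -/
theorem le_gaussianReal_real_one : 0.68 ≤ (gaussianReal 0 1).real (Set.Icc (-1) 1) := by
  rw [gaussianReal_real_Icc (by norm_num)]
  have h1 : ∫ t in (-1 : ℝ)..1, (1 - t ^ 2 / 2 + t ^ 4 / 8 + -1 / 36 * t ^ 6) ≤
      ∫ t in (-1 : ℝ)..1, Real.exp (-(t ^ 2 / 2)) := by
    refine intervalIntegral.integral_mono_on (by norm_num)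
      (Continuous.intervalIntegrable (by fun_prop) _ _)
      (Continuous.intervalIntegrable (by fun_prop) _ _) fun t ht => ?_
    have := (abs_le.1 (abs_exp_neg_sub_le (t := t) (abs_le.2 ht))).1
    linarith
  have h2 : 1.708 ≤ ∫ t in (-1 : ℝ)..1, (1 - t ^ 2 / 2 + t ^ 4 / 8 + -1 / 36 * t ^ 6) := by
    rw [integral_exp_taylor]
    norm_num
  have h3 : √(2 * Real.pi) ≤ 2.507 := by
    refine Real.sqrt_le_iff.2 ⟨by norm_num, ?_⟩
    nlinarith [Real.pi_lt_d6]
  have h4 : 0 < √(2 * Real.pi) := by positivity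
  rw [inv_mul_eq_div, le_div_iff₀ h4]
  linarith

theorem one_sub_gaussianReal_real_one :
    1 - (gaussianReal 0 1).real (Set.Icc (-1) 1) = 2 * (1 - cdf (gaussianReal 0 1) 1) := by
  have h1 : (gaussianReal 0 1).real (Set.Iio (-1)) = (gaussianReal 0 1).real (Set.Ioi 1) := by
    have h : (gaussianReal 0 1).map (fun x => -x) = gaussianReal 0 1 := by
      rw [gaussianReal_map_neg, neg_zero]
    nth_rw 1 [← h]
    rw [map_measureReal_apply measurable_neg measurableSet_Iio]
    congr 1
    ext x
    simp
  have h2 : (gaussianReal 0 1).real (Set.Ioi 1) = 1 - cdf (gaussianReal 0 1) 1 := by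
    rw [cdf_eq_real, ← Set.compl_Iic, probReal_compl_eq_one_sub measurableSet_Iic]
  have h3 : (Set.Icc (-1 : ℝ) 1)ᶜ = Set.Iio (-1) ∪ Set.Ioi 1 := by
    ext x
    simp only [Set.mem_compl_iff, Set.mem_Icc, Set.mem_union, Set.mem_Iio, Set.mem_Ioi, not_and_or,
      not_le]
  rw [← probReal_compl_eq_one_sub measurableSet_Icc, h3, measureReal_union ?_ measurableSet_Ioi,
    h1, h2]
  · ring
  · rw [Set.disjoint_left]
    intro x hx hx'
    rw [Set.mem_Iio] at hx
    rw [Set.mem_Ioi] at hx'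
    linarith

/-- Orthogonal coordinates in which `e` is the first basis vector. -/
theorem exists_coordinates {k : ℕ} {e : 𝔼 (k + 1)} (he : ‖e‖ = 1) :
    ∃ ι : (Fin k → ℝ) → 𝔼 (k + 1), Measurable ι ∧
      ((gaussianReal 0 1).prod (Measure.pi fun _ : Fin k => gaussianReal 0 1)).map
        (fun p => p.1 • e + ι p.2) = stdGaussian (𝔼 (k + 1)) ∧
      ∀ t w, ‖t • e + ι w‖ ^ 2 = t ^ 2 + ∑ i, w i ^ 2 := by
  obtain ⟨b, hb⟩ := Orthonormal.exists_orthonormalBasis_extension_of_card_eq (𝕜 := ℝ)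
    (ι := Fin (k + 1)) (by simp) (v := fun _ => e) (s := {0})
    (by
      rw [orthonormal_iff_ite]
      rintro ⟨i, rfl⟩ ⟨j, rfl⟩
      simp [he])
  have hb0 : b 0 = e := hb 0 rfl
  refine ⟨fun w => ∑ i : Fin k, w i • b i.succ, by fun_prop, ?_, fun t w => ?_⟩
  · rw [stdGaussian_eq_map_pi_orthonormalBasis b]
    have h := (measurePreserving_piFinSuccAbove (fun _ : Fin (k + 1) => gaussianReal 0 1) 0).symm
    rw [← h.map_eq, Measure.map_map (by fun_prop) (MeasurableEquiv.measurable _)]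
    congr 1
    ext1 p
    simp [Fin.sum_univ_succ, hb0]
  · have h1 : t • e + ∑ i : Fin k, w i • b i.succ =
        ∑ i, (Fin.cons t w : Fin (k + 1) → ℝ) i • b i := by
      rw [Fin.sum_univ_succ, hb0]
      simp
    rw [h1, ← b.sum_sq_inner_right]
    simp only [b.orthonormal.inner_right_fintype]
    rw [Fin.sum_univ_succ]
    simp

/-- Removing from the ball `‖x‖ ^ 2 ≤ n` a set whose slices in one direction have length at most `1`
leaves more than the fraction `2 (1 - Φ(1))` of its Gaussian measure. The removed part has at most
the measure of the slab `s = {|x₁| ≤ 1 / 2}` of the ball. With `A`, `C` the measures of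
`[-1/2, 1/2]`, `[-1, 1]` and `F r` the measure of the ball `‖w‖ ^ 2 ≤ r` in dimension `k = n - 1`,
the slab has measure at most `A F (k + 1) ≤ 3 / 2 A F k`, and the ball contains, beside the slab, a
set of measure `(C - A) F k`. -/
theorem lt_stdGaussian_ball_diff {k : ℕ} {e : 𝔼 (k + 1)} (he : ‖e‖ = 1) {S : Set (𝔼 (k + 1))}
    (hS : MeasurableSet S)
    (hslice : ∀ x, volume {t : ℝ | ‖t • e + x‖ ^ 2 ≤ (k : ℝ) + 1 ∧ t • e + x ∈ S} ≤ 1) :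
    2 * (1 - cdf (gaussianReal 0 1) 1) *
        (stdGaussian (𝔼 (k + 1))).real {x | ‖x‖ ^ 2 ≤ (k : ℝ) + 1} <
      (stdGaussian (𝔼 (k + 1))).real ({x | ‖x‖ ^ 2 ≤ (k : ℝ) + 1} \ S) := by
  obtain ⟨ι, hι, hmap, hnorm⟩ := exists_coordinates he
  set G := gaussianReal 0 1
  set ν := Measure.pi fun _ : Fin k => G with hν
  set B : Set (𝔼 (k + 1)) := {x | ‖x‖ ^ 2 ≤ (k : ℝ) + 1} with hB
  have hBm : MeasurableSet B := measurableSet_le (by fun_prop) (by fun_prop)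
  have hψ : Measurable fun p : ℝ × (Fin k → ℝ) => p.1 • e + ι p.2 := by fun_prop
  set A := G.real (Set.Icc (-(1 / 2)) (1 / 2)) with hA
  set C := G.real (Set.Icc (-1) 1) with hC
  set F : ℝ → ℝ := fun r => ν.real {w | ∑ i, w i ^ 2 ≤ r} with hF
  have hFm : ∀ r : ℝ, MeasurableSet {w : Fin k → ℝ | ∑ i, w i ^ 2 ≤ r} := fun r =>
    measurableSet_le (by fun_prop) (by fun_prop)
  -- the part of the ball in the slab
  set s : Set (ℝ × (Fin k → ℝ)) := {p | |p.1| ≤ 1 / 2 ∧ p.1 ^ 2 + ∑ i, p.2 i ^ 2 ≤ (k : ℝ) + 1}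
    with hs
  have hsm : MeasurableSet s := by
    have a1 : MeasurableSet {p : ℝ × (Fin k → ℝ) | |p.1| ≤ 1 / 2} :=
      measurableSet_le (by fun_prop) (by fun_prop)
    have a2 : MeasurableSet {p : ℝ × (Fin k → ℝ) | p.1 ^ 2 + ∑ i, p.2 i ^ 2 ≤ (k : ℝ) + 1} :=
      measurableSet_le (by fun_prop) (by fun_prop)
    exact a1.inter a2
  have h1 : (stdGaussian (𝔼 (k + 1))).real (B ∩ S) ≤ (G.prod ν).real s := by
    rw [← hmap, map_measureReal_apply hψ (hBm.inter hS)]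
    refine ENNReal.toReal_mono (measure_ne_top _ _) ?_
    rw [Measure.prod_apply_symm (hψ (hBm.inter hS)), Measure.prod_apply_symm hsm]
    refine lintegral_mono fun w => ?_
    have hsl := hslice (ι w)
    have e1 : ((fun t : ℝ => (t, w)) ⁻¹'
          ((fun p : ℝ × (Fin k → ℝ) => p.1 • e + ι p.2) ⁻¹' (B ∩ S))) =
        {t : ℝ | ‖t • e + ι w‖ ^ 2 ≤ (k : ℝ) + 1 ∧ t • e + ι w ∈ S} := rfl
    have e2 : ((fun t : ℝ => (t, w)) ⁻¹' s) =
        {t : ℝ | |t| ≤ 1 / 2 ∧ t ^ 2 ≤ (k : ℝ) + 1 - ∑ i, w i ^ 2} := by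
      ext t
      simp only [hs, Set.mem_preimage, Set.mem_ofPred_eq, le_sub_iff_add_le]
    rw [e1, e2]
    refine gaussianReal_le_of_subset_sq_le ?_ hsl fun t ht => ?_
    · exact (by fun_prop : Measurable fun t : ℝ => t • e + ι w) (hBm.inter hS)
    · have := ht.1
      rw [hnorm] at this
      linarith
  have h2 : (G.prod ν).real s ≤ A * F (k + 1) := by
    rw [hA, hF, ← measureReal_prod_prod]
    refine measureReal_mono fun p hp => ⟨abs_le.1 hp.1, ?_⟩
    have := hp.2
    simp only [Set.mem_ofPred_eq]
    nlinarith [sq_nonneg p.1]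
  have h3 : (G.prod ν).real s + (C - A) * F k ≤ (stdGaussian (𝔼 (k + 1))).real B := by
    have e1 : C - A = G.real (Set.Icc (-1) 1 \ Set.Icc (-(1 / 2)) (1 / 2)) := by
      rw [measureReal_sdiff (Set.Icc_subset_Icc (by norm_num) (by norm_num)) measurableSet_Icc]
    rw [e1, hF, ← measureReal_prod_prod, ← measureReal_union, ← hmap, map_measureReal_apply hψ hBm]
    · refine measureReal_mono ?_
      rintro p (hp | hp)
      · rw [Set.mem_preimage, hB, Set.mem_ofPred_eq, hnorm]
        exact hp.2
      · rw [Set.mem_preimage, hB, Set.mem_ofPred_eq, hnorm]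
        have h4 : ∑ i, p.2 i ^ 2 ≤ (k : ℝ) := hp.2
        have h5 : |p.1| ≤ 1 := abs_le.2 hp.1.1
        have h6 := (sq_le_one_iff_abs_le_one _).2 h5
        linarith
    · rw [Set.disjoint_left]
      intro p hp hp'
      exact hp'.1.2 (abs_le.1 hp.1)
    · exact (measurableSet_Icc.diff measurableSet_Icc).prod (hFm _)
  have h4 : F (k + 1) ≤ 3 / 2 * F k := pi_gaussianReal_sum_sq_le_add_one k
  have h5 : 0 < F k := pi_gaussianReal_sum_sq_le_pos k
  have hA' : A ≤ 0.384 := gaussianReal_real_half_le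
  have hA0 : 0 ≤ A := measureReal_nonneg
  have hC' : 0.68 ≤ C := le_gaussianReal_real_one
  have hC1 : C ≤ 1 := measureReal_le_one
  have h6 : (stdGaussian (𝔼 (k + 1))).real (B \ S) =
      (stdGaussian (𝔼 (k + 1))).real B - (stdGaussian (𝔼 (k + 1))).real (B ∩ S) := by
    have := measureReal_inter_add_sdiff (μ := stdGaussian (𝔼 (k + 1))) (s := B) hS
    linarith
  rw [← one_sub_gaussianReal_real_one, h6]
  have h7 : (1 - C) * (G.prod ν).real s ≤ (1 - C) * (A * (3 / 2 * F k)) := by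
    refine mul_le_mul_of_nonneg_left (h2.trans ?_) (by linarith)
    gcongr
  have h8 : (1 - C) * (A * (3 / 2)) < C * (C - A) := by nlinarith
  have h9 := mul_lt_mul_of_pos_right h8 h5
  have h10 := mul_le_mul_of_nonneg_left h3 (by linarith : 0 ≤ C)
  linarith

end Slab

/-! ### The success probability of a single perturbation -/

section Perturbation

variable {n : ℕ} {f : EuclideanSpace ℝ (Fin n) → ℝ} {θ : Params}

local notation "𝔼" k:max => EuclideanSpace ℝ (Fin k)

theorem noiseLaw_eq_map_stdGaussian (n : ℕ) (θ : Params) :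
    noiseLaw n θ = (stdGaussian (𝔼 n)).map fun x => (2 * θ.ε / θ.m) • x := by
  have h1 : gaussianReal 0 (Real.toNNReal ((2 * θ.ε / θ.m) ^ 2)) =
      (gaussianReal 0 1).map fun x => (2 * θ.ε / θ.m) * x := by
    rw [gaussianReal_map_const_mul, mul_zero, mul_one]
    congr 1
    exact Real.toNNReal_of_nonneg (sq_nonneg _)
  rw [noiseLaw, ← map_pi_eq_stdGaussian, Measure.map_map (by fun_prop) (by fun_prop), h1,
    ← Measure.pi_map_pi (fun _ => by fun_prop), Measure.map_map (by fun_prop) (by fun_prop)]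
  congr 1

instance isProbabilityMeasure_noiseLaw (n : ℕ) (θ : Params) :
    IsProbabilityMeasure (noiseLaw n θ) := by
  rw [noiseLaw_eq_map_stdGaussian]
  exact Measure.isProbabilityMeasure_map (by fun_prop)

theorem continuous_gradient (hf : ContDiff ℝ 2 f) : Continuous (gradient f) :=
  (contDiff_gradient hf).continuous

namespace Standing

variable (H : Standing f θ) {c x : EuclideanSpace ℝ (Fin n)}

include H

theorem sigma_pos : 0 < 2 * θ.ε / θ.m := by
  have := H.ε_pos
  have := H.m_pos
  positivity

/-- On the neighbourhood of a critical point the gradient is, up to Lipschitz error `m`, linear. -/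
theorem norm_gradient_sub_hessian_le {y z : 𝔼 n} (hy : y ∈ nbhd θ c) (hz : z ∈ nbhd θ c) :
    ‖gradient f z - gradient f y - hessian f c (z - y)‖ ≤ θ.m * ‖z - y‖ :=
  (convex_ball c (θ.m / θ.L)).norm_image_sub_le_of_norm_hasFDerivWithin_le'
    (fun w _ => (hasFDerivAt_gradient H.contDiff w).hasFDerivWithinAt)
    (fun _ hw => H.norm_hessian_sub_le hw) hy hz

theorem norm_sigma_smul_le {z : 𝔼 n} (hz : ‖z‖ ^ 2 ≤ (n : ℝ)) :
    ‖(2 * θ.ε / θ.m) • z‖ ≤ 2 * θ.ε / θ.m * √(n : ℝ) := by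
  have := H.sigma_pos
  rw [norm_smul, Real.norm_of_nonneg this.le]
  gcongr
  exact Real.le_sqrt_of_sq_le hz

theorem accepted_of_norm_sq_le (hx : ‖gradient f x‖ < θ.ε) {z : 𝔼 n} (hz : ‖z‖ ^ 2 ≤ (n : ℝ)) :
    Accepted f θ (x + (2 * θ.ε / θ.m) • z) := by
  have hm := H.m_pos
  have hM := H.M_pos
  have h1 := H.lip_gradient (x + (2 * θ.ε / θ.m) • z) x
  rw [add_sub_cancel_left] at h1
  have h2 : ‖gradient f (x + (2 * θ.ε / θ.m) • z)‖ ≤ ‖gradient f x‖ +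
      ‖gradient f (x + (2 * θ.ε / θ.m) • z) - gradient f x‖ := norm_le_insert' _ _
  have h3 : θ.M * ‖(2 * θ.ε / θ.m) • z‖ ≤ θ.M * (2 * θ.ε / θ.m * √(n : ℝ)) := by
    gcongr
    exact H.norm_sigma_smul_le hz
  rw [Accepted]
  have e : (2 * √(n : ℝ) * (θ.M / θ.m) + 1) * θ.ε = θ.ε + θ.M * (2 * θ.ε / θ.m * √(n : ℝ)) := by
    ring
  linarith

theorem add_mem_nbhd (hc : IsSaddle f c) (hxc : x ∈ nbhd θ c) (hx : ‖gradient f x‖ < θ.ε)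
    {z : 𝔼 n} (hz : ‖z‖ ^ 2 ≤ (n : ℝ)) : x + (2 * θ.ε / θ.m) • z ∈ nbhd θ c := by
  have hm := H.m_pos
  have hL := H.L_pos
  have hε := H.ε_pos
  rw [nbhd, Metric.mem_ball, dist_eq_norm, lt_div_iff₀ hL, add_sub_right_comm]
  have h1 := H.norm_sigma_smul_le hz
  have h2 := H.mul_norm_sub_le_norm_gradient hc.1 hxc
  have h3 := norm_add_le (x - c) ((2 * θ.ε / θ.m) • z)
  have h4 := H.eps_mul_denom_lt
  have h5 := H.two_mul_m_lt_M hc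
  have h6 := H.delta_mul_L_le
  have h7 : 0 ≤ √(n : ℝ) := Real.sqrt_nonneg _
  have h8 := H.zeta_mul_delta_lt
  have e : θ.m * (2 * θ.ε / θ.m * √(n : ℝ)) = 2 * θ.ε * √(n : ℝ) := by field_simp
  -- all lengths are compared after multiplication by `m`
  have h9 : θ.m * ‖x - c + (2 * θ.ε / θ.m) • z‖ ≤ θ.ε * (2 * √(n : ℝ) + 1) := by
    have h10 : θ.m * ‖(2 * θ.ε / θ.m) • z‖ ≤ θ.m * (2 * θ.ε / θ.m * √(n : ℝ)) := by gcongr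
    rw [e] at h10
    nlinarith
  have h11 : θ.ε * (2 * √(n : ℝ) + 1) * θ.m ≤ θ.ε * (2 * θ.M * √(n : ℝ) + θ.m) := by
    rw [mul_assoc]
    gcongr
    nlinarith
  have h12 : θ.ε * (2 * √(n : ℝ) + 1) < θ.δ := by
    refine lt_of_mul_lt_mul_right (a := θ.m) ?_ hm.le
    nlinarith
  refine lt_of_mul_lt_mul_left (a := θ.m) ?_ hm.le
  nlinarith

/-- Along an eigenvector `e` of the Hessian at the saddle with negative eigenvalue the derivative of
`⟪∇f, e⟫` is less than `-m`, so that `⟪∇f, e⟫` is small only on a short interval. -/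
theorem volume_slice_le (hc : IsSaddle f c) (hxc : x ∈ nbhd θ c) (hx : ‖gradient f x‖ < θ.ε)
    {e : 𝔼 n} (he : ‖e‖ = 1) {μ : ℝ} (hμ : μ < -(2 * θ.m)) (heμ : hessian f c e = μ • e) (y : 𝔼 n) :
    volume {t : ℝ | ‖t • e + y‖ ^ 2 ≤ (n : ℝ) ∧
      t • e + y ∈ {z | |inner ℝ (gradient f (x + (2 * θ.ε / θ.m) • z)) e| ≤ θ.γ * θ.ε}} ≤ 1 := by
  refine (Real.volume_le_diam _).trans (Metric.ediam_le fun t ht s hs => ?_)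
  have hσ := H.sigma_pos
  have hm := H.m_pos
  have hε := H.ε_pos
  rw [edist_dist, ← ENNReal.ofReal_one]
  refine ENNReal.ofReal_le_ofReal ?_
  rw [Real.dist_eq]
  have h1 := H.norm_gradient_sub_hessian_le (H.add_mem_nbhd hc hxc hx hs.1)
    (H.add_mem_nbhd hc hxc hx ht.1)
  have hsσ := hs.2
  have htσ := ht.2
  simp only [Set.mem_ofPred_eq] at hsσ htσ
  set σ := 2 * θ.ε / θ.m with hσdef
  have hmσ : θ.m * σ = 2 * θ.ε := by rw [hσdef]; field_simp
  set p := x + σ • (t • e + y)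
  set q := x + σ • (s • e + y)
  have hpq : p - q = (σ * (t - s)) • e := by
    simp only [p, q, smul_add, smul_smul, mul_sub, sub_smul]
    abel
  rw [hpq, map_smul, heμ, norm_smul, he, mul_one, Real.norm_eq_abs, abs_mul, abs_of_pos hσ] at h1
  have h2 := ((abs_real_inner_le_norm (gradient f p - gradient f q - (σ * (t - s)) • μ • e)
    e).trans_eq (by rw [he, mul_one])).trans h1
  rw [inner_sub_left, inner_sub_left, real_inner_smul_left, real_inner_smul_left,
    real_inner_self_eq_norm_sq, he, one_pow, mul_one] at h2
  have h3 : σ * |t - s| * |μ| ≤ 2 * (θ.γ * θ.ε) + θ.m * (σ * |t - s|) := by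
    have e1 : σ * |t - s| * |μ| = |σ * (t - s) * μ| := by
      rw [abs_mul, abs_mul, abs_of_pos hσ]
    rw [e1]
    have h4 := abs_sub_abs_le_abs_sub (σ * (t - s) * μ)
      (inner ℝ (gradient f p) e - inner ℝ (gradient f q) e)
    have h5 := abs_sub (inner ℝ (gradient f p) e) (inner ℝ (gradient f q) e)
    rw [abs_sub_comm (σ * (t - s) * μ)] at h4
    linarith
  have h4 : 2 * θ.m ≤ |μ| := by rw [abs_of_neg (by linarith)]; linarith
  have h5 : 0 ≤ σ * |t - s| := by positivity
  have h6 : σ * |t - s| * (2 * θ.m) ≤ σ * |t - s| * |μ| := by gcongr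
  have h7 : 2 * θ.ε * |t - s| ≤ 2 * θ.ε * θ.γ := by
    have h8 : θ.m * (σ * |t - s|) ≤ 2 * (θ.γ * θ.ε) := by linarith
    calc 2 * θ.ε * |t - s| = θ.m * (σ * |t - s|) := by rw [← hmσ]; ring
      _ ≤ 2 * (θ.γ * θ.ε) := h8
      _ = _ := by ring
  have h8 := le_of_mul_le_mul_left h7 (by positivity)
  linarith [H.γ_mem.2]

/-- A perturbation `x + σ z` succeeds if `‖z‖ ^ 2 ≤ n` and the gradient at `x + σ z` has a component
larger than `γ ε` along an eigenvector with negative eigenvalue. -/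
theorem probBound_lt (hc : IsSaddle f c) (hxc : x ∈ nbhd θ c) (hx : ‖gradient f x‖ < θ.ε) :
    probBound n < (noiseLaw n θ).real {v | Accepted f θ (x + v) ∧ x + v ∈ goodRegion f θ c} := by
  have hn := H.one_le_sqrt hc
  obtain ⟨k, rfl⟩ : ∃ k, n = k + 1 := by
    refine ⟨n - 1, ?_⟩
    rw [Real.one_le_sqrt, Nat.one_le_cast] at hn
    omega
  obtain ⟨μ, hμ0, hμ⟩ := hc.2
  have hμ1 := H.nondegenerate c hc.1 μ hμ
  rw [abs_of_neg hμ0] at hμ1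
  obtain ⟨v, hv⟩ := Module.End.HasEigenvalue.exists_hasEigenvector hμ
  have hv0 : 0 < ‖v‖ := norm_pos_iff.2 hv.2
  set e : 𝔼 (k + 1) := ‖v‖⁻¹ • v with he_def
  have he : ‖e‖ = 1 := by
    rw [he_def, norm_smul, norm_inv, norm_norm, inv_mul_cancel₀ hv0.ne']
  have hve : hessian f c v = μ • v := hv.apply_eq_smul
  have heμ : hessian f c e = μ • e := by
    rw [he_def, map_smul, hve, smul_comm]
  have heU : e ∈ negEigenspace (hessian f c) :=
    Submodule.mem_iSup_of_mem (⟨μ, hμ0⟩ : {μ : ℝ // μ < 0}) (Module.End.mem_eigenspace_iff.2 heμ)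
  have hcont := continuous_gradient H.contDiff
  set S : Set (𝔼 (k + 1)) :=
    {z | |inner ℝ (gradient f (x + (2 * θ.ε / θ.m) • z)) e| ≤ θ.γ * θ.ε} with hS
  have hSm : MeasurableSet S := by
    refine (isClosed_le ?_ continuous_const).measurableSet
    fun_prop
  have h1 := lt_stdGaussian_ball_diff he hSm fun y => by
    have := H.volume_slice_le hc hxc hx he (by linarith) heμ y
    rwa [Nat.cast_add_one] at this
  have h2 := stdGaussian_real_norm_sq_le (d := k + 1) (by omega) (r := (k : ℝ) + 1) (by positivity)
  rw [h2] at h1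
  have h3 : probBound (k + 1) = 2 * (1 - cdf (gaussianReal 0 1) 1) *
      ((∫ t in (0 : ℝ)..(((k : ℝ) + 1) / 2), t ^ (((k + 1 : ℕ) : ℝ) / 2 - 1) * Real.exp (-t)) /
        Real.Gamma (((k + 1 : ℕ) : ℝ) / 2)) := by
    rw [probBound]
    push_cast
    rfl
  rw [h3]
  refine h1.trans_le ?_
  rw [noiseLaw_eq_map_stdGaussian]
  refine le_trans (measureReal_mono ?_) (ENNReal.toReal_mono (measure_ne_top _ _)
    (Measure.le_map_apply (by fun_prop) _))
  rintro z ⟨hzB, hzS⟩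
  have hz : ‖z‖ ^ 2 ≤ ((k + 1 : ℕ) : ℝ) := by
    rw [Nat.cast_add_one]
    exact hzB
  have hacc := H.accepted_of_norm_sq_le hx hz
  refine ⟨hacc, ?_⟩
  by_contra hng
  obtain ⟨h4, h5⟩ := H.small_of_accepted hacc
  refine hzS ?_
  refine le_trans ?_ (H.norm_gradNeg_le_of_notMem (H.add_mem_nbhd hc hxc hx hz) h4 h5 hng)
  have h6 : inner ℝ (gradient f (x + (2 * θ.ε / θ.m) • z)) e =
      inner ℝ (gradNeg f c (x + (2 * θ.ε / θ.m) • z)) e := by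
    have := Submodule.starProjection_inner_eq_zero (K := negEigenspace (hessian f c))
      (gradient f (x + (2 * θ.ε / θ.m) • z)) e heU
    rw [inner_sub_left, sub_eq_zero] at this
    exact this
  rw [h6]
  refine (abs_real_inner_le_norm _ _).trans ?_
  rw [he, mul_one]

end Standing

end Perturbation

/-! ### Measurability of the iterates -/

section Measurability

variable {n : ℕ} {f : EuclideanSpace ℝ (Fin n) → ℝ} {θ : Params}

local notation "𝔼" k:max => EuclideanSpace ℝ (Fin k)

theorem aeval_apply_of_eigenvector {T : 𝔼 n →L[ℝ] 𝔼 n} {v : 𝔼 n} {l : ℝ} (hv : T v = l • v)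
    (p : Polynomial ℝ) : Polynomial.aeval T p v = p.eval l • v := by
  induction p using Polynomial.induction_on' with
  | add p q hp hq => rw [map_add, add_apply, hp, hq, Polynomial.eval_add, add_smul]
  | monomial k a =>
    have hk : ∀ k : ℕ, (T ^ k) v = l ^ k • v := by
      intro k
      induction k with
      | zero => simp
      | succ k ih =>
        rw [pow_succ, mul_apply_eq_comp, hv, map_smul, ih, smul_smul, pow_succ']
    rw [Polynomial.aeval_monomial, Polynomial.eval_monomial, mul_apply_eq_comp, hk,
      Algebra.algebraMap_eq_smul_one, smul_apply, one_apply_eq_self, smul_smul]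

/-- The PT-inverse is a pointwise limit of polynomials in the operator. -/
theorem exists_polynomial_tendsto_ptInverse (n : ℕ) {m : ℝ} (hm : 0 < m) :
    ∃ p : ℕ → Polynomial ℝ, ∀ T : 𝔼 n →L[ℝ] 𝔼 n, T.toLinearMap.IsSymmetric → ∀ v,
      Filter.Tendsto (fun N => Polynomial.aeval T (p N) v) Filter.atTop
        (nhds (ptInverse m T v)) := by
  have hcont : Continuous fun t : ℝ => (max |t| m)⁻¹ :=
    (continuous_abs.max continuous_const).inv₀ fun t => (lt_max_of_lt_right hm).ne'
  choose p hp using fun N : ℕ => exists_polynomial_near_of_continuousOn (-(N : ℝ)) N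
    (fun t : ℝ => (max |t| m)⁻¹) hcont.continuousOn (1 / ((N : ℝ) + 1)) (by positivity)
  refine ⟨p, fun T hT v => ?_⟩
  obtain ⟨b, l, hb, -, hpt⟩ := exists_orthonormalBasis_eigenvectors hT
  have hlim : ∀ t : ℝ, Filter.Tendsto (fun N => (p N).eval t) Filter.atTop
      (nhds (max |t| m)⁻¹) := by
    intro t
    rw [tendsto_iff_dist_tendsto_zero]
    refine squeeze_zero' (Filter.Eventually.of_forall fun N => dist_nonneg) ?_
      tendsto_one_div_add_atTop_nhds_zero_nat
    obtain ⟨N₀, hN₀⟩ := exists_nat_ge |t|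
    filter_upwards [Filter.eventually_ge_atTop N₀] with N hN
    rw [Real.dist_eq]
    have h1 : |t| ≤ (N : ℝ) := hN₀.trans (Nat.cast_le.2 hN)
    exact (hp N t (abs_le.1 h1)).le
  have h1 : ∀ N, Polynomial.aeval T (p N) v =
      ∑ i, ((p N).eval (l i) * inner ℝ (b i) v) • b i := by
    intro N
    conv_lhs => rw [← b.sum_repr' v]
    rw [map_sum]
    refine Finset.sum_congr rfl fun i _ => ?_
    rw [map_smul, aeval_apply_of_eigenvector (hb i), smul_smul, mul_comm]
  simp_rw [h1, hpt]
  exact tendsto_finsetSum _ fun i _ => ((hlim (l i)).mul_const _).smul_const _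

theorem measurable_newtonDir (hf : ContDiff ℝ 2 f) (hm : 0 < θ.m) :
    Measurable (newtonDir f θ) := by
  obtain ⟨p, hp⟩ := exists_polynomial_tendsto_ptInverse n hm
  refine Measurable.neg ?_
  refine measurable_of_tendsto_metrizable
    (f := fun N x => Polynomial.aeval (hessian f x) (p N) (gradient f x)) (fun N => ?_)
    (tendsto_pi_nhds.2 fun x => hp _ (hessian_isSymmetric hf x) _)
  refine Continuous.measurable ?_
  exact (((p N).continuous_aeval).comp (continuous_hessian hf)).clm_apply (continuous_gradient hf)

theorem measurable_sInf_nat {α : Type*} [MeasurableSpace α] {p : ℕ → α → Prop}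
    (hp : ∀ j, MeasurableSet {x | p j x}) : Measurable fun x => sInf {j | p j x} := by
  refine measurable_of_Ioi fun k => ?_
  have h : (fun x => sInf {j | p j x}) ⁻¹' Set.Ioi k =
      (⋃ j, {x | p j x}) ∩ ⋂ i ∈ Set.Iic k, {x | p i x}ᶜ := by
    ext x
    simp only [Set.mem_preimage, Set.mem_Ioi, Set.mem_inter_iff, Set.mem_iUnion, Set.mem_iInter,
      Set.mem_compl_iff, Set.mem_ofPred_eq, Set.mem_Iic]
    constructor
    · intro hk
      have hne : {j | p j x}.Nonempty := by
        rw [Set.nonempty_iff_ne_empty]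
        intro h0
        rw [h0, Nat.sInf_empty] at hk
        omega
      exact ⟨hne, fun i hi hpi => by
        have : sInf {j | p j x} ≤ i := Nat.sInf_le hpi
        omega⟩
    · rintro ⟨hne, hi⟩
      by_contra! hk
      exact hi _ hk (Nat.sInf_mem (s := {j | p j x}) hne)
  rw [h]
  exact (MeasurableSet.iUnion hp).inter
    (MeasurableSet.biInter (Set.to_countable _) fun i _ => (hp i).compl)

theorem measurable_backtracks (hf : ContDiff ℝ 2 f) (hm : 0 < θ.m) :
    Measurable (backtracks f θ) := by
  have hd := measurable_newtonDir hf hm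
  have hg := (continuous_gradient hf).measurable
  have hfm := hf.continuous.measurable
  refine measurable_sInf_nat fun j => measurableSet_le ?_ ?_
  · exact hfm.comp (measurable_id.add (hd.const_smul (θ.β ^ j)))
  · exact hfm.add ((hg.inner hd).const_mul (θ.α * θ.β ^ j))

theorem measurable_ncnStep (hf : ContDiff ℝ 2 f) (hm : 0 < θ.m) :
    Measurable (ncnStep f θ) := by
  have hd := measurable_newtonDir hf hm
  have hb := measurable_backtracks hf hm
  exact measurable_id.add (((measurable_from_top (f := fun j : ℕ => θ.β ^ j)).comp hb).smul hd)

theorem isOpen_hasNegativeCurvature (hf : ContDiff ℝ 2 f) :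
    IsOpen {x | HasNegativeCurvature f x} := by
  have h : {x | HasNegativeCurvature f x} = ⋃ v : 𝔼 n, {x | inner ℝ (hessian f x v) v < 0} := by
    ext x
    simp only [Set.mem_ofPred_eq, Set.mem_iUnion]
    constructor
    · rintro ⟨μ, hμ0, hμ⟩
      obtain ⟨v, hv⟩ := Module.End.HasEigenvalue.exists_hasEigenvector hμ
      have h1 : hessian f x v = μ • v := hv.apply_eq_smul
      refine ⟨v, ?_⟩
      rw [h1, real_inner_smul_left, real_inner_self_eq_norm_sq]
      have := norm_pos_iff.2 hv.2
      exact mul_neg_of_neg_of_pos hμ0 (by positivity)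
    · rintro ⟨v, hv⟩
      exact exists_neg_eigenvalue_of_inner_neg (hessian_isSymmetric hf x) hv
  rw [h]
  refine isOpen_iUnion fun v => isOpen_lt ?_ continuous_const
  exact ((continuous_hessian hf).clm_apply continuous_const).inner continuous_const

theorem measurableSet_perturbs (hf : ContDiff ℝ 2 f) :
    MeasurableSet {s : 𝔼 n × ℕ | Perturbs f θ s} := by
  have hg := (continuous_gradient hf).measurable
  have h1 : MeasurableSet {s : 𝔼 n × ℕ | s.2 = 0} := measurable_snd (measurableSet_singleton 0)
  have h2 : MeasurableSet {s : 𝔼 n × ℕ | ‖gradient f s.1‖ < θ.ε} :=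
    measurableSet_lt (by fun_prop) measurable_const
  have h3 : MeasurableSet {s : 𝔼 n × ℕ | HasNegativeCurvature f s.1} :=
    measurable_fst (isOpen_hasNegativeCurvature hf).measurableSet
  exact h1.inter (h2.inter h3)

theorem measurableSet_accepted (hf : ContDiff ℝ 2 f) : MeasurableSet {y | Accepted f θ y} :=
  measurableSet_le (continuous_gradient hf).norm.measurable measurable_const

theorem measurableSet_goodRegion (hf : ContDiff ℝ 2 f) (c : 𝔼 n) :
    MeasurableSet (goodRegion f θ c) := by
  have hg := (continuous_gradient hf).norm.measurable
  have hP : Measurable fun x => ‖gradNeg f c x‖ :=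
    (((negSpace f c).starProjection.continuous.comp (continuous_gradient hf)).norm).measurable
  have h1 : MeasurableSet (nbhd θ c) := measurableSet_ball
  have h2 : MeasurableSet {x | θ.γ * θ.ε < ‖gradNeg f c x‖} := measurableSet_lt measurable_const hP
  have h3 : MeasurableSet {x | ‖gradient f x‖ < θ.ζ * θ.δ} := measurableSet_lt hg measurable_const
  have h4 : MeasurableSet {x | 5 * θ.L / (2 * θ.m ^ 2) * ‖gradient f x‖ ^ 2 ≤ ‖gradNeg f c x‖} :=
    measurableSet_le ((hg.pow_const 2).const_mul _) hP
  exact h1.inter (h2.inter (h3.inter h4))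

open Classical in
theorem measurable_iteration (hf : ContDiff ℝ 2 f) (hm : 0 < θ.m) :
    Measurable fun p : (𝔼 n × ℕ) × 𝔼 n => iteration f θ p.1 p.2 := by
  have hg := (continuous_gradient hf).measurable
  have hstep := measurable_ncnStep (θ := θ) hf hm
  refine Measurable.ite (measurable_fst (measurableSet_perturbs hf)) ?_ ?_
  · refine Measurable.ite ?_ ?_ measurable_fst
    · exact (measurable_fst.fst.add measurable_snd) (measurableSet_accepted hf)
    · exact (measurable_fst.fst.add measurable_snd).prodMk measurable_const
  · refine Measurable.ite ?_ measurable_fst ?_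
    · have h1 : MeasurableSet {p : (𝔼 n × ℕ) × 𝔼 n | p.1.2 = 0} :=
        measurable_fst.snd (measurableSet_singleton 0)
      have h2 : MeasurableSet {p : (𝔼 n × ℕ) × 𝔼 n | ‖gradient f p.1.1‖ < θ.ε} :=
        measurableSet_lt (by fun_prop) measurable_const
      exact h1.inter h2
    · exact (hstep.comp measurable_fst.fst).prodMk
        ((measurable_from_top (f := fun j : ℕ => j - 1)).comp measurable_fst.snd)

theorem measurable_state (hf : ContDiff ℝ 2 f) (hm : 0 < θ.m) (x₀ : 𝔼 n) (k : ℕ) :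
    Measurable fun v : ℕ → 𝔼 n => state f θ x₀ v k := by
  induction k with
  | zero => exact measurable_const
  | succ k ih => exact (measurable_iteration hf hm).comp (ih.prodMk (measurable_pi_apply k))

theorem state_congr {x₀ : 𝔼 n} {v v' : ℕ → 𝔼 n} {k : ℕ} (h : ∀ j < k, v j = v' j) :
    state f θ x₀ v k = state f θ x₀ v' k := by
  induction k with
  | zero => rfl
  | succ k ih =>
    rw [state, state, ih fun j hj => h j (by omega), h k (by omega)]

end Measurability

/-! ### The number of perturbations per saddle -/

section Counting

variable {n : ℕ} {f : EuclideanSpace ℝ (Fin n) → ℝ} {θ : Params}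

local notation "𝔼" k:max => EuclideanSpace ℝ (Fin k)

theorem exists_of_lt_count {p : ℕ → Prop} [DecidablePred p] {i k : ℕ} (h : i < Nat.count p k) :
    ∃ j < k, p j ∧ Nat.count p j = i := by
  induction k with
  | zero => simp at h
  | succ k ih =>
    rw [Nat.count_succ] at h
    by_cases hi : i < Nat.count p k
    · obtain ⟨j, hj, hj'⟩ := ih hi
      exact ⟨j, by omega, hj'⟩
    · by_cases hp : p k
      · rw [if_pos hp] at h
        exact ⟨k, by omega, hp, by omega⟩
      · rw [if_neg hp] at h
        omega

/-- The perturbation drawn in iteration `k` is accepted and puts the iterate into the good region of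
`c`. -/
def Succeeds (f : EuclideanSpace ℝ (Fin n) → ℝ) (θ : Params) (x₀ : EuclideanSpace ℝ (Fin n))
    (c : EuclideanSpace ℝ (Fin n)) (k : ℕ) (v : ℕ → EuclideanSpace ℝ (Fin n)) : Prop :=
  Accepted f θ (iterate f θ x₀ v k + v k) ∧ iterate f θ x₀ v k + v k ∈ goodRegion f θ c

/-- The noise sequences for which the draw number `i` (counted from `0`) at `c` happens in iteration
`k`, all earlier draws at `c` failed, and `c` is one of the first `S` saddles at which a
perturbation is drawn. -/
def failedBefore (f : EuclideanSpace ℝ (Fin n) → ℝ) (θ : Params) (x₀ : EuclideanSpace ℝ (Fin n))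
    (S : ℕ) (c : EuclideanSpace ℝ (Fin n)) (i k : ℕ) : Set (ℕ → EuclideanSpace ℝ (Fin n)) :=
  {v | DrawsAt f θ x₀ v c k ∧ numDraws f θ x₀ v c k = i ∧
    (∀ j < k, DrawsAt f θ x₀ v c j → ¬ Succeeds f θ x₀ c j v) ∧
    ∀ j ≤ k, DrawsAt f θ x₀ v c j → numDraws f θ x₀ v c j = 0 → (visited f θ x₀ v j).encard ≤ S}

variable {x₀ : EuclideanSpace ℝ (Fin n)} {S : ℕ} {c : EuclideanSpace ℝ (Fin n)}

theorem numDraws_succ_of_drawsAt {v : ℕ → 𝔼 n} {k : ℕ} (h : DrawsAt f θ x₀ v c k) :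
    numDraws f θ x₀ v c (k + 1) = numDraws f θ x₀ v c k + 1 := by
  classical
  rw [numDraws, Nat.count_succ, if_pos h]
  rfl

theorem numDraws_mono (v : ℕ → 𝔼 n) : Monotone (numDraws f θ x₀ v c) := by
  classical
  exact Nat.count_monotone _

theorem numDraws_lt_of_drawsAt {v : ℕ → 𝔼 n} {j k : ℕ} (h : DrawsAt f θ x₀ v c j) (hjk : j < k) :
    numDraws f θ x₀ v c j < numDraws f θ x₀ v c k := by
  have := numDraws_mono (f := f) (θ := θ) (x₀ := x₀) (c := c) v hjk
  rw [Nat.succ_eq_add_one, numDraws_succ_of_drawsAt h] at this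
  omega

theorem visited_mono (v : ℕ → 𝔼 n) : Monotone (visited f θ x₀ v) := fun _ _ h _ hc =>
  ⟨hc.1, let ⟨j, hj, hd⟩ := hc.2; ⟨j, hj.trans h, hd⟩⟩

section Congr

variable {v v' : ℕ → EuclideanSpace ℝ (Fin n)} {k : ℕ}

theorem drawsAt_congr (h : ∀ j < k, v j = v' j) :
    DrawsAt f θ x₀ v c k ↔ DrawsAt f θ x₀ v' c k := by
  rw [DrawsAt, DrawsAt, iterate, iterate, state_congr h]

theorem numDraws_congr (h : ∀ j < k, v j = v' j) :
    numDraws f θ x₀ v c k = numDraws f θ x₀ v' c k := by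
  classical
  rw [numDraws, numDraws, Nat.count_eq_card_filter_range, Nat.count_eq_card_filter_range]
  congr 1
  refine Finset.filter_congr fun j hj => drawsAt_congr fun i hi => h i ?_
  have := Finset.mem_range.1 hj
  omega

theorem visited_congr (h : ∀ j < k, v j = v' j) : visited f θ x₀ v k = visited f θ x₀ v' k := by
  ext c
  refine and_congr_right fun _ => exists_congr fun j => and_congr_right fun hj =>
    drawsAt_congr fun i hi => h i (by omega)

theorem succeeds_congr (h : ∀ j < k + 1, v j = v' j) :
    Succeeds f θ x₀ c k v ↔ Succeeds f θ x₀ c k v' := by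
  rw [Succeeds, Succeeds, iterate, iterate, state_congr fun j hj => h j (by omega),
    h k (by omega)]

theorem failedBefore_congr {i : ℕ} (h : ∀ j < k, v j = v' j) :
    v ∈ failedBefore f θ x₀ S c i k ↔ v' ∈ failedBefore f θ x₀ S c i k := by
  have h' : ∀ j ≤ k, ∀ i < j, v i = v' i := fun j hj i hi => h i (by omega)
  refine and_congr (drawsAt_congr h) (and_congr (by rw [numDraws_congr h]) (and_congr ?_ ?_))
  · refine forall_congr' fun j => forall_congr' fun hj => ?_
    rw [drawsAt_congr (h' j hj.le), succeeds_congr (h' (j + 1) hj)]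
  · refine forall_congr' fun j => forall_congr' fun hj => ?_
    rw [drawsAt_congr (h' j hj), numDraws_congr (h' j hj), visited_congr (h' j hj)]

end Congr

theorem Standing.countable_saddles (H : Standing f θ) : {c | IsSaddle f c}.Countable := by
  have hm := H.m_pos
  have hL := H.L_pos
  refine Set.PairwiseDisjoint.countable_of_isOpen
    (s := fun c => Metric.ball c (θ.m / (2 * θ.L))) ?_ (fun _ _ => Metric.isOpen_ball)
    (fun _ _ => Metric.nonempty_ball.2 (by positivity))
  intro c hc c' hc' hne
  refine Metric.ball_disjoint_ball ?_
  by_contra! h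
  have e : θ.m / (2 * θ.L) + θ.m / (2 * θ.L) = θ.m / θ.L := by field_simp; norm_num
  rw [e] at h
  have h1 := H.mul_norm_sub_le_norm_gradient hc'.1 (y := c) (Metric.mem_ball.2 h)
  rw [hc.1, norm_zero] at h1
  have h2 : 0 < ‖c - c'‖ := norm_pos_iff.2 (sub_ne_zero.2 hne)
  have : 0 < 3 * θ.m / 2 * ‖c - c'‖ := by positivity
  linarith

section Measurable

variable (hf : ContDiff ℝ 2 f) (hm : 0 < θ.m)

include hf hm

theorem measurableSet_drawsAt (k : ℕ) : MeasurableSet {v | DrawsAt f θ x₀ v c k} := by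
  have hs := measurable_state hf hm x₀ k
  exact (hs (measurableSet_perturbs hf)).inter
    (hs.fst (measurableSet_ball (x := c) (ε := θ.m / θ.L)))

theorem measurable_numDraws (k : ℕ) : Measurable fun v => numDraws f θ x₀ v c k := by
  classical
  induction k with
  | zero => simp only [numDraws, Nat.count_zero]; exact measurable_const
  | succ k ih =>
    simp only [numDraws, Nat.count_succ] at ih ⊢
    exact ih.add (Measurable.ite (measurableSet_drawsAt hf hm k) measurable_const measurable_const)

theorem measurableSet_succeeds (k : ℕ) : MeasurableSet {v | Succeeds f θ x₀ c k v} := by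
  have hs := (measurable_state hf hm x₀ k).fst.add (measurable_pi_apply k)
  exact (hs (measurableSet_accepted hf)).inter (hs (measurableSet_goodRegion hf c))

omit hf hm in
theorem lt_encard_visited_iff {v : ℕ → 𝔼 n} {k : ℕ} :
    (S : ℕ∞) < (visited f θ x₀ v k).encard ↔
      ∃ s : Finset {c // IsSaddle f c}, s.card = S + 1 ∧
        ∀ c ∈ s, ∃ j ≤ k, DrawsAt f θ x₀ v c j := by
  classical
  constructor
  · intro h
    obtain ⟨t, ht, htc⟩ := Set.exists_subset_encard_eq (Order.add_one_le_of_lt h)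
    have hfin : t.Finite := Set.finite_of_encard_eq_coe (k := S + 1) (by rw [htc]; push_cast; rfl)
    refine ⟨hfin.toFinset.subtype (IsSaddle f), ?_, fun c hc => ?_⟩
    · rw [Finset.card_subtype, Finset.filter_true_of_mem
        (fun c hc => (ht (hfin.mem_toFinset.1 hc)).1)]
      have h1 := hfin.encard_eq_coe_toFinset_card
      rw [htc] at h1
      exact_mod_cast h1.symm
    · rw [Finset.mem_subtype, hfin.mem_toFinset] at hc
      exact (ht hc).2
  · rintro ⟨s, hs, hd⟩
    have h1 : ((s.map (Function.Embedding.subtype _) : Finset (𝔼 n)) : Set (𝔼 n)) ⊆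
        visited f θ x₀ v k := by
      intro c hc
      rw [Finset.mem_coe, Finset.mem_map] at hc
      obtain ⟨c, hc, rfl⟩ := hc
      exact ⟨c.2, hd c hc⟩
    have h2 := Set.encard_le_encard h1
    rw [Set.encard_coe_eq_coe_finsetCard, Finset.card_map, hs] at h2
    refine lt_of_lt_of_le ?_ h2
    exact_mod_cast Nat.lt_succ_self S

theorem measurableSet_encard_visited_le [Countable {c // IsSaddle f c}] (k : ℕ) :
    MeasurableSet {v | (visited f θ x₀ v k).encard ≤ S} := by
  have h : {v | (visited f θ x₀ v k).encard ≤ S}ᶜ =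
      ⋃ s : {s : Finset {c // IsSaddle f c} // s.card = S + 1}, ⋂ c ∈ s.1,
        ⋃ j ∈ Set.Iic k, {v | DrawsAt f θ x₀ v c j} := by
    ext v
    simp only [Set.mem_compl_iff, Set.mem_ofPred_eq, not_le, lt_encard_visited_iff, Set.mem_iUnion,
      Set.mem_iInter, Set.mem_Iic, Subtype.exists, exists_prop]
  rw [← MeasurableSet.compl_iff, h]
  refine MeasurableSet.iUnion fun s => Finset.measurableSet_biInter _ fun c _ =>
    MeasurableSet.biUnion (Set.to_countable _) fun j _ => measurableSet_drawsAt hf hm j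

theorem measurableSet_failedBefore [Countable {c // IsSaddle f c}] (i k : ℕ) :
    MeasurableSet (failedBefore f θ x₀ S c i k) := by
  have h : failedBefore f θ x₀ S c i k = {v | DrawsAt f θ x₀ v c k} ∩
      ({v | numDraws f θ x₀ v c k = i} ∩
      ((⋂ j ∈ Set.Iio k, ({v | DrawsAt f θ x₀ v c j} ∩ {v | Succeeds f θ x₀ c j v})ᶜ) ∩
      ⋂ j ∈ Set.Iic k, (({v | DrawsAt f θ x₀ v c j} ∩ {v | numDraws f θ x₀ v c j = 0}) ∩
        {v | (visited f θ x₀ v j).encard ≤ S}ᶜ)ᶜ)) := by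
    ext v
    simp only [failedBefore, Set.mem_ofPred_eq, Set.mem_inter_iff, Set.mem_iInter, Set.mem_Iio,
      Set.mem_Iic, Set.mem_compl_iff, not_and, not_not, and_imp]
  rw [h]
  have hd := fun j => measurableSet_drawsAt (x₀ := x₀) (c := c) hf hm j
  have hn := fun j i => measurable_numDraws (x₀ := x₀) (c := c) hf hm j
    (measurableSet_singleton i)
  refine (hd k).inter ((hn k i).inter (MeasurableSet.inter ?_ ?_))
  · exact MeasurableSet.biInter (Set.to_countable _) fun j _ =>
      ((hd j).inter (measurableSet_succeeds hf hm j)).compl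
  · exact MeasurableSet.biInter (Set.to_countable _) fun j _ =>
      (((hd j).inter (hn j 0)).inter (measurableSet_encard_visited_le hf hm j).compl).compl

end Measurable

/-- If the iterate neither enters the good region of `c` in time nor is thrown out, then the first
`N` draws at `c` take place and fail. -/
theorem Standing.exists_mem_failedBefore (H : Standing f θ) (hc : IsSaddle f c) {v : ℕ → 𝔼 n}
    {N k : ℕ} (hk : DrawsAt f θ x₀ v c k) (hS : (visited f θ x₀ v k).encard ≤ S)
    (hgood : ¬ EntersGoodRegion f θ x₀ v c (N + 1)) (hout : ¬ ThrownOut f θ x₀ v c (N + 1)) :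
    ∃ k', v ∈ failedBefore f θ x₀ S c N k' ∧ ¬ Succeeds f θ x₀ c k' v := by
  classical
  have hfail : ∀ j, DrawsAt f θ x₀ v c j → numDraws f θ x₀ v c j ≤ N →
      ¬ Succeeds f θ x₀ c j v := by
    rintro j hj hjN ⟨hacc, hgr⟩
    refine hgood ⟨j + 1, ?_, ?_, ?_⟩
    · rw [iterate, state, iteration, if_pos hj.1,
        if_pos (show Accepted f θ ((state f θ x₀ v j).1 + v j) from hacc)]
      exact hgr
    · rw [numDraws_succ_of_drawsAt hj]
      omega
    · rw [numDraws_succ_of_drawsAt hj]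
      omega
  have hex : ∃ k', DrawsAt f θ x₀ v c k' ∧ numDraws f θ x₀ v c k' = N := by
    by_contra! hno
    have hle : ∀ j, numDraws f θ x₀ v c j ≤ N := by
      intro j
      by_contra! h
      obtain ⟨j', -, hj', hj''⟩ := exists_of_lt_count h
      exact hno j' hj' hj''
    -- among the draws, the one with the largest number is the last
    obtain ⟨k₀, hk₀, hlast⟩ : ∃ k₀, DrawsAt f θ x₀ v c k₀ ∧ ∀ j > k₀, ¬ DrawsAt f θ x₀ v c j := by
      by_contra! h
      have : ∀ i, ∃ j, DrawsAt f θ x₀ v c j ∧ i ≤ numDraws f θ x₀ v c j := by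
        intro i
        induction i with
        | zero => exact ⟨k, hk, Nat.zero_le _⟩
        | succ i ih =>
          obtain ⟨j, hj, hij⟩ := ih
          obtain ⟨j', hjj', hj'⟩ := h j hj
          have := numDraws_lt_of_drawsAt hj hjj'
          exact ⟨j', hj', by omega⟩
      obtain ⟨j, -, hj⟩ := this (N + 1)
      have := hle j
      omega
    by_cases hn : iterate f θ x₀ v (k₀ + 1) ∈ nbhd θ c
    · obtain ⟨k', hk', -, h | h⟩ := H.exists_goodRegion_or_drawsAt hc hk₀ hn
      · refine hgood ⟨k', h, ?_, ?_⟩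
        · have := numDraws_lt_of_drawsAt hk₀ hk'
          omega
        · have := hle k'
          omega
      · exact hlast k' hk' h
    · refine hout ⟨k₀, hk₀, hn, hlast, ?_⟩
      have := hle (k₀ + 1)
      omega
  obtain ⟨k', hk', hN⟩ := hex
  refine ⟨k', ⟨hk', hN, fun j hj hd => hfail j hd ?_, fun j hj hd h0 => ?_⟩, hfail k' hk' hN.le⟩
  · have := numDraws_mono (f := f) (θ := θ) (x₀ := x₀) (c := c) v hj.le
    omega
  · have hjk : j ≤ k := by
      by_contra! h
      have := numDraws_lt_of_drawsAt hk h
      omega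
    exact (Set.encard_le_encard (visited_mono v hjk)).trans hS

theorem pairwise_disjoint_failedBefore (i : ℕ) :
    Pairwise (Function.onFun Disjoint (failedBefore f θ x₀ S c i)) := by
  have h : ∀ k k', k < k' → ∀ v, v ∈ failedBefore f θ x₀ S c i k →
      v ∉ failedBefore f θ x₀ S c i k' := by
    rintro k k' hk v ⟨h1, h2, -⟩ ⟨h1', h2', -⟩
    have := numDraws_lt_of_drawsAt h1 hk
    omega
  intro k k' hk
  rw [Function.onFun, Set.disjoint_left]
  intro v hv hv'
  rcases Nat.lt_or_gt_of_ne hk with hk | hk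
  · exact h _ _ hk v hv hv'
  · exact h _ _ hk v hv' hv

theorem failedBefore_succ_subset (i k : ℕ) :
    failedBefore f θ x₀ S c (i + 1) k ⊆
      ⋃ j, failedBefore f θ x₀ S c i j ∩ {v | ¬ Succeeds f θ x₀ c j v} := by
  classical
  rintro v ⟨h1, h2, h3, h4⟩
  have hlt : i < numDraws f θ x₀ v c k := by omega
  obtain ⟨j, hj, hd, hji⟩ := exists_of_lt_count hlt
  refine Set.mem_iUnion.2 ⟨j, ⟨hd, hji, fun l hl => h3 l (by omega), fun l hl => h4 l (by omega)⟩,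
    h3 j hj hd⟩

/-- At most `S` saddles are among the first `S` saddles at which a perturbation is drawn. -/
theorem card_le_of_mem_failedBefore_zero {v : ℕ → 𝔼 n} (s : Finset {c // IsSaddle f c})
    (hs : ∀ c ∈ s, ∃ k, v ∈ failedBefore f θ x₀ S c 0 k) : s.card ≤ S := by
  classical
  rcases s.eq_empty_or_nonempty with rfl | hne
  · simp
  choose! k hk using hs
  obtain ⟨c₀, hc₀, hmax⟩ := s.exists_max_image k hne
  have h1 : ((s.map (Function.Embedding.subtype _) : Finset (𝔼 n)) : Set (𝔼 n)) ⊆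
      visited f θ x₀ v (k c₀) := by
    intro c hc
    rw [Finset.mem_coe, Finset.mem_map] at hc
    obtain ⟨c, hc, rfl⟩ := hc
    exact ⟨c.2, k c, hmax c hc, (hk c hc).1⟩
  have h2 := Set.encard_le_encard h1
  rw [Set.encard_coe_eq_coe_finsetCard, Finset.card_map] at h2
  obtain ⟨h3, h4, -, h5⟩ := hk c₀ hc₀
  exact_mod_cast h2.trans (h5 _ le_rfl h3 h4)

section Probability

open scoped ENNReal

variable {Ω : Type*} [MeasurableSpace Ω] {P : Measure Ω} [IsProbabilityMeasure P]
  {X : ℕ → Ω → EuclideanSpace ℝ (Fin n)} {q : ℝ}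

/-- The noise drawn in iteration `k` is independent of the past, so that a draw fails with
conditional probability at most `1 - q`. -/
theorem Standing.measure_failedBefore_inter_le (H : Standing f θ) (hc : IsSaddle f c)
    (hq : IsSuccessBound f θ q) (hX : ∀ k, Measurable (X k)) (hind : iIndepFun X P)
    (hlaw : ∀ k, P.map (X k) = noiseLaw n θ) (i k : ℕ) :
    P ((fun ω j => X j ω) ⁻¹' (failedBefore f θ x₀ S c i k ∩ {v | ¬ Succeeds f θ x₀ c k v})) ≤
      ENNReal.ofReal (1 - q) * P ((fun ω j => X j ω) ⁻¹' failedBefore f θ x₀ S c i k) := by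
  have hf := H.contDiff
  have hm := H.m_pos
  have : Countable {c // IsSaddle f c} := H.countable_saddles.to_subtype
  -- the past, and its extension by `0` to a noise sequence
  set h : Ω → (Finset.range k → 𝔼 n) := fun ω j => X j ω with hh
  set ext : (Finset.range k → 𝔼 n) → ℕ → 𝔼 n :=
    fun g j => if hj : j ∈ Finset.range k then g ⟨j, hj⟩ else 0 with hext
  have hhm : Measurable h := measurable_pi_lambda _ fun j => hX j
  have hextm : Measurable ext := by
    refine measurable_pi_lambda _ fun j => ?_
    by_cases hj : j ∈ Finset.range k
    · simp only [hext, dif_pos hj]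
      exact measurable_pi_apply _
    · simp only [hext, dif_neg hj]
      exact measurable_const
  have hagree : ∀ ω, ∀ j < k, (fun j => X j ω) j = ext (h ω) j := by
    intro ω j hj
    simp [hext, hh, hj]
  have hindep : IndepFun h (X k) P := by
    have h1 := hind.indepFun_finset (Finset.range k) {k} (by simp) hX
    exact h1.comp measurable_id (measurable_pi_apply (⟨k, by simp⟩ : ({k} : Finset ℕ)))
  have hprod := hindep.map_prod_eq_prod_map_map hhm.aemeasurable (hX k).aemeasurable
  rw [hlaw k] at hprod
  set A' : Set (Finset.range k → 𝔼 n) := ext ⁻¹' failedBefore f θ x₀ S c i k with hA'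
  have hA'm : MeasurableSet A' := hextm (measurableSet_failedBefore hf hm i k)
  have hy : Measurable fun g => iterate f θ x₀ (ext g) k :=
    ((measurable_state hf hm x₀ k).fst).comp hextm
  have hgood : MeasurableSet {y | Accepted f θ y ∧ y ∈ goodRegion f θ c} :=
    (measurableSet_accepted hf).inter (measurableSet_goodRegion hf c)
  set D : Set ((Finset.range k → 𝔼 n) × 𝔼 n) :=
    {p | p.1 ∈ A' ∧ iterate f θ x₀ (ext p.1) k + p.2 ∉
      {y | Accepted f θ y ∧ y ∈ goodRegion f θ c}} with hD
  have hDm : MeasurableSet D :=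
    (measurable_fst hA'm).inter
      (((hy.comp measurable_fst).add measurable_snd) hgood.compl)
  have e1 : (fun ω j => X j ω) ⁻¹' failedBefore f θ x₀ S c i k = h ⁻¹' A' := by
    ext ω
    exact failedBefore_congr (hagree ω)
  have e2 : (fun ω j => X j ω) ⁻¹' (failedBefore f θ x₀ S c i k ∩ {v | ¬ Succeeds f θ x₀ c k v}) =
      (fun ω => (h ω, X k ω)) ⁻¹' D := by
    rw [Set.preimage_inter, e1]
    ext ω
    simp only [Set.mem_inter_iff, Set.mem_preimage, Set.mem_ofPred_eq, hD, Succeeds, iterate,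
      state_congr (hagree ω)]
  rw [e2, e1, ← Measure.map_apply (hhm.prodMk (hX k)) hDm, ← Measure.map_apply hhm hA'm, hprod,
    Measure.prod_apply hDm]
  calc ∫⁻ g, noiseLaw n θ (Prod.mk g ⁻¹' D) ∂(P.map h)
      ≤ ∫⁻ g, A'.indicator (fun _ => ENNReal.ofReal (1 - q)) g ∂(P.map h) := by
        refine lintegral_mono fun g => ?_
        by_cases hg : g ∈ A'
        · rw [Set.indicator_of_mem hg]
          set x := iterate f θ x₀ (ext g) k with hx
          have hdraw : DrawsAt f θ x₀ (ext g) c k := hg.1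
          have h1 := hq c hc x hdraw.2 hdraw.1.2.1
          have hWm : MeasurableSet {w | Accepted f θ (x + w) ∧ x + w ∈ goodRegion f θ c} :=
            (measurable_const.add measurable_id) hgood
          have e3 : Prod.mk g ⁻¹' D = {w | Accepted f θ (x + w) ∧ x + w ∈ goodRegion f θ c}ᶜ := by
            ext w
            simp [hD, hg, hx]
          rw [e3, ← ofReal_measureReal, probReal_compl_eq_one_sub hWm]
          exact ENNReal.ofReal_le_ofReal (by linarith)
        · have e3 : Prod.mk g ⁻¹' D = ∅ := by
            ext w
            simp [hD, hg]
          rw [e3, measure_empty]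
          exact zero_le
    _ = ENNReal.ofReal (1 - q) * P.map h A' := by
        rw [lintegral_indicator hA'm, setLIntegral_const]

theorem Standing.tsum_failedBefore_succ_le (H : Standing f θ) (hc : IsSaddle f c)
    (hq : IsSuccessBound f θ q) (hX : ∀ k, Measurable (X k)) (hind : iIndepFun X P)
    (hlaw : ∀ k, P.map (X k) = noiseLaw n θ) (i : ℕ) :
    ∑' k, P ((fun ω j => X j ω) ⁻¹' failedBefore f θ x₀ S c (i + 1) k) ≤
      ENNReal.ofReal (1 - q) *
        ∑' k, P ((fun ω j => X j ω) ⁻¹' failedBefore f θ x₀ S c i k) := by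
  have : Countable {c // IsSaddle f c} := H.countable_saddles.to_subtype
  have hXm : Measurable fun ω j => X j ω := measurable_pi_lambda _ hX
  rw [← measure_iUnion (fun k k' hk => (pairwise_disjoint_failedBefore (i + 1) hk).preimage _)
    (fun k => hXm (measurableSet_failedBefore H.contDiff H.m_pos (i + 1) k)),
    ← ENNReal.tsum_mul_left]
  refine (measure_mono ?_).trans ((measure_iUnion_le fun k => (fun ω j => X j ω) ⁻¹'
    (failedBefore f θ x₀ S c i k ∩ {v | ¬ Succeeds f θ x₀ c k v})).trans
    (ENNReal.tsum_le_tsum fun k => H.measure_failedBefore_inter_le hc hq hX hind hlaw i k))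
  refine Set.iUnion_subset fun k => ?_
  rw [← Set.preimage_iUnion]
  exact Set.preimage_mono (failedBefore_succ_subset i k)

theorem Standing.tsum_failedBefore_le (H : Standing f θ) (hc : IsSaddle f c)
    (hq : IsSuccessBound f θ q) (hX : ∀ k, Measurable (X k)) (hind : iIndepFun X P)
    (hlaw : ∀ k, P.map (X k) = noiseLaw n θ) (i : ℕ) :
    ∑' k, P ((fun ω j => X j ω) ⁻¹' failedBefore f θ x₀ S c i k) ≤
      ENNReal.ofReal (1 - q) ^ i *
        ∑' k, P ((fun ω j => X j ω) ⁻¹' failedBefore f θ x₀ S c 0 k) := by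
  induction i with
  | zero => simp
  | succ i ih =>
    refine (H.tsum_failedBefore_succ_le hc hq hX hind hlaw i).trans ?_
    rw [pow_succ', mul_assoc]
    gcongr

/-- The expected number of saddles that are among the first `S` ones is at most `S`. -/
theorem Standing.tsum_tsum_failedBefore_zero_le (H : Standing f θ) (hX : ∀ k, Measurable (X k)) :
    ∑' c : {c // IsSaddle f c}, ∑' k,
      P ((fun ω j => X j ω) ⁻¹' failedBefore f θ x₀ S c 0 k) ≤ S := by
  have : Countable {c // IsSaddle f c} := H.countable_saddles.to_subtype
  have hXm : Measurable fun ω j => X j ω := measurable_pi_lambda _ hX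
  set Q : {c // IsSaddle f c} → Set Ω := fun c =>
    ⋃ k, (fun ω j => X j ω) ⁻¹' failedBefore f θ x₀ S c 0 k with hQ
  have hQm : ∀ c, MeasurableSet (Q c) := fun c =>
    MeasurableSet.iUnion fun k => hXm (measurableSet_failedBefore H.contDiff H.m_pos 0 k)
  have h1 : ∀ c : {c // IsSaddle f c},
      ∑' k, P ((fun ω j => X j ω) ⁻¹' failedBefore f θ x₀ S c 0 k) =
        ∫⁻ ω, (Q c).indicator 1 ω ∂P := by
    intro c
    rw [lintegral_indicator_one (hQm c), hQ,
      measure_iUnion (fun k k' hk => (pairwise_disjoint_failedBefore 0 hk).preimage _)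
        (fun k => hXm (measurableSet_failedBefore H.contDiff H.m_pos 0 k))]
  simp_rw [h1]
  rw [← lintegral_tsum fun c => (measurable_one.indicator (hQm c)).aemeasurable]
  calc ∫⁻ ω, ∑' c, (Q c).indicator 1 ω ∂P ≤ ∫⁻ _, (S : ℝ≥0∞) ∂P := by
        refine lintegral_mono fun ω => ?_
        rw [ENNReal.tsum_eq_iSup_sum]
        refine iSup_le fun s => ?_
        classical
        have h2 : ∑ c ∈ s, (Q c).indicator (1 : Ω → ℝ≥0∞) ω =
            ((s.filter fun c => ω ∈ Q c).card : ℝ≥0∞) := by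
          rw [Finset.card_filter, Nat.cast_sum]
          refine Finset.sum_congr rfl fun c _ => ?_
          rw [Set.indicator_apply]
          split_ifs <;> simp
        rw [h2]
        refine Nat.cast_le.2 (card_le_of_mem_failedBefore_zero (f := f) (θ := θ) (x₀ := x₀)
          (v := fun j => X j ω) _ fun c hc => ?_)
        have h3 : ω ∈ Q c := (Finset.mem_filter.1 hc).2
        obtain ⟨k, hk⟩ := Set.mem_iUnion.1 h3
        exact ⟨k, hk⟩
    _ = S := by simp

theorem drawBound_pos {p : ℝ} (hq0 : 0 < q) (hq1 : q < 1) (hp0 : 0 < p) (hp1 : p < 1) (hS : 1 ≤ S) :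
    0 < drawBound S p q := by
  have hS' : (1 : ℝ) ≤ S := Nat.one_le_cast.2 hS
  refine Nat.ceil_pos.2 (div_pos (Real.log_pos ?_) (Real.log_pos ?_))
  · rw [lt_div_iff₀ hp0]
    linarith
  · rw [lt_div_iff₀ (by linarith)]
    linarith

theorem pow_drawBound_mul_le {p : ℝ} (hq0 : 0 < q) (hq1 : q < 1) (hp0 : 0 < p) (hS : 1 ≤ S) :
    (1 - q) ^ drawBound S p q * S ≤ p := by
  have hS' : (0 : ℝ) < S := Nat.cast_pos.2 hS
  have h1 : 0 < Real.log (1 / (1 - q)) := Real.log_pos (by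
    rw [lt_div_iff₀ (by linarith)]
    linarith)
  have h2 : Real.log (S / p) / Real.log (1 / (1 - q)) ≤ drawBound S p q := Nat.le_ceil _
  generalize drawBound S p q = N at h2 ⊢
  rw [div_le_iff₀ h1, ← Real.log_pow,
    Real.log_le_log_iff (by positivity) (pow_pos (by rw [one_div, inv_pos]; linarith) _),
    one_div, inv_pow, div_le_iff₀ hp0, inv_mul_eq_div, le_div_iff₀ (pow_pos (by linarith) _)] at h2
  rw [mul_comm]
  exact h2

/-- Union bound over the first `S` saddles: the first `drawBound S p q` draws at one of them all
fail with probability at most `S (1 - q) ^ drawBound S p q ≤ p`. -/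
theorem Standing.le_measureReal_enters (H : Standing f θ) {p : ℝ} (hq0 : 0 < q) (hq1 : q < 1)
    (hq : IsSuccessBound f θ q) (hp0 : 0 < p) (hp1 : p < 1) (hS : 1 ≤ S)
    (hX : ∀ k, Measurable (X k)) (hind : iIndepFun X P)
    (hlaw : ∀ k, P.map (X k) = noiseLaw n θ) (x₀ : 𝔼 n) :
    1 - p ≤ P.real {ω | ∀ c k, IsSaddle f c → DrawsAt f θ x₀ (fun i => X i ω) c k →
      (visited f θ x₀ (fun i => X i ω) k).encard ≤ S →
      EntersGoodRegion f θ x₀ (fun i => X i ω) c (drawBound S p q) ∨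
        ThrownOut f θ x₀ (fun i => X i ω) c (drawBound S p q)} := by
  have : Countable {c // IsSaddle f c} := H.countable_saddles.to_subtype
  obtain ⟨N, hN⟩ : ∃ N, drawBound S p q = N + 1 :=
    ⟨drawBound S p q - 1, by have := drawBound_pos hq0 hq1 hp0 hp1 hS; omega⟩
  set W : Set Ω := {ω | ∀ c k, IsSaddle f c → DrawsAt f θ x₀ (fun i => X i ω) c k →
      (visited f θ x₀ (fun i => X i ω) k).encard ≤ S →
      EntersGoodRegion f θ x₀ (fun i => X i ω) c (drawBound S p q) ∨
        ThrownOut f θ x₀ (fun i => X i ω) c (drawBound S p q)} with hW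
  have hsub : Wᶜ ⊆ ⋃ c : {c // IsSaddle f c}, ⋃ k, (fun ω j => X j ω) ⁻¹'
      (failedBefore f θ x₀ S c N k ∩ {v | ¬ Succeeds f θ x₀ c k v}) := by
    intro ω hω
    rw [Set.mem_compl_iff, hW, Set.mem_ofPred_eq] at hω
    push Not at hω
    obtain ⟨c, k, hc, hk, hvis, hgood, hout⟩ := hω
    rw [hN] at hgood hout
    obtain ⟨k', h1, h2⟩ := H.exists_mem_failedBefore hc hk hvis hgood hout
    exact Set.mem_iUnion.2 ⟨⟨c, hc⟩, Set.mem_iUnion.2 ⟨k', h1, h2⟩⟩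
  have hbound : P Wᶜ ≤ ENNReal.ofReal p := by
    calc P Wᶜ ≤ ∑' c : {c // IsSaddle f c}, ∑' k, P ((fun ω j => X j ω) ⁻¹'
          (failedBefore f θ x₀ S c N k ∩ {v | ¬ Succeeds f θ x₀ c k v})) :=
          (measure_mono hsub).trans ((measure_iUnion_le _).trans
            (ENNReal.tsum_le_tsum fun c => measure_iUnion_le _))
      _ ≤ ∑' c : {c // IsSaddle f c}, ENNReal.ofReal (1 - q) ^ (N + 1) *
          ∑' k, P ((fun ω j => X j ω) ⁻¹' failedBefore f θ x₀ S c 0 k) := by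
          refine ENNReal.tsum_le_tsum fun c => ?_
          refine (ENNReal.tsum_le_tsum fun k =>
            H.measure_failedBefore_inter_le c.2 hq hX hind hlaw N k).trans ?_
          rw [ENNReal.tsum_mul_left, pow_succ', mul_assoc]
          gcongr
          exact H.tsum_failedBefore_le c.2 hq hX hind hlaw N
      _ ≤ ENNReal.ofReal (1 - q) ^ (N + 1) * S := by
          rw [ENNReal.tsum_mul_left]
          gcongr
          exact H.tsum_tsum_failedBefore_zero_le hX
      _ ≤ ENNReal.ofReal p := by
          rw [← hN, ← ENNReal.ofReal_pow (by linarith), ← ENNReal.ofReal_natCast,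
            ← ENNReal.ofReal_mul (pow_nonneg (by linarith) _)]
          exact ENNReal.ofReal_le_ofReal (pow_drawBound_mul_le hq0 hq1 hp0 hS)
  -- `W` need not be measurable: only subadditivity is used
  have h1 : (1 : ℝ) ≤ P.real W + P.real Wᶜ := by
    have := measureReal_union_le (μ := P) W Wᶜ
    rwa [Set.union_compl_self, probReal_univ] at this
  have h2 : P.real Wᶜ ≤ p := by
    rw [measureReal_def]
    exact ENNReal.toReal_le_of_le_ofReal hp0.le hbound
  linarith

end Probability

end Counting

end NonconvexNewton

theorem mainTheorem4 {Ω : Type*} [MeasurableSpace Ω] (P : Measure Ω) [IsProbabilityMeasure P]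
    {n : ℕ} (f : EuclideanSpace ℝ (Fin n) → ℝ) (θ : NonconvexNewton.Params)
    (hf : ContDiff ℝ 2 f)
    (hm : 0 < θ.m) (hM : 0 < θ.M) (hL : 0 < θ.L)
    (hLipGrad : ∀ x y, ‖gradient f x - gradient f y‖ ≤ θ.M * ‖x - y‖)
    (hLipHess : ∀ x y,
      ‖NonconvexNewton.hessian f x - NonconvexNewton.hessian f y‖ ≤ θ.L * ‖x - y‖)
    (hNondeg : ∀ c, gradient f c = 0 →
      ∀ μ, NonconvexNewton.IsHessianEigenvalue f c μ → 2 * θ.m < |μ|)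
    (hα : 0 < θ.α ∧ θ.α < 1 / 2) (hβ : 0 < θ.β ∧ θ.β < 1)
    (hγ : 0 < θ.γ ∧ θ.γ < 1) (hζ : 0 < θ.ζ ∧ θ.ζ < 1)
    (hδ : 0 < θ.δ ∧ θ.δ ≤ 3 * θ.m ^ 2 / θ.L * (1 - 2 * θ.α) ∧ θ.δ ≤ θ.m ^ 2 / (5 * θ.L))
    (hε : 0 < θ.ε)
    (hε₁ : θ.ε < θ.ζ * θ.δ * θ.m / (2 * θ.M * √n + θ.m))
    (hε₂ : θ.ε < 2 * θ.m ^ 4 * θ.γ / (5 * θ.L * (2 * θ.M * √n + θ.m) ^ 2)) :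
    -- a single perturbation succeeds with probability larger than the explicit bound
    (∀ c, NonconvexNewton.IsSaddle f c → ∀ x ∈ NonconvexNewton.nbhd θ c,
      ‖gradient f x‖ < θ.ε →
      NonconvexNewton.probBound n < (NonconvexNewton.noiseLaw n θ).real
        {v | NonconvexNewton.Accepted f θ (x + v) ∧
          x + v ∈ NonconvexNewton.goodRegion f θ c}) ∧
    -- exponential escape from the good region
    (∀ c, NonconvexNewton.IsSaddle f c → ∀ y ∈ NonconvexNewton.goodRegion f θ c, ∀ k : ℕ,
      (∀ j ≤ k, ‖gradient f ((NonconvexNewton.ncnStep f θ)^[j] y)‖ < θ.ζ * θ.δ) →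
      (2 - θ.ζ) ^ k * (θ.γ * θ.ε) <
        ‖NonconvexNewton.gradNeg f c ((NonconvexNewton.ncnStep f θ)^[k + 1] y)‖) ∧
    -- after a perturbation that does not carry the iterate out of the neighbourhood of the saddle,
    -- the iterate soon enters the good region or is perturbed again
    (∀ (x₀ : EuclideanSpace ℝ (Fin n)) (v : ℕ → EuclideanSpace ℝ (Fin n)) (c),
      NonconvexNewton.IsSaddle f c →
      ∀ k, NonconvexNewton.DrawsAt f θ x₀ v c k →
        NonconvexNewton.iterate f θ x₀ v (k + 1) ∈ NonconvexNewton.nbhd θ c →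
        ∃ k', k < k' ∧ k' ≤ k + NonconvexNewton.waitSteps θ + 2 ∧
          (NonconvexNewton.iterate f θ x₀ v k' ∈ NonconvexNewton.goodRegion f θ c ∨
            NonconvexNewton.DrawsAt f θ x₀ v c k')) ∧
    -- number of perturbations per saddle
    (∀ q : ℝ, 0 < q → q < 1 → NonconvexNewton.IsSuccessBound f θ q →
      ∀ p : ℝ, 0 < p → p < 1 → ∀ S : ℕ, 1 ≤ S →
      ∀ X : ℕ → Ω → EuclideanSpace ℝ (Fin n),
        (∀ k, Measurable (X k)) → iIndepFun X P →
        (∀ k, P.map (X k) = NonconvexNewton.noiseLaw n θ) →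
        ∀ x₀ : EuclideanSpace ℝ (Fin n),
          1 - p ≤ P.real {ω | ∀ c k,
            NonconvexNewton.IsSaddle f c →
            NonconvexNewton.DrawsAt f θ x₀ (fun i => X i ω) c k →
            (NonconvexNewton.visited f θ x₀ (fun i => X i ω) k).encard ≤ S →
            NonconvexNewton.EntersGoodRegion f θ x₀ (fun i => X i ω) c
                (NonconvexNewton.drawBound S p q) ∨
              NonconvexNewton.ThrownOut f θ x₀ (fun i => X i ω) c
                (NonconvexNewton.drawBound S p q)}) := by
  have H : NonconvexNewton.Standing f θ :=
    ⟨hf, hm, hM, hL, hLipGrad, hLipHess, hNondeg, hα, hγ, hζ, hδ, hε, hε₁, hε₂⟩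
  refine ⟨fun c hc x hxc hx => H.probBound_lt hc hxc hx,
    fun c hc y hy k hk => (H.lt_norm_gradNeg_iterate hc.1 hy k hk).2.2,
    fun x₀ v c hc k hk hk1 => H.exists_goodRegion_or_drawsAt hc hk hk1,
    fun q hq0 hq1 hq p hp0 hp1 S hS X hX hind hlaw x₀ =>
      H.le_measureReal_enters hq0 hq1 hq hp0 hp1 hS hX hind hlaw x₀⟩
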